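/- Let $n\ge 5$, $N\ge 0$, and let $C^a_{bc}$ ($1\le a,b,c\le N$) be real constants with $C^a_{bc}=-C^a_{cb}$ (for instance the constant structure coefficients of an orthonormal frame on the target manifold). Put $\Gamma^a_{bc}=\tfrac12(C^a_{bc}+C^b_{ac}+C^c_{ab})$. On $\mathbb R\times\mathbb R^n$ use the Minkowski metric $m=\mathrm{diag}(-1,1,\dots,1)$, $\partial^\mu=m^{\mu\nu}\partial_\nu$, $\Box=\partial^\mu\partial_\mu$, and sum over repeated indices. Fix a non-negative smooth bump function $\eta$ on $\mathbb R^n$ supported in $|\xi|\le2$ and equal to $1$ on $|\xi|\le 1$. Let $P_{\le k}$ be the Fourier multiplier in $x$ with symbol $\eta(2^{-k}\xi)$, in the convention $\int e^{ix\cdot\xi}\eta(2^{-k}\xi)\hat f(\xi)\,d\xi$ with the inversion normalization, and $P_k=P_{\le k}-P_{\le k-1}$ ($k\in\mathbb Z$), acting componentwise. For $0<T<\infty$ put $$\|\Phi\|_{S_k}=\sup_{(q,r)\in\mathcal A}2^{k(\frac1q+\frac nr-1)}\Big(\|\Phi\|_{L^q_tL^r_x([0,T]\times\mathbb R^n)}+2^{-k}\|\partial_t\Phi\|_{L^q_tL^r_x([0,T]\times\mathbb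 R^n)}\Big),$$ $$\mathcal A=\{(q,r):2\le q,r\le\infty,\ \tfrac1q+\tfrac{n-1}{2r}\le\tfrac{n-1}4\},$$ where an array is measured pointwise by the maximum of the absolute values of its entries. Let $0<\sigma<\min(\frac12,\frac{n-4}4)$ and $A\in\mathbb R$. A frequency envelope is a non-negative sequence $c=(c_k)_{k\in\mathbb Z}\in\ell^2$ with $c_k\le A\,2^{\sigma|k-k'|}c_{k'}$ for all $k,k'$. Then there is $C_0>0$ such that for every $C\ge C_0$ there is $\varepsilon_0>0$ such that the following holds for all $0<\varepsilon\le\varepsilon_0$, all frequency envelopes $c$ with $\|c\|_{\ell^2}\le\varepsilon$, and all $0<T<\infty$ (here $C_0$ and $\varepsilon_0$ do not depend on $\varepsilon,c,T,\Phi$). Let $\Phi=(\phi^a_\alpha)_{1\le a\le N,\,0\le\alpha\le n}$ be a real-valued array, twice continuously differentiable on $(0,T)\times\mathbb R^n$, with $\sup_{0<t<T}\|\Phi(t)\|_{L^2(\mathbb R^n)}<\infty$, which solves $$\partial_\beta\phi^a_\alpha-\partial_\alpha\phi^a_\beta=C^a_{bc}\,\phi^b_\alpha\phi^c_\beta,\qquad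 \partial^\alpha\phi^a_\alpha=-\Gamma^a_{bc}\,\phi^b_\beta\phi^c_\gamma\, m^{\beta\gamma}$$ on $(0,T)\times\mathbb R^n$ and satisfies the bootstrap assumption $$\|P_k\Phi\|_{S_k}\le 2C c_k\qquad\text{for all }k\in\mathbb Z.$$ Let $R_\mu=(R^a_{b\mu})_{a,b=1}^N$, $R^a_{b\mu}=\Gamma^a_{cb}\phi^c_\mu$, and $\tilde R_\mu=P_{\le-10}R_\mu$. Then: (i) $\tilde R_\mu=\Gamma\cdot P_{\le-10}\Phi_\mu$, that is, $\tilde R^a_{b\mu}=\Gamma^a_{cb}\,P_{\le-10}\phi^c_\mu$, and the $N\times N$ matrices $\tilde R_\mu$ are antisymmetric, $\tilde R_\mu^{\,t}=-\tilde R_\mu$; (ii) $\Psi=P_0\Phi=(\psi^a_\alpha)$ is twice continuously differentiable on $(0,T)\times\mathbb R^n$ and satisfies there $$\Box\Psi=-2\tilde R_\mu\cdot\partial^\mu\Psi+F,\qquad\text{that is,}\qquad \Box\psi^a_\alpha=-2\tilde R^a_{b\mu}\,\partial^\mu\psi^b_\alpha+F^a_\alpha,$$ where $F$ is an acceptable error: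 $F$ is measurable and $\|F\|_{L^1_tL^2_x([0,T]\times\mathbb R^n)}\le C^3\varepsilon c_0$. -/

import Mathlib

open MeasureTheory Set
open scoped ENNReal NNReal FourierTransform ContDiff

noncomputable section

namespace WaveMaps

/-- The space `ℝⁿ` with its Euclidean norm. -/
abbrev Sp (n : ℕ) : Type := EuclideanSpace ℝ (Fin n)

/-- Arrays `(v^a_α)` with a frame index `a = 1, …, N` and a space-time index `α = 0, …, n`
(`α = 0` is time), normed by the maximum of the absolute values of the entries. -/
abbrev Arr (N n : ℕ) (𝕜 : Type) : Type := Fin N → Fin (n + 1) → 𝕜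

/-! ### Space-time calculus on `ℝ × ℝⁿ` -/

/-- The partial derivative `∂_μ f` at `(t, x)`: `μ = 0` is the time derivative, and `μ = i + 1`
is the derivative in the `i`-th spatial coordinate direction. -/
def pd {n : ℕ} {V : Type} [NormedAddCommGroup V] [NormedSpace ℝ V] (μ : Fin (n + 1))
    (f : ℝ → Sp n → V) (t : ℝ) (x : Sp n) : V :=
  Fin.cases (motive := fun _ => V) (deriv (fun s => f s x) t)
    (fun i => deriv (fun h : ℝ => f t (x + h • EuclideanSpace.single i (1 : ℝ))) 0) μ

/-- The diagonal entries `m^{μμ}` of the Minkowski metric `diag(-1, 1, …, 1)`; the other entries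
vanish, so that `∂^μ = m^{μμ} ∂_μ`. -/
def mink {n : ℕ} (μ : Fin (n + 1)) : ℝ := if μ = 0 then -1 else 1

/-- The wave operator `□ = ∂^μ ∂_μ = -∂_t² + Δ`. -/
def box {n : ℕ} {V : Type} [NormedAddCommGroup V] [NormedSpace ℝ V]
    (f : ℝ → Sp n → V) (t : ℝ) (x : Sp n) : V :=
  ∑ μ : Fin (n + 1), mink μ • pd μ (pd μ f) t x

/-! ### The div-curl system -/

/-- The connection coefficients `Γ^a_{bc} = (C^a_{bc} + C^b_{ac} + C^c_{ab}) / 2` of an orthonormal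
frame with structure coefficients `S a b c = C^a_{bc}`. -/
def conn {N : ℕ} (S : Fin N → Fin N → Fin N → ℝ) (a b c : Fin N) : ℝ :=
  (S a b c + S b a c + S c a b) / 2

/-- The array `Φ = (φ^a_α)` solves, on `(0, T) × ℝⁿ`, the system
`∂_β φ^a_α - ∂_α φ^a_β = C^a_{bc} φ^b_α φ^c_β`, `∂^α φ^a_α = -Γ^a_{bc} φ^b_β φ^c_γ m^{βγ}`. -/
structure SolvesDivCurl {N n : ℕ} (S : Fin N → Fin N → Fin N → ℝ) (T : ℝ)
    (Φ : ℝ → Sp n → Arr N n ℝ) : Prop where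
  curl : ∀ t ∈ Ioo 0 T, ∀ (x : Sp n) (a : Fin N) (α β : Fin (n + 1)),
    pd β Φ t x a α - pd α Φ t x a β = ∑ b, ∑ c, S a b c * Φ t x b α * Φ t x c β
  div : ∀ t ∈ Ioo 0 T, ∀ (x : Sp n) (a : Fin N),
    ∑ α, mink α * pd α Φ t x a α
      = -∑ b, ∑ c, ∑ β, conn S a b c * Φ t x b β * Φ t x c β * mink β

/-- The matrices `R_μ = (R^a_{bμ})`, `R^a_{bμ} = Γ^a_{cb} φ^c_μ`. -/
def connMat {N n : ℕ} (S : Fin N → Fin N → Fin N → ℝ) (Φ : ℝ → Sp n → Arr N n ℝ)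
    (μ : Fin (n + 1)) (t : ℝ) (x : Sp n) : Matrix (Fin N) (Fin N) ℝ :=
  fun a b => ∑ c, conn S a c b * Φ t x c μ

/-! ### Littlewood-Paley projections -/

/-- A non-negative smooth bump function supported in `|ξ| ≤ 2` and equal to `1` on `|ξ| ≤ 1`. -/
structure IsBump {n : ℕ} (η : Sp n → ℝ) : Prop where
  smooth : ContDiff ℝ ∞ η
  nonneg : ∀ ξ, 0 ≤ η ξ
  eq_one : ∀ ξ, ‖ξ‖ ≤ 1 → η ξ = 1
  eq_zero : ∀ ξ, 2 ≤ ‖ξ‖ → η ξ = 0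

open Classical in
/-- The Fourier multiplier with symbol `m` on `L²(ℝⁿ)`: with `f̂` the `L²` Fourier transform of `f`,
the function with Fourier transform `m f̂`, given pointwise by the inversion integral. Mathlib's
transform has the phase `exp(-2πi x·ζ)`, so `ξ = 2πζ` is the frequency in the phase
`exp(-i x·ξ)`. (For `f` outside `L²` the value is set to `0`.) -/
def multiplier {n : ℕ} (m : Sp n → ℝ) (f : Sp n → ℂ) (x : Sp n) : ℂ :=
  if h : MemLp f 2 volume then
    𝓕⁻ (fun ζ : Sp n => (m ((2 * Real.pi) • ζ) : ℂ) * (𝓕 (h.toLp f) : Lp ℂ 2 volume) ζ) x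
  else 0

/-- `P_{≤ k}`, the multiplier with symbol `η(2^{-k} ξ)`. -/
def projLE {n : ℕ} (η : Sp n → ℝ) (k : ℤ) (f : Sp n → ℂ) : Sp n → ℂ :=
  multiplier (fun ξ => η ((2 : ℝ) ^ (-k) • ξ)) f

/-- `P_k = P_{≤ k} - P_{≤ k - 1}`. -/
def proj {n : ℕ} (η : Sp n → ℝ) (k : ℤ) (f : Sp n → ℂ) : Sp n → ℂ :=
  fun x => projLE η k f x - projLE η (k - 1) f x

/-- `P_k Φ`, the projection acting in `x` on each component at each time. -/
def projArr {N n : ℕ} (η : Sp n → ℝ) (k : ℤ) (Φ : ℝ → Sp n → Arr N n ℝ) (t : ℝ) (x : Sp n) :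
    Arr N n ℂ :=
  fun a α => proj η k (fun y => (Φ t y a α : ℂ)) x

/-- `P_{≤ k} Φ`, componentwise. -/
def projLEArr {N n : ℕ} (η : Sp n → ℝ) (k : ℤ) (Φ : ℝ → Sp n → Arr N n ℝ) (t : ℝ) (x : Sp n) :
    Arr N n ℂ :=
  fun a α => projLE η k (fun y => (Φ t y a α : ℂ)) x

/-- `R̃_μ = P_{≤ -10} R_μ`, entrywise. -/
def connMatLow {N n : ℕ} (η : Sp n → ℝ) (S : Fin N → Fin N → Fin N → ℝ)
    (Φ : ℝ → Sp n → Arr N n ℝ) (μ : Fin (n + 1)) (t : ℝ) (x : Sp n) :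
    Matrix (Fin N) (Fin N) ℂ :=
  fun a b => projLE η (-10) (fun y => (connMat S Φ μ t y a b : ℂ)) x

/-! ### Norms on `[0, T] × ℝⁿ` -/

/-- The mixed norm `‖f‖_{L^q_t L^r_x([0, T] × ℝⁿ)}`, with values in `[0, ∞]`. -/
def mixedNorm {n : ℕ} {V : Type} [NormedAddCommGroup V] (T : ℝ) (q r : ℝ≥0∞)
    (f : ℝ → Sp n → V) : ℝ≥0∞ :=
  eLpNorm (fun t => eLpNorm (f t) r volume) q (volume.restrict (Icc 0 T))

/-- The admissible Strichartz exponents: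
`2 ≤ q, r ≤ ∞` and `1/q + (n - 1)/(2r) ≤ (n - 1)/4`. -/
def Admissible (n : ℕ) (q r : ℝ≥0∞) : Prop :=
  2 ≤ q ∧ 2 ≤ r ∧ q⁻¹.toReal + ((n : ℝ) - 1) / 2 * r⁻¹.toReal ≤ ((n : ℝ) - 1) / 4

/-- The norm `‖f‖_{S_k([0, T] × ℝⁿ)}`, the supremum over admissible `(q, r)` of
`2^{k(1/q + n/r - 1)} (‖f‖_{L^q_t L^r_x} + 2^{-k} ‖∂_t f‖_{L^q_t L^r_x})`. -/
def strichartzNorm {n : ℕ} {V : Type} [NormedAddCommGroup V] [NormedSpace ℝ V] (T : ℝ) (k : ℤ)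
    (f : ℝ → Sp n → V) : ℝ≥0∞ :=
  ⨆ (q : ℝ≥0∞) (r : ℝ≥0∞) (_ : Admissible n q r),
    ENNReal.ofReal ((2 : ℝ) ^ ((k : ℝ) * (q⁻¹.toReal + n * r⁻¹.toReal - 1))) *
      (mixedNorm T q r f + ENNReal.ofReal ((2 : ℝ) ^ (-k)) * mixedNorm T q r (pd 0 f))

/-! ### Frequency envelopes, the bootstrap assumption, acceptable errors -/

/-- A frequency envelope: a non-negative `ℓ²` sequence `c` with `c_k ≤ A 2^{σ|k - k'|} c_{k'}`. -/
structure IsFreqEnvelope (σ A : ℝ) (c : ℤ → ℝ) : Prop where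
  nonneg : ∀ k, 0 ≤ c k
  sq_summable : Summable fun k => c k ^ 2
  slow : ∀ k k' : ℤ, c k ≤ A * (2 : ℝ) ^ (σ * |(k : ℝ) - k'|) * c k'

/-- The bootstrap assumption `‖P_k Φ‖_{S_k([0, T] × ℝⁿ)} ≤ 2 C c_k` for all `k ∈ ℤ`. -/
def Bootstrap {N n : ℕ} (η : Sp n → ℝ) (T C : ℝ) (c : ℤ → ℝ) (Φ : ℝ → Sp n → Arr N n ℝ) : Prop :=
  ∀ k : ℤ, strichartzNorm T k (projArr η k Φ) ≤ ENNReal.ofReal (2 * C * c k)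

/-- An acceptable error: `‖F‖_{L¹_t L²_x([0, T] × ℝⁿ)} ≤ C³ ε c_0`. -/
def AcceptableError {N n : ℕ} (T C ε : ℝ) (c : ℤ → ℝ) (F : ℝ → Sp n → Arr N n ℂ) : Prop :=
  AEStronglyMeasurable (Function.uncurry F) ((volume.restrict (Icc 0 T)).prod volume) ∧
    mixedNorm T 1 2 F ≤ ENNReal.ofReal (C ^ 3 * ε * c 0)

end WaveMaps

end

/-! Differentiating the divergence equation and using the curl equation twice expresses `□ φ^a_α`
through products `φ ∂φ`. The algebra hinges on `C^a_{bc} = Γ^a_{bc} - Γ^a_{cb}`: after `∂_α φ_β` is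
replaced by `∂_β φ_α` at the price of cubic terms, the two contributions with `Γ^a_{bc}` cancel and
what remains is `-2 Γ^a_{cb} φ^c_β ∂^β φ^b_α` plus cubic terms (`inhom_eq`). Hence the error after
applying `P_0` consists of differences `P_0(f ∂g) - P_{≤-10} f ∂ P_0 g` and of `P_0` of cubic
expressions. Antisymmetry of the matrices is that of `Γ^a_{cb}` under exchange of `a` and `b`.

The bilinear differences gain a derivative on the lower frequency. Decompose `f` and `g` into pieces
of frequencies `2^k` and `2^l`. If both are at most `2^{-10}`, nothing survives. If `l ≤ k`, the
derivative already falls on the lower frequency. If `k ≤ l`, integration by parts moves it onto `f`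
or onto the kernel of `P_0`; in the latter case, for very low `k`, `P_{≤-10}` is the identity on the
piece of `f` and a commutator with multiplication by this piece appears, which costs a derivative of
the piece only. In all cases, with `1/p + 1/q = 1/2`, the `L²` norm is controlled by `2^j ‖P_j Φ‖_p
‖P_i Φ‖_q` for `j ≤ i`, `i ≥ -9` (`eLpNorm_bil_le`). Time derivatives are first eliminated by the
equations in favour of spatial ones and quadratic terms (`pairs_du`). In a cubic term the lowest
factor goes in `L^∞`, where the bootstrap assumption with `ε ≤ 1/(4C)` bounds it by `2^l / 2`;
summing over this lowest frequency reproduces the bilinear sum (`tsum_hSum_le`).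

The exponents are `p = n - 1` and `q = 2(n-1)/(n-3)`, so that `(2, p)` and `(2, q)` are both
admissible when `n ≥ 5`. Cauchy-Schwarz in time and the bootstrap assumption then give the summand
`C² c_i c_j 2^{γ j - β i}` with `γ > 0` and `γ - β = -(n-4)/2`. With `c_j ≤ ε` and `c_i ≤ |A|
2^{σ|i|} c_0` the double sum converges because `σ` is below `(n-4)/4`, and the total is a constant
times `C² ε c_0`, which is at most `C³ ε c_0` once `C` is large.

The remaining work is justification at low regularity: `Φ` is only `C²` with an `L²` bound. The
projections are realised as convolutions with Schwartz kernels, which act on `L¹` products as well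
as on `L²` functions. The bootstrap assumption at `q = ∞` yields `Φ ∈ L⁴` and `∂Φ ∈ L²` uniformly in
time (`Bootstrap.sol`), so all products in the equation have integrable slices. Second derivatives
are taken only of the projected functions, which are shown to be `C²` by trading time derivatives
for derivatives of the kernel (`Sol.contDiffOn_cvl`). -/

noncomputable section

namespace WaveMaps

open Filter Topology SchwartzMap
open scoped RealInnerProductSpace LineDeriv

variable {n : ℕ} {η : Sp n → ℝ}

section

variable {E : Type} [NormedAddCommGroup E] [NormedSpace ℂ E]

/-! ### Convolution with a Schwartz kernel -/

/-- The convolution of a scalar function with a Schwartz kernel. -/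
def cvl (K : 𝓢(Sp n, E)) (f : Sp n → ℂ) (x : Sp n) : E := ∫ y, f y • K (x - y)

/-- An integrable polynomial weight. -/
def wt (y : Sp n) : ℝ := ((1 + ‖y‖) ^ (n + 1))⁻¹

lemma wt_pos (y : Sp n) : 0 < wt y := by unfold wt; positivity

lemma wt_le_one (y : Sp n) : wt y ≤ 1 := by
  unfold wt
  exact inv_le_one_of_one_le₀ (one_le_pow₀ (by linarith [norm_nonneg y]))

lemma continuous_wt : Continuous (wt : Sp n → ℝ) := by
  unfold wt
  exact Continuous.inv₀ (by fun_prop) (fun y => by positivity)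

lemma integrable_wt : Integrable (wt : Sp n → ℝ) := by
  have h := integrable_one_add_norm (E := Sp n) (μ := volume) (r := (n : ℝ) + 1) (by simp)
  refine h.congr (Eventually.of_forall fun x => ?_)
  unfold wt
  have : (0 : ℝ) < 1 + ‖x‖ := by positivity
  simp only
  rw [Real.rpow_neg this.le]
  norm_cast

lemma memLp_two_wt : MemLp (wt : Sp n → ℝ) 2 := by
  rw [memLp_two_iff_integrable_sq continuous_wt.aestronglyMeasurable]
  refine integrable_wt.mono' (continuous_wt.pow 2).aestronglyMeasurable
    (Eventually.of_forall fun x => ?_)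
  rw [Real.norm_of_nonneg (by positivity)]
  nlinarith [wt_pos x, wt_le_one x]

/-- Integrability against the weight `wt`. -/
def WInt (f : Sp n → ℂ) : Prop := AEStronglyMeasurable f ∧ Integrable fun y => wt y * ‖f y‖

lemma WInt.of_integrable {f : Sp n → ℂ} (hf : Integrable f) : WInt f := by
  refine ⟨hf.1, hf.norm.mono' (continuous_wt.aestronglyMeasurable.mul hf.1.norm)
    (Eventually.of_forall fun y => ?_)⟩
  rw [norm_mul, norm_norm, Real.norm_of_nonneg (wt_pos y).le]
  nlinarith [wt_pos y, wt_le_one y, norm_nonneg (f y)]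

lemma WInt.of_memLp_two {f : Sp n → ℂ} (hf : MemLp f 2) : WInt f :=
  ⟨hf.1, memLp_two_wt.integrable_mul hf.norm⟩

lemma exists_kernel_bound (K : 𝓢(Sp n, E)) (m : ℕ) :
    ∃ C : ℝ, 0 ≤ C ∧ ∀ z, (1 + ‖z‖) ^ m * ‖K z‖ ≤ C := by
  obtain ⟨C1, -, h1⟩ := K.decay m 0
  obtain ⟨C0, -, h0⟩ := K.decay 0 0
  have h : ∀ z, (1 + ‖z‖) ^ m * ‖K z‖ ≤
      2 ^ m * (Finset.Iic (m, 0)).sup (fun m => SchwartzMap.seminorm ℝ m.1 m.2) K := fun z => by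
    simpa using one_add_le_sup_seminorm_apply (𝕜 := ℝ) (m := (m, 0)) (k := m) (n := 0)
      le_rfl le_rfl K z
  exact ⟨_, by positivity, h⟩

/-- The tail of a translated kernel is uniformly small relative to the weight. -/
lemma exists_kernel_translate_bound (K : 𝓢(Sp n, E)) :
    ∃ C : ℝ, 0 ≤ C ∧ ∀ x y, ‖K (x - y)‖ ≤ C * (1 + ‖x‖) ^ (n + 2) * (wt y * (1 + ‖y‖)⁻¹) := by
  obtain ⟨C, hC, h⟩ := exists_kernel_bound K (n + 2)
  refine ⟨C, hC, fun x y => ?_⟩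
  have h1 := h (x - y)
  -- Peetre's inequality transfers decay in `x - y` to decay in `y`, at the cost of a power of `1 +
  -- ‖x‖`. The exponent `n + 2` is one more than in the weight and leaves the factor `(1 + ‖y‖)⁻¹`
  -- that makes tails small.
  have h2 : 1 + ‖y‖ ≤ (1 + ‖x‖) * (1 + ‖x - y‖) := by
    have : ‖y‖ ≤ ‖x‖ + ‖x - y‖ := by
      calc ‖y‖ = ‖x - (x - y)‖ := by congr 1; abel
        _ ≤ _ := norm_sub_le _ _
    nlinarith [norm_nonneg x, norm_nonneg (x - y)]
  have h3 : (1 + ‖y‖) ^ (n + 2) ≤ (1 + ‖x‖) ^ (n + 2) * (1 + ‖x - y‖) ^ (n + 2) := by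
    rw [← mul_pow]; gcongr
  have e : wt y * (1 + ‖y‖)⁻¹ = ((1 + ‖y‖) ^ (n + 2))⁻¹ := by
    unfold wt; rw [← mul_inv]; congr 1
  rw [e, ← div_eq_mul_inv, le_div_iff₀ (by positivity)]
  calc ‖K (x - y)‖ * (1 + ‖y‖) ^ (n + 2)
      ≤ ‖K (x - y)‖ * ((1 + ‖x‖) ^ (n + 2) * (1 + ‖x - y‖) ^ (n + 2)) := by gcongr
    _ = ((1 + ‖x - y‖) ^ (n + 2) * ‖K (x - y)‖) * (1 + ‖x‖) ^ (n + 2) := by ring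
    _ ≤ C * (1 + ‖x‖) ^ (n + 2) := by gcongr

lemma exists_kernel_translate_bound' (K : 𝓢(Sp n, E)) :
    ∃ C : ℝ, 0 ≤ C ∧ ∀ x y, ‖K (x - y)‖ ≤ C * (1 + ‖x‖) ^ (n + 2) * wt y := by
  obtain ⟨C, hC, h⟩ := exists_kernel_translate_bound K
  refine ⟨C, hC, fun x y => (h x y).trans ?_⟩
  gcongr
  exact mul_le_of_le_one_right (wt_pos y).le
    (inv_le_one_of_one_le₀ (by linarith [norm_nonneg y]))

lemma WInt.integrable_smul {f : Sp n → ℂ} (hf : WInt f) (K : 𝓢(Sp n, E)) (x : Sp n) :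
    Integrable fun y => f y • K (x - y) := by
  obtain ⟨C, hC, h⟩ := exists_kernel_translate_bound' K
  refine (hf.2.const_mul (C * (1 + ‖x‖) ^ (n + 2))).mono'
    (hf.1.smul (K.continuous.comp (continuous_const.sub continuous_id)).aestronglyMeasurable)
    (Eventually.of_forall fun y => ?_)
  rw [norm_smul]
  calc ‖f y‖ * ‖K (x - y)‖ ≤ ‖f y‖ * (C * (1 + ‖x‖) ^ (n + 2) * wt y) := by gcongr; exact h x y
    _ = _ := by ring

/-- The derivative falls on the kernel, so no regularity of `f` is needed; on a unit ball around `x`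
the translated kernels have a common majorant, a multiple of the weight. -/
lemma hasFDerivAt_cvl [CompleteSpace E] (K : 𝓢(Sp n, E)) {f : Sp n → ℂ} (hf : WInt f) (x : Sp n) :
    HasFDerivAt (cvl K f) (cvl (fderivCLM ℂ (Sp n) E K) f x) x := by
  obtain ⟨C, hC, h⟩ := exists_kernel_translate_bound' (fderivCLM ℂ (Sp n) E K)
  unfold cvl
  refine hasFDerivAt_integral_of_dominated_of_fderiv_le
    (F' := fun x y => f y • (fderivCLM ℂ (Sp n) E K) (x - y))
    (bound := fun y => C * (2 + ‖x‖) ^ (n + 2) * (wt y * ‖f y‖)) (Metric.ball_mem_nhds x one_pos)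
    (Eventually.of_forall fun z => (hf.integrable_smul K z).1) (hf.integrable_smul K x)
    (hf.integrable_smul _ x).1 (Eventually.of_forall fun y z hz => ?_) (hf.2.const_mul _)
    (Eventually.of_forall fun y z _ => ?_)
  · rw [norm_smul]
    have hz' : 1 + ‖z‖ ≤ 2 + ‖x‖ := by
      have := norm_le_norm_add_norm_sub' z x
      rw [Metric.mem_ball, dist_eq_norm, ] at hz
      linarith
    calc ‖f y‖ * ‖_‖ ≤ ‖f y‖ * (C * (1 + ‖z‖) ^ (n + 2) * wt y) := by gcongr; exact h z y
      _ ≤ ‖f y‖ * (C * (2 + ‖x‖) ^ (n + 2) * wt y) := by gcongr; exact (wt_pos y).le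
      _ = _ := by ring
  · have h1 := (K.hasFDerivAt (z - y)).comp z ((hasFDerivAt_id z).sub_const y)
    have h2 := h1.const_smul (f y)
    simpa using! h2

lemma continuous_cvl [CompleteSpace E] (K : 𝓢(Sp n, E)) {f : Sp n → ℂ} (hf : WInt f) :
    Continuous (cvl K f) :=
  continuous_iff_continuousAt.2 fun x => (hasFDerivAt_cvl K hf x).continuousAt

/-! ### Time-dependent functions -/

/-- Continuous functions on `(0, T) × ℝⁿ` whose time slices are uniformly integrable against the
weight. -/
structure SliceBdd (T : ℝ) (f : ℝ → Sp n → ℂ) : Prop where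
  cont : ContinuousOn (Function.uncurry f) (Ioo 0 T ×ˢ univ)
  wint : ∀ t ∈ Ioo 0 T, WInt (f t)
  bdd : ∃ M : ℝ, ∀ t ∈ Ioo 0 T, ∫ y, wt y * ‖f t y‖ ≤ M

/-- `SliceBdd` gives no majorant in `y` common to all times, so dominated convergence does not apply
on the whole space. The integral is cut at radius `R`: inside, `f` is bounded on a compact set;
outside, the kernel beats the weight by a factor `(1 + R)⁻¹` and the uniform bound on the weighted
integrals makes the tail small uniformly in `t`. -/
lemma continuousOn_cvl (K : 𝓢(Sp n, E)) {T : ℝ} {f : ℝ → Sp n → ℂ} (hf : SliceBdd T f) :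
    ContinuousOn (Function.uncurry fun t x => cvl K (f t) x) (Ioo 0 T ×ˢ univ) := by
  obtain ⟨M, hM⟩ := hf.bdd
  obtain ⟨C, hC, hK⟩ := exists_kernel_translate_bound K
  rintro ⟨t₀, x₀⟩ ⟨ht₀, -⟩
  simp only at ht₀
  have hM0 : 0 ≤ M := (integral_nonneg fun y => by
    have := wt_pos y; positivity).trans (hM t₀ ht₀)
  refine ContinuousAt.continuousWithinAt ?_
  -- the truncated integrals
  set D : ℝ := C * (2 + ‖x₀‖) ^ (n + 2) * M
  have hnear : ∀ᶠ p : ℝ × Sp n in 𝓝 (t₀, x₀), p.1 ∈ Ioo 0 T ∧ p.2 ∈ Metric.ball x₀ 1 := by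
    refine ((continuous_fst.continuousAt.eventually
      (isOpen_Ioo.mem_nhds ht₀)).and (continuous_snd.continuousAt.eventually
        (Metric.ball_mem_nhds x₀ one_pos)))
  have htail : ∀ R > 0, ∀ t ∈ Ioo 0 T, ∀ x ∈ Metric.ball x₀ 1,
      ‖cvl K (f t) x - ∫ y in Metric.closedBall 0 R, f t y • K (x - y)‖ ≤ D * (1 + R)⁻¹ := by
    intro R hR t ht x hx
    have hi := (hf.wint t ht).integrable_smul K x
    have hx' : 1 + ‖x‖ ≤ 2 + ‖x₀‖ := by
      have := norm_le_norm_add_norm_sub' x x₀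
      rw [Metric.mem_ball, dist_eq_norm] at hx
      linarith
    unfold cvl
    rw [← integral_add_compl (s := Metric.closedBall 0 R) Metric.isClosed_closedBall.measurableSet
      hi, add_sub_cancel_left]
    calc ‖∫ y in (Metric.closedBall 0 R)ᶜ, f t y • K (x - y)‖
        ≤ ∫ y in (Metric.closedBall 0 R)ᶜ,
            (C * (2 + ‖x₀‖) ^ (n + 2) * (1 + R)⁻¹) * (wt y * ‖f t y‖) := by
          refine norm_integral_le_of_norm_le (((hf.wint t ht).2.const_mul _).integrableOn) ?_
          refine (ae_restrict_iff' Metric.isClosed_closedBall.measurableSet.compl).2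
            (Eventually.of_forall fun y hy => ?_)
          rw [mem_compl_iff, mem_closedBall_zero_iff, not_le] at hy
          rw [norm_smul]
          have hw := wt_pos y
          calc ‖f t y‖ * ‖K (x - y)‖
              ≤ ‖f t y‖ * (C * (1 + ‖x‖) ^ (n + 2) * (wt y * (1 + ‖y‖)⁻¹)) := by
                gcongr; exact hK x y
            _ ≤ ‖f t y‖ * (C * (2 + ‖x₀‖) ^ (n + 2) * (wt y * (1 + R)⁻¹)) := by gcongr
            _ = _ := by ring
      _ ≤ ∫ y, (C * (2 + ‖x₀‖) ^ (n + 2) * (1 + R)⁻¹) * (wt y * ‖f t y‖) := by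
          refine setIntegral_le_integral ((hf.wint t ht).2.const_mul _)
            (Eventually.of_forall fun y => ?_)
          have hw := wt_pos y
          simp only [Pi.zero_apply]
          positivity
      _ = (C * (2 + ‖x₀‖) ^ (n + 2) * (1 + R)⁻¹) * ∫ y, (wt y * ‖f t y‖) := by
          rw [integral_const_mul]
      _ ≤ (C * (2 + ‖x₀‖) ^ (n + 2) * (1 + R)⁻¹) * M := by gcongr; exact hM t ht
      _ = _ := by simp only [D]; ring
  have hmain : ∀ R > 0, ContinuousAt (fun p : ℝ × Sp n =>
      ∫ y in Metric.closedBall 0 R, f p.1 y • K (p.2 - y)) (t₀, x₀) := by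
    intro R hR
    obtain ⟨δ, hδ, hδT⟩ := Metric.nhds_basis_closedBall.mem_iff.1 (isOpen_Ioo.mem_nhds ht₀)
    have hcomp : IsCompact (Metric.closedBall t₀ δ ×ˢ Metric.closedBall (0 : Sp n) R) :=
      (isCompact_closedBall _ _).prod (isCompact_closedBall _ _)
    obtain ⟨B, hB⟩ := hcomp.exists_bound_of_continuousOn
      (hf.cont.mono (prod_mono hδT (subset_univ _)))
    obtain ⟨B', hB'0, hB'⟩ := exists_kernel_bound K 0
    have hnear' : ∀ᶠ p : ℝ × Sp n in 𝓝 (t₀, x₀), p.1 ∈ Metric.closedBall t₀ δ :=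
      continuous_fst.continuousAt.eventually (Metric.closedBall_mem_nhds t₀ hδ)
    refine continuousAt_of_dominated (bound := fun _ => |B| * B') ?_ ?_ ?_ ?_
    · filter_upwards [hnear'] with p hp
      exact ((hf.wint p.1 (hδT hp)).integrable_smul K p.2).1.restrict
    · filter_upwards [hnear'] with p hp
      refine (ae_restrict_iff' Metric.isClosed_closedBall.measurableSet).2
        (Eventually.of_forall fun y hy => ?_)
      rw [norm_smul]
      refine mul_le_mul ((hB (p.1, y) ⟨hp, hy⟩).trans (le_abs_self _)) (by simpa using hB' (p.2 - y))
        (norm_nonneg _) (abs_nonneg _)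
    · exact integrableOn_const (by exact (isCompact_closedBall _ _).measure_lt_top.ne)
    · refine Eventually.of_forall fun y => ?_
      have h1 : ContinuousAt (fun p : ℝ × Sp n => Function.uncurry f (p.1, y)) (t₀, x₀) := by
        have h0 : ContinuousAt (Function.uncurry f) (t₀, y) :=
          hf.cont.continuousAt ((isOpen_Ioo.prod isOpen_univ).mem_nhds ⟨ht₀, mem_univ _⟩)
        exact ContinuousAt.comp (f := fun p : ℝ × Sp n => (p.1, y)) (x := (t₀, x₀)) h0
          (by fun_prop)
      exact h1.smul (K.continuous.continuousAt.comp (by fun_prop))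
  rw [Metric.continuousAt_iff']
  intro ε hε
  obtain ⟨R, hR0, hR⟩ : ∃ R > 0, D * (1 + R)⁻¹ < ε / 3 := by
    have : Tendsto (fun R : ℝ => D * (1 + R)⁻¹) atTop (𝓝 (D * 0)) :=
      (tendsto_inv_atTop_zero.comp (tendsto_atTop_add_const_left _ _ tendsto_id)).const_mul D
    rw [mul_zero] at this
    exact ((eventually_gt_atTop 0).and (this.eventually (gt_mem_nhds (by linarith)))).exists
  filter_upwards [hnear, (Metric.continuousAt_iff'.1 (hmain R hR0)) (ε / 3) (by linarith)]
    with p hp hp2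
  have e1 := htail R hR0 p.1 hp.1 p.2 hp.2
  have e2 := htail R hR0 t₀ ht₀ x₀ (Metric.mem_ball_self one_pos)
  rw [dist_eq_norm] at hp2 ⊢
  simp only [Function.uncurry]
  set a := cvl K (f p.1) p.2
  set b := cvl K (f t₀) x₀
  set a' := ∫ y in Metric.closedBall 0 R, f p.1 y • K (p.2 - y)
  set b' := ∫ y in Metric.closedBall 0 R, f t₀ y • K (x₀ - y)
  calc ‖a - b‖ = ‖(a - a') + (a' - b') - (b - b')‖ := by congr 1; abel
    _ ≤ ‖a - a'‖ + ‖a' - b'‖ + ‖b - b'‖ := (norm_sub_le _ _).trans (by gcongr; exact norm_add_le _ _)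
    _ < ε := by linarith

/-- Differentiation under the integral would again need a majorant uniform in time. Instead `f s - f
t` is written as a time integral of `g`, Fubini moves this integral outside the convolution, and the
fundamental theorem of calculus applies because the convolution of `g` is continuous in time. -/
lemma hasDerivAt_cvl_time [CompleteSpace E] (K : 𝓢(Sp n, E)) {T : ℝ} {f g : ℝ → Sp n → ℂ}
    (hf : SliceBdd T f) (hg : SliceBdd T g)
    (hfg : ∀ t ∈ Ioo 0 T, ∀ y, HasDerivAt (fun s => f s y) (g t y) t)
    {t : ℝ} (ht : t ∈ Ioo 0 T) (x : Sp n) :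
    HasDerivAt (fun s => cvl K (f s) x) (cvl K (g t) x) t := by
  obtain ⟨M, hM⟩ := hg.bdd
  obtain ⟨C, hC, hK⟩ := exists_kernel_translate_bound' K
  have hc : ContinuousOn (fun s => cvl K (g s) x) (Ioo 0 T) :=
    (continuousOn_cvl K hg).comp (f := fun s => (s, x)) (by fun_prop) (fun s hs => ⟨hs, mem_univ _⟩)
  have hint : ∀ s ∈ Ioo 0 T, cvl K (f s) x = cvl K (f t) x + ∫ τ in t..s, cvl K (g τ) x := by
    intro s hs
    have hsub : uIcc t s ⊆ Ioo 0 T := (ordConnected_Ioo).uIcc_subset ht hs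
    have hmeas : AEStronglyMeasurable (Function.uncurry fun τ y => g τ y • K (x - y))
        ((volume.restrict (uIoc t s)).prod volume) := by
      have h1 : ContinuousOn (Function.uncurry fun τ y => g τ y • K (x - y)) (uIoc t s ×ˢ univ) :=
        (hg.cont.mono (prod_mono (uIoc_subset_uIcc.trans hsub) subset_rfl)).smul
          (K.continuous.comp (continuous_const.sub continuous_snd)).continuousOn
      have h2 := h1.aestronglyMeasurable (μ := volume.prod volume)
        (measurableSet_uIoc.prod MeasurableSet.univ)
      rwa [← Measure.prod_restrict, Measure.restrict_univ] at h2
    have hprod : Integrable (Function.uncurry fun τ y => g τ y • K (x - y))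
        ((volume.restrict (uIoc t s)).prod volume) := by
      rw [integrable_prod_iff hmeas]
      constructor
      · refine (ae_restrict_iff' measurableSet_uIoc).2 (Eventually.of_forall fun τ hτ => ?_)
        exact (hg.wint τ (hsub (uIoc_subset_uIcc hτ))).integrable_smul K x
      · have hconst : Integrable (fun _ : ℝ => C * (1 + ‖x‖) ^ (n + 2) * M)
            (volume.restrict (uIoc t s)) :=
          integrableOn_const (by rw [uIoc]; exact measure_Ioc_lt_top.ne)
        refine hconst.mono' ?_ ?_
        · exact hmeas.norm.integral_prod_right'
        · refine (ae_restrict_iff' measurableSet_uIoc).2 (Eventually.of_forall fun τ hτ => ?_)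
          have hτ' := hsub (uIoc_subset_uIcc hτ)
          rw [Real.norm_of_nonneg (integral_nonneg fun _ => norm_nonneg _)]
          calc ∫ y, ‖g τ y • K (x - y)‖
              ≤ ∫ y, (C * (1 + ‖x‖) ^ (n + 2)) * (wt y * ‖g τ y‖) := by
                refine integral_mono ((hg.wint τ hτ').integrable_smul K x).norm
                  ((hg.wint τ hτ').2.const_mul _) fun y => ?_
                simp only
                rw [norm_smul]
                calc ‖g τ y‖ * ‖K (x - y)‖
                    ≤ ‖g τ y‖ * (C * (1 + ‖x‖) ^ (n + 2) * wt y) := by gcongr; exact hK x y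
                  _ = _ := by ring
            _ = (C * (1 + ‖x‖) ^ (n + 2)) * ∫ y, wt y * ‖g τ y‖ := integral_const_mul _ _
            _ ≤ _ := by gcongr; exact hM τ hτ'
    have hswap := intervalIntegral_integral_swap hprod
    have e : cvl K (f s) x - cvl K (f t) x = ∫ τ in t..s, cvl K (g τ) x := by
      unfold cvl
      rw [hswap, ← integral_sub ((hf.wint s hs).integrable_smul K x)
        ((hf.wint t ht).integrable_smul K x)]
      refine integral_congr_ae (Eventually.of_forall fun y => ?_)
      simp only
      have hgy : ContinuousOn (fun τ => g τ y) (uIcc t s) :=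
        hg.cont.comp (f := fun τ => (τ, y)) (by fun_prop) (fun τ hτ => ⟨hsub hτ, mem_univ _⟩)
      rw [intervalIntegral.integral_smul_const, ← sub_smul,
        intervalIntegral.integral_eq_sub_of_hasDerivAt (f := fun τ => f τ y)
          (fun τ hτ => hfg τ (hsub hτ) y) hgy.intervalIntegrable]
    rw [← e]; abel
  have hint2 : HasDerivAt (fun s => cvl K (f t) x + ∫ τ in t..s, cvl K (g τ) x)
      (cvl K (g t) x) t := by
    refine HasDerivAt.const_add _ ?_
    refine intervalIntegral.integral_hasDerivAt_right (by simp) ?_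
      (hc.continuousAt (isOpen_Ioo.mem_nhds ht))
    exact hc.stronglyMeasurableAtFilter isOpen_Ioo t ht
  exact hint2.congr_of_eventuallyEq (by
    filter_upwards [isOpen_Ioo.mem_nhds ht] with s hs using hint s hs)

/-! ### Joint regularity -/

/-- A function of time and space whose partial derivatives are `C^m` is `C^{m+1}`. -/
lemma contDiffOn_succ_uncurry {V : Type} [NormedAddCommGroup V] [NormedSpace ℝ V] {T : ℝ}
    (m : ℕ) {f g : ℝ → Sp n → V} {A : ℝ → Sp n → Sp n →L[ℝ] V}
    (hft : ∀ t ∈ Ioo 0 T, ∀ x, HasDerivAt (fun s => f s x) (g t x) t)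
    (hfx : ∀ t ∈ Ioo 0 T, ∀ x, HasFDerivAt (f t) (A t x) x)
    (hg : ContDiffOn ℝ m (Function.uncurry g) (Ioo 0 T ×ˢ univ))
    (hA : ContDiffOn ℝ m (Function.uncurry A) (Ioo 0 T ×ˢ univ)) :
    ContDiffOn ℝ (m + 1) (Function.uncurry f) (Ioo 0 T ×ˢ univ) := by
  have ho : IsOpen (Ioo 0 T ×ˢ (univ : Set (Sp n))) := isOpen_Ioo.prod isOpen_univ
  have hsr : ContDiffOn ℝ m
      (fun p => ContinuousLinearMap.smulRight (1 : ℝ →L[ℝ] ℝ) (Function.uncurry g p))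
      (Ioo 0 T ×ˢ univ) := contDiffOn_const.smulRight hg
  have hd : ∀ u ∈ Ioo 0 T ×ˢ (univ : Set (Sp n)), HasFDerivAt (Function.uncurry f)
      ((ContinuousLinearMap.smulRight (1 : ℝ →L[ℝ] ℝ) (Function.uncurry g u)).coprod
        (Function.uncurry A u)) u := by
    intro u hu
    refine (hasStrictFDerivAt_uncurry_coprod (f := f)
      (f₁ := fun t x => ContinuousLinearMap.smulRight (1 : ℝ →L[ℝ] ℝ) (g t x)) (f₂ := A)
      ?_ ?_ ?_ ?_).hasFDerivAt
    · filter_upwards [ho.mem_nhds hu] with v hv using (hft v.1 hv.1 v.2).hasFDerivAt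
    · filter_upwards [ho.mem_nhds hu] with v hv using hfx v.1 hv.1 v.2
    · exact hsr.continuousOn.continuousAt (ho.mem_nhds hu)
    · exact hA.continuousOn.continuousAt (ho.mem_nhds hu)
  rw [contDiffOn_succ_iff_fderiv_of_isOpen ho]
  refine ⟨fun u hu => (hd u hu).differentiableAt.differentiableWithinAt, by simp, ?_⟩
  have h1 : ContDiffOn ℝ m (fun u =>
      (ContinuousLinearMap.smulRight (1 : ℝ →L[ℝ] ℝ) (Function.uncurry g u)).comp
        (ContinuousLinearMap.fst ℝ ℝ (Sp n)) +
      (Function.uncurry A u).comp (ContinuousLinearMap.snd ℝ ℝ (Sp n))) (Ioo 0 T ×ˢ univ) :=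
    (hsr.clm_comp contDiffOn_const).add (hA.clm_comp contDiffOn_const)
  refine h1.congr fun u hu => ?_
  rw [(hd u hu).fderiv]
  ext <;> simp

/-- The time derivative falls on `f` and the space derivative on the kernel; each is a convolution
of a function in `SliceBdd`, hence jointly continuous. -/
lemma contDiffOn_cvl [CompleteSpace E] (K : 𝓢(Sp n, E)) {T : ℝ} {f g : ℝ → Sp n → ℂ}
    (hf : SliceBdd T f) (hg : SliceBdd T g)
    (hfg : ∀ t ∈ Ioo 0 T, ∀ y, HasDerivAt (fun s => f s y) (g t y) t) :
    ContDiffOn ℝ 1 (Function.uncurry fun t x => cvl K (f t) x) (Ioo 0 T ×ˢ univ) := by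
  have := contDiffOn_succ_uncurry 0 (f := fun t x => cvl K (f t) x) (g := fun t x => cvl K (g t) x)
    (A := fun t x => cvl (fderivCLM ℂ (Sp n) E K) (f t) x) (T := T)
    (fun t ht x => hasDerivAt_cvl_time K hf hg hfg ht x)
    (fun t ht x => hasFDerivAt_cvl K (hf.wint t ht) x)
    (contDiffOn_zero.2 (continuousOn_cvl K hg)) (contDiffOn_zero.2 (continuousOn_cvl _ hf))
  simpa using this

/-! ### Algebra of convolutions -/

lemma cvl_add (K : 𝓢(Sp n, E)) {f g : Sp n → ℂ} (hf : WInt f) (hg : WInt g) (x : Sp n) :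
    cvl K (fun y => f y + g y) x = cvl K f x + cvl K g x := by
  unfold cvl
  simp_rw [add_smul]
  exact integral_add (hf.integrable_smul K x) (hg.integrable_smul K x)

lemma cvl_const_mul (K : 𝓢(Sp n, E)) (c : ℂ) (f : Sp n → ℂ) (x : Sp n) :
    cvl K (fun y => c * f y) x = c • cvl K f x := by
  unfold cvl
  simp_rw [mul_smul]
  exact integral_smul c _

lemma cvl_sum (K : 𝓢(Sp n, E)) {ι : Type} (s : Finset ι) {f : ι → Sp n → ℂ}
    (hf : ∀ i ∈ s, WInt (f i)) (x : Sp n) :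
    cvl K (fun y => ∑ i ∈ s, f i y) x = ∑ i ∈ s, cvl K (f i) x := by
  unfold cvl
  simp_rw [Finset.sum_smul]
  exact integral_finsetSum s fun i hi => (hf i hi).integrable_smul K x

lemma WInt.add {f g : Sp n → ℂ} (hf : WInt f) (hg : WInt g) : WInt fun y => f y + g y := by
  refine ⟨hf.1.add hg.1, (hf.2.add hg.2).mono'
    (continuous_wt.aestronglyMeasurable.mul (hf.1.add hg.1).norm) (Eventually.of_forall fun y => ?_)⟩
  have hw := wt_pos y
  rw [Real.norm_of_nonneg (by positivity), Pi.add_apply, ← mul_add]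
  gcongr
  exact norm_add_le _ _

lemma WInt.const_mul {f : Sp n → ℂ} (hf : WInt f) (c : ℂ) : WInt fun y => c * f y := by
  refine ⟨hf.1.const_mul c, (hf.2.const_mul ‖c‖).congr (Eventually.of_forall fun y => ?_)⟩
  simp only [norm_mul]
  ring

lemma WInt.sum {ι : Type} (s : Finset ι) {f : ι → Sp n → ℂ} (hf : ∀ i ∈ s, WInt (f i)) :
    WInt fun y => ∑ i ∈ s, f i y := by
  classical
  induction s using Finset.induction_on with
  | empty =>
    simp only [Finset.sum_empty]
    exact WInt.of_integrable (integrable_zero (Sp n) ℂ volume)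
  | insert a s ha ih =>
    simp_rw [Finset.sum_insert ha]
    exact (hf a (Finset.mem_insert_self a s)).add
      (ih fun i hi => hf i (Finset.mem_insert_of_mem hi))

/-- Derivatives may be moved onto the kernel. -/
lemma cvl_fderiv (K : 𝓢(Sp n, E)) {f : Sp n → ℂ} (v : Sp n) (hd : Differentiable ℝ f)
    (hf : WInt f) (hf' : WInt fun y => fderiv ℝ f y v) (x : Sp n) :
    cvl K (fun y => fderiv ℝ f y v) x = cvl (∂_{v} K) f x := by
  have hK : ∀ y, HasFDerivAt (fun y => K (x - y)) (-(fderiv ℝ K (x - y))) y := fun y => by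
    have h1 := (K.hasFDerivAt (x - y)).comp y ((hasFDerivAt_id y).const_sub x)
    refine h1.congr_fderiv ?_
    ext w; simp
  have hK' : ∀ y, fderiv ℝ (fun y => K (x - y)) y v = -(∂_{v} K) (x - y) := fun y => by
    rw [(hK y).fderiv, lineDerivOp_apply_eq_fderiv]; rfl
  have h := integral_smul_fderiv_eq_neg_fderiv_smul_of_integrable (μ := (volume : Measure (Sp n)))
    (f := f) (g := fun y => K (x - y)) (v := v) (hf'.integrable_smul K x)
    (by simp_rw [hK', smul_neg]; exact (hf.integrable_smul _ x).neg)
    (hf.integrable_smul K x) (fun y _ => hd y) (fun y _ => (hK y).differentiableAt)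
  simp_rw [hK', smul_neg, integral_neg, neg_inj] at h
  exact h.symm

/-- The derivative of a convolution in the direction `v`. -/
lemma cvl_fderivCLM_apply [CompleteSpace E] (K : 𝓢(Sp n, E)) {f : Sp n → ℂ} (hf : WInt f)
    (x v : Sp n) : cvl (fderivCLM ℂ (Sp n) E K) f x v = cvl (∂_{v} K) f x := by
  unfold cvl
  rw [ContinuousLinearMap.integral_apply (hf.integrable_smul _ x)]
  rfl

lemma SliceBdd.add {T : ℝ} {f g : ℝ → Sp n → ℂ} (hf : SliceBdd T f) (hg : SliceBdd T g) :
    SliceBdd T fun t y => f t y + g t y := by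
  obtain ⟨M, hM⟩ := hf.bdd
  obtain ⟨M', hM'⟩ := hg.bdd
  refine ⟨hf.cont.add hg.cont, fun t ht => (hf.wint t ht).add (hg.wint t ht), M + M',
    fun t ht => ?_⟩
  refine (integral_mono ((hf.wint t ht).add (hg.wint t ht)).2
    ((hf.wint t ht).2.add (hg.wint t ht).2) fun y => ?_).trans
    ((integral_add (hf.wint t ht).2 (hg.wint t ht).2).trans_le (add_le_add (hM t ht) (hM' t ht)))
  have hw := wt_pos y
  simp only [Pi.add_apply, ← mul_add]
  gcongr
  exact norm_add_le _ _

lemma SliceBdd.const_mul {T : ℝ} {f : ℝ → Sp n → ℂ} (hf : SliceBdd T f) (c : ℂ) :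
    SliceBdd T fun t y => c * f t y := by
  obtain ⟨M, hM⟩ := hf.bdd
  refine ⟨hf.cont.const_smul c, fun t ht => (hf.wint t ht).const_mul c, ‖c‖ * M, fun t ht => ?_⟩
  have : ∀ y, wt y * ‖c * f t y‖ = ‖c‖ * (wt y * ‖f t y‖) := fun y => by rw [norm_mul]; ring
  simp_rw [this, integral_const_mul]
  gcongr
  exact hM t ht

lemma SliceBdd.sum {T : ℝ} {ι : Type} (s : Finset ι) {f : ι → ℝ → Sp n → ℂ}
    (hf : ∀ i ∈ s, SliceBdd T (f i)) : SliceBdd T fun t y => ∑ i ∈ s, f i t y := by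
  classical
  induction s using Finset.induction_on with
  | empty =>
    refine ⟨by simpa using! continuousOn_const, fun t _ => ?_, 0, by simp⟩
    simp only [Finset.sum_empty]
    exact WInt.of_integrable (integrable_zero (Sp n) ℂ volume)
  | insert a s ha ih =>
    simp_rw [Finset.sum_insert ha]
    exact (hf a (Finset.mem_insert_self a s)).add
      (ih fun i hi => hf i (Finset.mem_insert_of_mem hi))

/-! ### Slices bounded in `L¹` or `L²`. -/

lemma continuous_slice {V : Type} [TopologicalSpace V] {T : ℝ} {f : ℝ → Sp n → V}
    (hf : ContinuousOn (Function.uncurry f) (Ioo 0 T ×ˢ univ)) {t : ℝ} (ht : t ∈ Ioo 0 T) :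
    Continuous (f t) := by
  rw [← continuousOn_univ]
  exact hf.comp (f := fun y => (t, y)) (by fun_prop) (fun y _ => ⟨ht, mem_univ _⟩)

lemma SliceBdd.of_eLpNorm_one {T : ℝ} {f : ℝ → Sp n → ℂ}
    (hf : ContinuousOn (Function.uncurry f) (Ioo 0 T ×ˢ univ)) {M : ℝ≥0}
    (hM : ∀ t ∈ Ioo 0 T, eLpNorm (f t) 1 volume ≤ M) : SliceBdd T f := by
  have hi : ∀ t ∈ Ioo 0 T, Integrable (f t) := fun t ht => memLp_one_iff_integrable.1
    ⟨(continuous_slice hf ht).aestronglyMeasurable, (hM t ht).trans_lt ENNReal.coe_lt_top⟩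
  refine ⟨hf, fun t ht => WInt.of_integrable (hi t ht), M, fun t ht => ?_⟩
  calc ∫ y, wt y * ‖f t y‖ ≤ ∫ y, ‖f t y‖ := by
        refine integral_mono (WInt.of_integrable (hi t ht)).2 (hi t ht).norm fun y => ?_
        exact mul_le_of_le_one_left (norm_nonneg _) (wt_le_one y)
    _ = (eLpNorm (f t) 1 volume).toReal := by
        rw [eLpNorm_one_eq_lintegral_enorm, integral_norm_eq_lintegral_enorm (hi t ht).1]
    _ ≤ M := ENNReal.toReal_le_coe_of_le_coe (hM t ht)

/-- The weight lies in `L²`, so Cauchy-Schwarz against it turns a uniform `L²` bound into a uniform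
weighted `L¹` bound. -/
lemma SliceBdd.of_eLpNorm_two {T : ℝ} {f : ℝ → Sp n → ℂ}
    (hf : ContinuousOn (Function.uncurry f) (Ioo 0 T ×ˢ univ)) {M : ℝ≥0}
    (hM : ∀ t ∈ Ioo 0 T, eLpNorm (f t) 2 volume ≤ M) : SliceBdd T f := by
  have hi : ∀ t ∈ Ioo 0 T, MemLp (f t) 2 := fun t ht =>
    ⟨(continuous_slice hf ht).aestronglyMeasurable, (hM t ht).trans_lt ENNReal.coe_lt_top⟩
  have hwt : eLpNorm (wt : Sp n → ℝ) 2 volume ≠ ⊤ := memLp_two_wt.2.ne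
  refine ⟨hf, fun t ht => WInt.of_memLp_two (hi t ht),
    (eLpNorm (wt : Sp n → ℝ) 2 volume * M).toReal, fun t ht => ?_⟩
  have h2 := (WInt.of_memLp_two (hi t ht))
  calc ∫ y, wt y * ‖f t y‖ = ∫ y, ‖wt y • f t y‖ := by
        refine integral_congr_ae (Eventually.of_forall fun y => ?_)
        simp only [norm_smul, Real.norm_of_nonneg (wt_pos y).le]
    _ = (eLpNorm ((wt : Sp n → ℝ) • f t) 1 volume).toReal := by
        rw [eLpNorm_one_eq_lintegral_enorm]
        exact integral_norm_eq_lintegral_enorm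
          (continuous_wt.aestronglyMeasurable.smul (hi t ht).1)
    _ ≤ (eLpNorm (wt : Sp n → ℝ) 2 volume * M).toReal := by
        refine ENNReal.toReal_mono (ENNReal.mul_ne_top hwt ENNReal.coe_ne_top) ?_
        refine (eLpNorm_smul_le_mul_eLpNorm (p := 2) (q := 2) (r := 1) (hi t ht).1
          continuous_wt.aestronglyMeasurable).trans ?_
        gcongr
        exact hM t ht

end

/-! ### Fourier multipliers as convolutions -/

lemma continuous_fourierInv {a : Sp n → ℂ} (ha : Integrable a) : Continuous (𝓕⁻ a) :=
  VectorFourier.fourierIntegral_continuous Real.continuous_fourierChar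
    (L := -innerₗ (Sp n)) (by simp only [LinearMap.neg_apply, innerₗ_apply_apply]; fun_prop) ha

lemma norm_fourierInv_le {a : Sp n → ℂ} (x : Sp n) : ‖𝓕⁻ a x‖ ≤ ∫ ζ, ‖a ζ‖ := by
  rw [Real.fourierInv_eq]
  refine (norm_integral_le_integral_norm _).trans_eq ?_
  simp

/-- Convolution with a Schwartz kernel acts on inverse Fourier transforms of integrable functions
by multiplication with the symbol. -/
lemma cvl_fourierInv (σ : 𝓢(Sp n, ℂ)) {a : Sp n → ℂ} (ha : Integrable a) (x : Sp n) :
    cvl (𝓕⁻ σ) (𝓕⁻ a) x = 𝓕⁻ (fun ζ => σ ζ * a ζ) x := by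
  set K : 𝓢(Sp n, ℂ) := 𝓕⁻ σ
  -- Plane waves are eigenfunctions of the convolution, with the symbol as eigenvalue; Fubini then
  -- superposes them with density `a`.
  have hK : ∀ ζ, ∫ y, Real.fourierChar ⟪ζ, y⟫ • K (x - y) = Real.fourierChar ⟪ζ, x⟫ • σ ζ := by
    intro ζ
    have h1 : σ ζ = 𝓕 (K : Sp n → ℂ) ζ := by
      rw [← fourier_coe]
      simp [K]
    rw [h1, Real.fourier_eq, ← integral_sub_left_eq_self _ volume x, Circle.smul_def,
      ← integral_smul]
    refine integral_congr_ae (Eventually.of_forall fun y => ?_)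
    simp only [Circle.smul_def, smul_smul]
    congr 1
    rw [← Circle.coe_mul, ← AddChar.map_add_eq_mul]
    congr 3
    · rw [inner_sub_right, real_inner_comm ζ y]
      ring
    · congr 1; abel
  unfold cvl
  simp_rw [Real.fourierInv_eq, ← integral_smul_const]
  rw [integral_integral_swap]
  · refine integral_congr_ae (Eventually.of_forall fun ζ => ?_)
    simp only
    have : ∀ y, (Real.fourierChar ⟪ζ, y⟫ • a ζ) • K (x - y)
        = a ζ • (Real.fourierChar ⟪ζ, y⟫ • K (x - y)) := fun y => by
      simp only [Circle.smul_def, smul_eq_mul]; ring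
    simp_rw [this, integral_smul, hK]
    simp only [Circle.smul_def, smul_eq_mul]; ring
  · have hK1 : Integrable fun y => K (x - y) := K.integrable.comp_sub_left x
    have h1 := hK1.mul_prod ha
    have hc : Continuous fun p : Sp n × Sp n => (Real.fourierChar ⟪p.2, p.1⟫ : ℂ) :=
      continuous_subtype_val.comp (Real.continuous_fourierChar.comp (by fun_prop))
    refine h1.mono ((hc.aestronglyMeasurable.mul ha.1.comp_snd).mul hK1.1.comp_fst)
      (Eventually.of_forall fun p => ?_)
    simp [Function.uncurry, mul_comm]

/-- The integral is the inner product with the conjugate of `g`. This supplies the continuity needed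
to extend kernel formulas from Schwartz functions to `L²` by density. -/
lemma continuous_integral_mul_Lp {g : Sp n → ℂ} (hg : MemLp g 2) :
    Continuous fun F : Lp ℂ 2 (volume : Measure (Sp n)) => ∫ y, F y * g y := by
  have hg' : MemLp (fun y => (starRingEnd ℂ) (g y)) 2 := hg.star
  have : (fun F : Lp ℂ 2 (volume : Measure (Sp n)) => ∫ y, F y * g y)
      = fun F => inner ℂ (hg'.toLp _) F := by
    funext F
    rw [L2.inner_def]
    refine integral_congr_ae ?_
    filter_upwards [hg'.coeFn_toLp] with y hy
    rw [hy]
    simp [mul_comm]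
  rw [this]
  fun_prop

/-- A Fourier multiplier with Schwartz symbol is convolution with a Schwartz kernel. -/
lemma fourierInv_mul_fourier_Lp (σ : 𝓢(Sp n, ℂ)) (x : Sp n)
    (F : Lp ℂ 2 (volume : Measure (Sp n))) :
    𝓕⁻ (fun ζ => σ ζ * (𝓕 F : Lp ℂ 2 (volume : Measure (Sp n))) ζ) x = cvl (𝓕⁻ σ) F x := by
  have hc1 : Continuous fun F : Lp ℂ 2 (volume : Measure (Sp n)) =>
      𝓕⁻ (fun ζ => σ ζ * (𝓕 F : Lp ℂ 2 (volume : Measure (Sp n))) ζ) x := by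
    have hg : MemLp (fun ζ => (Real.fourierChar ⟪ζ, x⟫ : ℂ) * σ ζ) 2 := by
      have e : ∀ ζ, ‖σ ζ‖ = ‖(Real.fourierChar ⟪ζ, x⟫ : ℂ) * σ ζ‖ := fun ζ => by
        rw [norm_mul, Circle.norm_coe, one_mul]
      refine (σ.memLp 2).congr_norm ?_ (Eventually.of_forall e)
      exact ((continuous_subtype_val.comp (Real.continuous_fourierChar.comp
        (by fun_prop : Continuous fun ζ : Sp n => ⟪ζ, x⟫))).mul σ.continuous).aestronglyMeasurable
    have h1 := (continuous_integral_mul_Lp hg).comp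
      (ContinuousFourier.continuous_fourier (E := Lp ℂ 2 (volume : Measure (Sp n)))
        (F := Lp ℂ 2 (volume : Measure (Sp n))))
    refine h1.congr fun F => ?_
    rw [Real.fourierInv_eq]
    refine integral_congr_ae (Eventually.of_forall fun ζ => ?_)
    simp only [Circle.smul_def, smul_eq_mul]
    ring
  have hc2 : Continuous fun F : Lp ℂ 2 (volume : Measure (Sp n)) => cvl (𝓕⁻ σ) F x := by
    have hg : MemLp (fun y => (𝓕⁻ σ : 𝓢(Sp n, ℂ)) (x - y)) 2 :=
      ((𝓕⁻ σ : 𝓢(Sp n, ℂ)).memLp 2).comp_measurePreserving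
        (Measure.measurePreserving_sub_left volume x)
    exact continuous_integral_mul_Lp hg
  -- For fixed `x` both sides are continuous in `F` for the `L²` norm, so it is enough to compare
  -- them on Schwartz functions, where `cvl_fourierInv` applies.
  refine (SchwartzMap.denseRange_toLpCLM (E := Sp n) (F := ℂ) (p := 2) (μ := volume)
    ENNReal.ofNat_ne_top).induction_on
    (p := fun F => 𝓕⁻ (fun ζ => σ ζ * (𝓕 F : Lp ℂ 2 (volume : Measure (Sp n))) ζ) x
      = cvl (𝓕⁻ σ) F x) F (isClosed_eq hc1 hc2) fun f => ?_
  rw [toLpCLM_apply, toLp_fourier_eq]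
  have e1 : 𝓕⁻ (fun ζ => σ ζ * ((𝓕 f).toLp 2 volume : Sp n → ℂ) ζ) x
      = 𝓕⁻ (fun ζ => σ ζ * (𝓕 f) ζ) x := by
    refine Real.fourierInv_congr_ae ?_ x
    filter_upwards [(𝓕 f).coeFn_toLp 2 volume] with ζ hζ
    rw [hζ]
  have e2 : cvl (𝓕⁻ σ) (f.toLp 2 volume) x = cvl (𝓕⁻ σ) f x := by
    refine integral_congr_ae ?_
    filter_upwards [f.coeFn_toLp 2 volume] with ζ hζ
    rw [hζ]
  rw [e1, e2, ← cvl_fourierInv σ (𝓕 f).integrable, ← fourierInv_coe]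
  simp

/-- The `L²` inverse Fourier transform is given by the integral on integrable functions. -/
lemma coeFn_fourierInv_toLp {a : Sp n → ℂ} (h1 : Integrable a) (h2 : MemLp a 2) :
    ((𝓕⁻ (h2.toLp a) : Lp ℂ 2 (volume : Measure (Sp n))) : Sp n → ℂ) =ᵐ[volume] 𝓕⁻ a := by
  refine ae_eq_of_integral_contDiff_smul_eq
    ((Lp.memLp _).locallyIntegrable (by norm_num)) (continuous_fourierInv h1).locallyIntegrable
    fun g hg hgs => ?_
  set G : 𝓢(Sp n, ℂ) := (hgs.comp_left (g := ((↑) : ℝ → ℂ)) rfl).toSchwartzMap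
    (Complex.ofRealCLM.contDiff.comp hg)
  have hG : ∀ x, G x = (g x : ℂ) := fun x => rfl
  -- The two inverse transforms are compared by testing against `G`: Plancherel for the `L²`
  -- transform on one side, Fubini for the integral on the other.
  have hin := Lp.inner_fourier_eq (G.toLp 2 volume)
    (𝓕⁻ (h2.toLp a) : Lp ℂ 2 (volume : Measure (Sp n)))
  rw [FourierInvPair.fourier_fourierInv_eq, toLp_fourier_eq, L2.inner_def, L2.inner_def] at hin
  have hl : ∫ ζ, inner ℂ (((𝓕 G).toLp 2 volume : Sp n → ℂ) ζ) ((h2.toLp a : Sp n → ℂ) ζ)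
      = ∫ ζ, inner ℂ (𝓕 (G : Sp n → ℂ) ζ) (a ζ) := by
    refine integral_congr_ae ?_
    filter_upwards [(𝓕 G).coeFn_toLp 2 volume, h2.coeFn_toLp] with ζ e1 e2
    rw [e1, e2, fourier_coe]
  have hr : ∫ ζ, inner ℂ ((G.toLp 2 volume : Sp n → ℂ) ζ)
        ((𝓕⁻ (h2.toLp a) : Lp ℂ 2 (volume : Measure (Sp n))) ζ)
      = ∫ ζ, g ζ • ((𝓕⁻ (h2.toLp a) : Lp ℂ 2 (volume : Measure (Sp n))) ζ) := by
    refine integral_congr_ae ?_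
    filter_upwards [G.coeFn_toLp 2 volume] with ζ e1
    rw [e1, hG]
    simp [mul_comm]
  rw [hl, hr] at hin
  rw [← hin]
  have := VectorFourier.integral_sesq_fourierIntegral_eq_neg_flip (innerSL ℂ)
    (L := innerₗ (Sp n)) (μ := volume) (ν := volume) Real.continuous_fourierChar
    (by simp only [innerₗ_apply_apply]; fun_prop) G.integrable h1
  simp only [innerSL_apply_apply, flip_innerₗ] at this
  refine this.trans (integral_congr_ae (Eventually.of_forall fun ζ => ?_))
  simp only [hG]
  change inner ℂ (g ζ : ℂ) (𝓕⁻ a ζ) = _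
  simp [mul_comm]

/-! ### Littlewood-Paley kernels -/

lemma IsBump.hasCompactSupport (hη : IsBump η) : HasCompactSupport η :=
  HasCompactSupport.intro (isCompact_closedBall 0 2) fun x hx => hη.eq_zero x (by
    simpa using (le_of_lt (by simpa using hx : 2 < ‖x‖)))

/-- The dilation factor taking the frequency variable of the transform to the argument of `η`. -/
def freqScale (k : ℤ) : ℝ := (2 : ℝ) ^ (-k) * (2 * Real.pi)

lemma freqScale_pos (k : ℤ) : 0 < freqScale k := by unfold freqScale; positivity

/-- The symbol of `P_{≤ k}`. -/
def symLE (hη : IsBump η) (k : ℤ) : 𝓢(Sp n, ℂ) :=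
  HasCompactSupport.toSchwartzMap (f := fun ζ => (η (freqScale k • ζ) : ℂ))
    ((hη.hasCompactSupport.comp_smul (freqScale_pos k).ne').comp_left
      (g := ((↑) : ℝ → ℂ)) rfl)
    (Complex.ofRealCLM.contDiff.comp (hη.smooth.comp (contDiff_const_smul (freqScale k))))

lemma symLE_apply (hη : IsBump η) (k : ℤ) (ζ : Sp n) :
    symLE hη k ζ = (η ((2 : ℝ) ^ (-k) • ((2 * Real.pi) • ζ)) : ℂ) := by
  rw [smul_smul]; rfl

/-- The frequency radius. -/
def rad (ζ : Sp n) : ℝ := 2 * Real.pi * ‖ζ‖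

lemma norm_freq (k : ℤ) (ζ : Sp n) :
    ‖(2 : ℝ) ^ (-k) • ((2 * Real.pi) • ζ)‖ = (2 : ℝ) ^ (-k) * rad ζ := by
  rw [norm_smul, norm_smul, Real.norm_of_nonneg (by positivity), Real.norm_of_nonneg (by positivity)]
  rfl

lemma symLE_eq_one (hη : IsBump η) {k : ℤ} {ζ : Sp n} (h : rad ζ ≤ 2 ^ k) : symLE hη k ζ = 1 := by
  rw [symLE_apply, hη.eq_one, Complex.ofReal_one]
  rw [norm_freq, zpow_neg, inv_mul_le_iff₀ (by positivity), mul_one]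
  exact h

lemma symLE_eq_zero (hη : IsBump η) {k : ℤ} {ζ : Sp n} (h : (2 : ℝ) ^ (k + 1) ≤ rad ζ) :
    symLE hη k ζ = 0 := by
  rw [symLE_apply, hη.eq_zero, Complex.ofReal_zero]
  rw [norm_freq, zpow_neg, le_inv_mul_iff₀ (by positivity)]
  rwa [zpow_add₀ two_ne_zero, zpow_one] at h

/-- The symbol of `P_k`. -/
def symP (hη : IsBump η) (k : ℤ) : 𝓢(Sp n, ℂ) := symLE hη k - symLE hη (k - 1)

lemma symP_apply (hη : IsBump η) (k : ℤ) (ζ : Sp n) :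
    symP hη k ζ = symLE hη k ζ - symLE hη (k - 1) ζ := rfl

lemma symP_eq_zero_of_le (hη : IsBump η) {k : ℤ} {ζ : Sp n} (h : rad ζ ≤ 2 ^ (k - 1)) :
    symP hη k ζ = 0 := by
  rw [symP_apply, symLE_eq_one hη h, symLE_eq_one hη, sub_self]
  exact h.trans (zpow_le_zpow_right₀ (by norm_num) (by lia))

lemma symP_eq_zero_of_ge (hη : IsBump η) {k : ℤ} {ζ : Sp n} (h : (2 : ℝ) ^ (k + 1) ≤ rad ζ) :
    symP hη k ζ = 0 := by
  rw [symP_apply, symLE_eq_zero hη h, symLE_eq_zero hη, sub_self]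
  exact (zpow_le_zpow_right₀ (by norm_num) (by lia)).trans h

/-- The kernel of `P_{≤ k}`. -/
def kerLE (hη : IsBump η) (k : ℤ) : 𝓢(Sp n, ℂ) := 𝓕⁻ (symLE hη k)

/-- The kernel of `P_k`. -/
def kerP (hη : IsBump η) (k : ℤ) : 𝓢(Sp n, ℂ) := 𝓕⁻ (symP hη k)

lemma projLE_eq_fourierInv (hη : IsBump η) (k : ℤ) {f : Sp n → ℂ} (hf : MemLp f 2) (x : Sp n) :
    projLE η k f x = 𝓕⁻ (fun ζ => symLE hη k ζ *
      (𝓕 (hf.toLp f) : Lp ℂ 2 (volume : Measure (Sp n))) ζ) x := by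
  unfold projLE multiplier
  rw [dif_pos hf]
  simp_rw [symLE_apply]

lemma cvl_congr_ae {E : Type} [NormedAddCommGroup E] [NormedSpace ℂ E] (K : 𝓢(Sp n, E))
    {f g : Sp n → ℂ} (h : f =ᵐ[volume] g) (x : Sp n) : cvl K f x = cvl K g x := by
  refine integral_congr_ae ?_
  filter_upwards [h] with y hy
  rw [hy]

/-- From here on projections are handled as convolutions. The multiplier is set to `0` outside `L²`,
whereas the convolution keeps its meaning on `L¹`, where the products of components lie. -/
lemma projLE_eq_cvl (hη : IsBump η) (k : ℤ) {f : Sp n → ℂ} (hf : MemLp f 2) (x : Sp n) :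
    projLE η k f x = cvl (kerLE hη k) f x := by
  rw [projLE_eq_fourierInv hη k hf, fourierInv_mul_fourier_Lp]
  exact cvl_congr_ae _ hf.coeFn_toLp x

lemma fourierInv_sub (σ τ : 𝓢(Sp n, ℂ)) : 𝓕⁻ (σ - τ) = 𝓕⁻ σ - 𝓕⁻ τ := by
  rw [sub_eq_add_neg, sub_eq_add_neg, ← neg_one_smul ℂ τ, ← neg_one_smul ℂ (𝓕⁻ τ),
    FourierTransform.fourierInv_add, FourierTransform.fourierInv_smul]

lemma kerP_eq (hη : IsBump η) (k : ℤ) : kerP hη k = kerLE hη k - kerLE hη (k - 1) := by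
  unfold kerP kerLE symP
  exact fourierInv_sub _ _

lemma cvl_sub_kernel {E : Type} [NormedAddCommGroup E] [NormedSpace ℂ E] (K K' : 𝓢(Sp n, E))
    {f : Sp n → ℂ} (hf : WInt f) (x : Sp n) : cvl (K - K') f x = cvl K f x - cvl K' f x := by
  unfold cvl
  rw [← integral_sub (hf.integrable_smul K x) (hf.integrable_smul K' x)]
  simp_rw [← smul_sub]
  rfl

lemma proj_eq_cvl (hη : IsBump η) (k : ℤ) {f : Sp n → ℂ} (hf : MemLp f 2) (x : Sp n) :
    proj η k f x = cvl (kerP hη k) f x := by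
  unfold proj
  rw [projLE_eq_cvl hη _ hf, projLE_eq_cvl hη _ hf, kerP_eq,
    cvl_sub_kernel _ _ (WInt.of_memLp_two hf)]

lemma integrable_mul_fourier (σ : 𝓢(Sp n, ℂ)) (F : Lp ℂ 2 (volume : Measure (Sp n))) :
    Integrable fun ζ => σ ζ * (𝓕 F : Lp ℂ 2 (volume : Measure (Sp n))) ζ :=
  (σ.memLp 2).integrable_mul (Lp.memLp (𝓕 F : Lp ℂ 2 (volume : Measure (Sp n))))

lemma memLp_mul_fourier (σ : 𝓢(Sp n, ℂ)) (F : Lp ℂ 2 (volume : Measure (Sp n))) :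
    MemLp (fun ζ => σ ζ * (𝓕 F : Lp ℂ 2 (volume : Measure (Sp n))) ζ) 2 :=
  (Lp.memLp (𝓕 F : Lp ℂ 2 (volume : Measure (Sp n)))).mul (p := ⊤) (q := 2) (σ.memLp_top _)

lemma proj_eq_fourierInv (hη : IsBump η) (k : ℤ) {f : Sp n → ℂ} (hf : MemLp f 2) :
    proj η k f = 𝓕⁻ (fun ζ => symP hη k ζ *
      (𝓕 (hf.toLp f) : Lp ℂ 2 (volume : Measure (Sp n))) ζ) := by
  funext x
  rw [proj_eq_cvl hη k hf, fourierInv_mul_fourier_Lp]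
  exact (cvl_congr_ae _ hf.coeFn_toLp x).symm

/-! ### Functions of low frequency -/

/-- Inverse Fourier transforms of integrable functions supported in frequency radius `< ρ`. -/
def LowFreq (ρ : ℝ) (u : Sp n → ℂ) : Prop :=
  ∃ a : Sp n → ℂ, Integrable a ∧ (∀ ζ, ρ ≤ rad ζ → a ζ = 0) ∧ u = 𝓕⁻ a

lemma lowFreq_proj (hη : IsBump η) (k : ℤ) {f : Sp n → ℂ} (hf : MemLp f 2) :
    LowFreq (2 ^ (k + 1)) (proj η k f) :=
  ⟨_, integrable_mul_fourier _ _, fun ζ hζ => by simp only [symP_eq_zero_of_ge hη hζ, zero_mul],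
    proj_eq_fourierInv hη k hf⟩

/-- The product of two inverse transforms is the inverse transform of the convolution of the
densities, and frequency radii add under convolution. -/
lemma LowFreq.mul {ρ ρ' : ℝ} {u v : Sp n → ℂ} (hu : LowFreq ρ u) (hv : LowFreq ρ' v) :
    LowFreq (ρ + ρ') fun x => u x * v x := by
  obtain ⟨a, ha, hsa, rfl⟩ := hu
  obtain ⟨b, hb, hsb, rfl⟩ := hv
  refine ⟨convolution a b (ContinuousLinearMap.mul ℂ ℂ) volume, ha.integrable_convolution _ hb,
    fun ζ hζ => ?_, ?_⟩
  · rw [convolution_def]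
    refine integral_eq_zero_of_ae (Eventually.of_forall fun θ => ?_)
    simp only [ContinuousLinearMap.mul_apply', Pi.zero_apply]
    by_cases h : ρ ≤ rad θ
    · rw [hsa θ h, zero_mul]
    · rw [hsb _ ?_, mul_zero]
      have : rad ζ ≤ rad θ + rad (ζ - θ) := by
        unfold rad
        rw [← mul_add]
        gcongr
        exact norm_le_norm_add_norm_sub' ζ θ |>.trans_eq (by rw [norm_sub_rev])
      linarith
  · funext x
    rw [Real.fourierInv_eq_fourier_neg, Real.fourierInv_eq_fourier_neg,
      Real.fourierInv_eq_fourier_neg, Real.fourier_mul_convolution_eq ha hb]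

lemma LowFreq.cvl {ρ : ℝ} {u : Sp n → ℂ} (hu : LowFreq ρ u) (K : 𝓢(Sp n, ℂ)) :
    LowFreq ρ (cvl K u) := by
  obtain ⟨a, ha, hs, rfl⟩ := hu
  refine ⟨fun ζ => (𝓕 K) ζ * a ζ, ?_, fun ζ hζ => by simp only [hs ζ hζ, mul_zero], ?_⟩
  · obtain ⟨C, -, hC⟩ := exists_kernel_bound (𝓕 K) 0
    exact ha.bdd_mul (c := C) (𝓕 K).continuous.aestronglyMeasurable
      (Eventually.of_forall fun ζ => by simpa using hC ζ)
  · funext x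
    have h := cvl_fourierInv (𝓕 K) ha x
    rwa [FourierTransform.fourierInv_fourier_eq] at h

/-- Low frequencies are annihilated by `P_0`. -/
lemma LowFreq.cvl_kerP {ρ : ℝ} {u : Sp n → ℂ} (hu : LowFreq ρ u) (hη : IsBump η) {k : ℤ}
    (h : ρ ≤ 2 ^ (k - 1)) (x : Sp n) : WaveMaps.cvl (kerP hη k) u x = 0 := by
  obtain ⟨a, ha, hs, rfl⟩ := hu
  rw [kerP, cvl_fourierInv _ ha, Real.fourierInv_eq]
  refine integral_eq_zero_of_ae (Eventually.of_forall fun ζ => ?_)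
  by_cases hζ : ρ ≤ rad ζ
  · simp [hs ζ hζ]
  · simp [symP_eq_zero_of_le hη ((not_le.1 hζ).le.trans h)]

/-- Low frequencies are reproduced by `P_{≤ k}`. -/
lemma LowFreq.cvl_kerLE {ρ : ℝ} {u : Sp n → ℂ} (hu : LowFreq ρ u) (hη : IsBump η) {k : ℤ}
    (h : ρ ≤ 2 ^ k) (x : Sp n) : WaveMaps.cvl (kerLE hη k) u x = u x := by
  obtain ⟨a, ha, hs, rfl⟩ := hu
  rw [kerLE, cvl_fourierInv _ ha]
  refine congrArg (fun b : Sp n → ℂ => 𝓕⁻ b x) (funext fun ζ => ?_)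
  by_cases hζ : ρ ≤ rad ζ
  · simp [hs ζ hζ]
  · simp [symLE_eq_one hη ((not_le.1 hζ).le.trans h)]

/-! ### The Littlewood-Paley expansion -/

/-- The sum telescopes; the symmetric range of frequencies exhausts the integers as `m` grows. -/
lemma sum_proj (η : Sp n → ℝ) (f : Sp n → ℂ) (m : ℕ) (x : Sp n) :
    ∑ k ∈ Finset.Icc (-(m : ℤ)) m, proj η k f x = projLE η m f x - projLE η (-(m : ℤ) - 1) f x := by
  induction m with
  | zero => simp [proj]
  | succ m ih =>
    have : Finset.Icc (-((m + 1 : ℕ) : ℤ)) ((m + 1 : ℕ) : ℤ)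
        = insert (-((m + 1 : ℕ) : ℤ)) (insert ((m + 1 : ℕ) : ℤ) (Finset.Icc (-(m : ℤ)) m)) := by
      ext k; simp only [Finset.mem_Icc, Finset.mem_insert]; lia
    rw [this, Finset.sum_insert, Finset.sum_insert, ih]
    · unfold proj
      have e1 : ((m + 1 : ℕ) : ℤ) - 1 = m := by push_cast; ring
      have e2 : (-((m + 1 : ℕ) : ℤ)) = -(m : ℤ) - 1 := by push_cast; ring
      rw [e1, e2]; ring
    · simp
    · simp only [Finset.mem_insert, Finset.mem_Icc]; lia

/-- Identifies the pointwise projection with a representative of an `L²` inverse transform, which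
makes Plancherel available for the partial sums. -/
lemma projLE_sub_eq_ae (hη : IsBump η) {f : Sp n → ℂ} (hf : MemLp f 2) (k j : ℤ) :
    (fun x => projLE η k f x - projLE η j f x) =ᵐ[volume]
      (𝓕⁻ ((memLp_mul_fourier (symLE hη k - symLE hη j) (hf.toLp f)).toLp _) :
        Lp ℂ 2 (volume : Measure (Sp n))) := by
  have h := coeFn_fourierInv_toLp (integrable_mul_fourier (symLE hη k - symLE hη j) (hf.toLp f))
    (memLp_mul_fourier (symLE hη k - symLE hη j) (hf.toLp f))
  refine EventuallyEq.trans (Eventually.of_forall fun x => ?_) h.symm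
  simp only
  rw [fourierInv_mul_fourier_Lp, cvl_congr_ae _ hf.coeFn_toLp,
    projLE_eq_cvl hη _ hf, projLE_eq_cvl hη _ hf, ← cvl_sub_kernel _ _ (WInt.of_memLp_two hf),
    kerLE, kerLE, ← fourierInv_sub]

lemma exists_bump_bound (hη : IsBump η) : ∃ B : ℝ, ∀ ξ, ‖η ξ‖ ≤ B :=
  hη.smooth.continuous.bounded_above_of_compact_support hη.hasCompactSupport

/-- By Plancherel the claim concerns `(σ_m - 1) 𝓕 f`. The symbols `σ_m` are uniformly bounded and
equal `1` at each fixed nonzero frequency from some `m` on, so dominated convergence applies; the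
origin is a null set because `n ≠ 0`. -/
lemma tendsto_sum_proj [NeZero n] (hη : IsBump η) {f : Sp n → ℂ} (hf : MemLp f 2) :
    Tendsto (fun m : ℕ => eLpNorm (fun x => ∑ k ∈ Finset.Icc (-(m : ℤ)) m, proj η k f x - f x)
      2 volume) atTop (𝓝 0) := by
  set F : Lp ℂ 2 (volume : Measure (Sp n)) := hf.toLp f
  set G : Lp ℂ 2 (volume : Measure (Sp n)) := 𝓕 F
  set σ : ℕ → 𝓢(Sp n, ℂ) := fun m => symLE hη m - symLE hη (-(m : ℤ) - 1)
  have h1 : ∀ m : ℕ, eLpNorm (fun x => ∑ k ∈ Finset.Icc (-(m : ℤ)) m, proj η k f x - f x) 2 volume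
      = eLpNorm (fun ζ => σ m ζ * G ζ - G ζ) 2 volume := by
    intro m
    set A := (memLp_mul_fourier (σ m) F).toLp _
    have e1 : (fun x => ∑ k ∈ Finset.Icc (-(m : ℤ)) m, proj η k f x - f x) =ᵐ[volume]
        ((𝓕⁻ A - F : Lp ℂ 2 (volume : Measure (Sp n))) : Sp n → ℂ) := by
      filter_upwards [projLE_sub_eq_ae hη hf m (-(m : ℤ) - 1), hf.coeFn_toLp,
        Lp.coeFn_sub (𝓕⁻ A : Lp ℂ 2 (volume : Measure (Sp n))) F] with x hx hx2 hx3
      rw [hx3, Pi.sub_apply, sum_proj, hx, hx2]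
    have e2 : (fun ζ => σ m ζ * G ζ - G ζ) =ᵐ[volume]
        ((A - G : Lp ℂ 2 (volume : Measure (Sp n))) : Sp n → ℂ) := by
      filter_upwards [Lp.coeFn_sub A G, (memLp_mul_fourier (σ m) F).coeFn_toLp] with ζ h1 h2
      rw [h1, Pi.sub_apply, h2]
    rw [eLpNorm_congr_ae e1, eLpNorm_congr_ae e2, ← Lp.enorm_def, ← Lp.enorm_def]
    have e3 : 𝓕 (𝓕⁻ A - F) = A - G := by
      have := (Lp.fourierTransformₗᵢ (Sp n) ℂ).map_sub (𝓕⁻ A) F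
      have h' : (𝓕 (𝓕⁻ A : Lp ℂ 2 (volume : Measure (Sp n)))
        : Lp ℂ 2 (volume : Measure (Sp n))) = A := FourierInvPair.fourier_fourierInv_eq A
      exact this.trans (congrArg (· - G) h')
    rw [← e3, ← ofReal_norm, ← ofReal_norm, Lp.norm_fourier_eq]
  simp_rw [h1]
  obtain ⟨B, hB⟩ := exists_bump_bound hη
  have hB0 : 0 ≤ B := (norm_nonneg _).trans (hB 0)
  have hGm : AEStronglyMeasurable G volume := (Lp.memLp G).1
  have hσ : ∀ m ζ, ‖σ m ζ - 1‖ ≤ 2 * B + 1 := by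
    intro m ζ
    have hs : ∀ k, ‖symLE hη k ζ‖ ≤ B := fun k => by
      rw [symLE_apply, Complex.norm_real]; exact hB _
    calc ‖symLE hη m ζ - symLE hη (-(m : ℤ) - 1) ζ - 1‖
        ≤ ‖symLE hη m ζ‖ + ‖symLE hη (-(m : ℤ) - 1) ζ‖ + ‖(1 : ℂ)‖ :=
          (norm_sub_le _ _).trans (by gcongr; exact norm_sub_le _ _)
      _ ≤ 2 * B + 1 := by rw [norm_one]; linarith [hs m, hs (-(m : ℤ) - 1)]
  have hlim : Tendsto (fun m : ℕ => ∫⁻ ζ, ‖σ m ζ * G ζ - G ζ‖ₑ ^ (2 : ℝ)) atTop (𝓝 0) := by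
    have := tendsto_lintegral_of_dominated_convergence' (μ := (volume : Measure (Sp n)))
      (F := fun m ζ => ‖σ m ζ * G ζ - G ζ‖ₑ ^ (2 : ℝ)) (f := fun _ => 0)
      (fun ζ => (ENNReal.ofReal (2 * B + 1) * ‖G ζ‖ₑ) ^ (2 : ℝ))
      (fun m => ((((σ m).continuous.aestronglyMeasurable.mul hGm).sub hGm).enorm).pow_const _)
      (fun m => Eventually.of_forall fun ζ => ?_) ?_ ?_
    · simpa using this
    · simp only
      gcongr
      rw [show σ m ζ * G ζ - G ζ = (σ m ζ - 1) * G ζ by ring, enorm_mul]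
      gcongr
      rw [← ofReal_norm]
      exact ENNReal.ofReal_le_ofReal (hσ m ζ)
    · simp_rw [ENNReal.mul_rpow_of_nonneg _ _ (zero_le_two : (0 : ℝ) ≤ 2)]
      rw [lintegral_const_mul'']
      · refine ENNReal.mul_ne_top (by simp) ?_
        have := (lintegral_rpow_enorm_lt_top_of_eLpNorm_lt_top (p := 2) two_ne_zero
          ENNReal.ofNat_ne_top (Lp.memLp G).2).ne
        simpa using this
      · exact hGm.enorm.pow_const _
    · have h0 : ∀ᵐ ζ : Sp n, ζ ≠ 0 := by
        rw [ae_iff]; simp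
      filter_upwards [h0] with ζ hζ
      have hr : 0 < rad ζ := by
        have := norm_pos_iff.2 hζ
        unfold rad; positivity
      have ev1 : ∀ᶠ m : ℕ in atTop, rad ζ ≤ 2 ^ (m : ℤ) := by
        simp_rw [zpow_natCast]
        exact (tendsto_pow_atTop_atTop_of_one_lt one_lt_two).eventually_ge_atTop _
      have ev2 : ∀ᶠ m : ℕ in atTop, (2 : ℝ) ^ (-(m : ℤ) - 1 + 1) ≤ rad ζ := by
        have : Tendsto (fun m : ℕ => ((2 : ℝ)⁻¹) ^ m) atTop (𝓝 0) :=
          tendsto_pow_atTop_nhds_zero_of_lt_one (by norm_num) (by norm_num)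
        filter_upwards [this.eventually (ge_mem_nhds hr)] with m hm
        rw [sub_add_cancel, zpow_neg, zpow_natCast, ← inv_pow]
        exact hm
      refine tendsto_const_nhds.congr' ?_
      filter_upwards [ev1, ev2] with m h1 h2
      have : σ m ζ = 1 := by
        change symLE hη m ζ - symLE hη (-(m : ℤ) - 1) ζ = 1
        rw [symLE_eq_one hη h1, symLE_eq_zero hη h2, sub_zero]
      rw [this]; simp
  have := hlim.ennrpow_const (1 / 2 : ℝ)
  simp only [eLpNorm_eq_lintegral_rpow_enorm_toReal (two_ne_zero' ℝ≥0∞) ENNReal.ofNat_ne_top]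
  simpa using this

/-! ### Scaling of the kernels -/

/-- Rescaling the frequency variable shows that the kernels are `L¹`-normalised dilations of one
kernel. Hence their `L¹` norms do not depend on `k`, and each derivative costs exactly `2 ^ k`. -/
lemma kerLE_apply (hη : IsBump η) (k : ℤ) (x : Sp n) :
    kerLE hη k x = ((2 : ℝ) ^ k) ^ n • kerLE hη 0 ((2 : ℝ) ^ k • x) := by
  have h2 : (0 : ℝ) < 2 ^ k := by positivity
  unfold kerLE
  rw [fourierInv_coe, fourierInv_coe, Real.fourierInv_eq, Real.fourierInv_eq]
  have := Measure.integral_comp_smul_of_nonneg (μ := (volume : Measure (Sp n)))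
    (fun v => Real.fourierChar ⟪v, x⟫ • symLE hη k v) ((2 : ℝ) ^ k) (hR := h2.le)
  rw [finrank_euclideanSpace_fin] at this
  rw [← smul_inv_smul₀ (pow_ne_zero n h2.ne') (∫ v, Real.fourierChar ⟪v, x⟫ • symLE hη k v), ← this]
  congr 1
  refine integral_congr_ae (Eventually.of_forall fun ζ => ?_)
  simp only
  rw [real_inner_smul_left, real_inner_smul_right]
  congr 1
  rw [symLE_apply, symLE_apply, smul_comm (2 * Real.pi) ((2 : ℝ) ^ k), smul_smul ((2 : ℝ) ^ (-k)),
    ← zpow_add₀ two_ne_zero]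
  simp

lemma integral_norm_dilation (g : Sp n → ℂ) {R : ℝ} (hR : 0 < R) :
    ∫ x, ‖(R ^ n) • g (R • x)‖ = ∫ x, ‖g x‖ := by
  simp_rw [norm_smul, Real.norm_of_nonneg (pow_nonneg hR.le n)]
  rw [integral_const_mul, Measure.integral_comp_smul_of_nonneg _ (fun x => ‖g x‖) R (hR := hR.le),
    finrank_euclideanSpace_fin, smul_eq_mul, mul_inv_cancel_left₀ (pow_ne_zero n hR.ne')]

lemma integral_norm_kerLE (hη : IsBump η) (k : ℤ) :
    ∫ x, ‖kerLE hη k x‖ = ∫ x, ‖kerLE hη 0 x‖ := by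
  simp_rw [kerLE_apply hη k]
  exact integral_norm_dilation _ (by positivity)

lemma lineDeriv_kerLE_apply (hη : IsBump η) (k : ℤ) (v x : Sp n) :
    (∂_{v} (kerLE hη k)) x = (2 : ℝ) ^ k • (((2 : ℝ) ^ k) ^ n •
      (∂_{v} (kerLE hη 0)) ((2 : ℝ) ^ k • x)) := by
  rw [lineDerivOp_apply_eq_fderiv, lineDerivOp_apply_eq_fderiv]
  have e : (kerLE hη k : Sp n → ℂ) = fun x => ((2 : ℝ) ^ k) ^ n • kerLE hη 0 ((2 : ℝ) ^ k • x) := by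
    funext x; exact kerLE_apply hη k x
  have h1 : HasFDerivAt (fun x => ((2 : ℝ) ^ k) ^ n • kerLE hη 0 ((2 : ℝ) ^ k • x))
      (((2 : ℝ) ^ k) ^ n • (fderiv ℝ (kerLE hη 0) ((2 : ℝ) ^ k • x)).comp
        ((2 : ℝ) ^ k • ContinuousLinearMap.id ℝ (Sp n))) x :=
    HasFDerivAt.fun_const_smul (f := fun x => kerLE hη 0 ((2 : ℝ) ^ k • x))
      (((kerLE hη 0).hasFDerivAt ((2 : ℝ) ^ k • x)).comp x
        ((hasFDerivAt_id x).const_smul ((2 : ℝ) ^ k))) _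
  rw [e, h1.fderiv]
  simp only [smul_apply, ContinuousLinearMap.comp_apply,
    ContinuousLinearMap.id_apply, map_smul]
  rw [smul_comm]

lemma integral_norm_lineDeriv_kerLE (hη : IsBump η) (k : ℤ) (v : Sp n) :
    ∫ x, ‖(∂_{v} (kerLE hη k)) x‖ = 2 ^ k * ∫ x, ‖(∂_{v} (kerLE hη 0)) x‖ := by
  simp_rw [lineDeriv_kerLE_apply hη k v]
  simp_rw [norm_smul ((2 : ℝ) ^ k), integral_const_mul]
  rw [integral_norm_dilation _ (by positivity), Real.norm_of_nonneg (by positivity)]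

/-! ### Integral inequalities -/

/-- Minkowski's inequality for averages. -/
lemma eLpNorm_lintegral_le {X Y : Type} [MeasurableSpace X] [MeasurableSpace Y] {μ : Measure X}
    {ν : Measure Y} [SFinite μ] [IsFiniteMeasure ν] {h : X → Y → ℝ≥0∞}
    (hm : Measurable (Function.uncurry h)) {p : ℝ≥0∞} (hp : 1 ≤ p) {B : ℝ≥0∞}
    (hB : ∀ y, eLpNorm (fun x => h x y) p μ ≤ B) :
    eLpNorm (fun x => ∫⁻ y, h x y ∂ν) p μ ≤ ν univ * B := by
  rcases eq_or_ne p ⊤ with rfl | hpt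
  · rw [eLpNorm_exponent_top]
    refine essSup_le_of_ae_le _ ?_
    have h1 : ∀ᵐ y ∂ν, ∀ᵐ x ∂μ, h x y ≤ B := Eventually.of_forall fun y => by
      have h2 := hB y
      rw [eLpNorm_exponent_top] at h2
      filter_upwards [ae_le_eLpNormEssSup (μ := μ) (f := fun x => h x y)] with x hx
      exact hx.trans h2
    have h3 : ∀ᵐ x ∂μ, ∀ᵐ y ∂ν, h x y ≤ B := by
      rwa [Measure.ae_ae_comm (p := fun x y => h x y ≤ B) (measurableSet_le hm measurable_const)]
    filter_upwards [h3] with x hx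
    calc ‖∫⁻ y, h x y ∂ν‖ₑ = ∫⁻ y, h x y ∂ν := rfl
      _ ≤ ∫⁻ _, B ∂ν := lintegral_mono_ae hx
      _ = ν univ * B := by rw [lintegral_const, mul_comm]
  · have hp0 : p ≠ 0 := (zero_lt_one.trans_le hp).ne'
    set q := p.toReal with hq
    have hq1 : 1 ≤ q := by
      rw [hq, ← ENNReal.toReal_one]
      exact ENNReal.toReal_mono hpt hp
    have hq0 : 0 < q := by linarith
    -- Jensen's inequality for a finite measure, from Hölder's inequality against the constant `1`;
    -- integrating in `x` and exchanging the integrals gives the claim.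
    have key : ∀ x, (∫⁻ y, h x y ∂ν) ^ q ≤ (ν univ) ^ (q - 1) * ∫⁻ y, h x y ^ q ∂ν := by
      intro x
      have hmx : Measurable fun y => h x y := hm.comp measurable_prodMk_left
      have h1 := ENNReal.lintegral_mul_norm_pow_le (μ := ν) (f := fun _ => 1)
        (g := fun y => h x y ^ q) aemeasurable_const (hmx.pow_const q).aemeasurable
        (p := 1 - q⁻¹) (q := q⁻¹) (by
          have := inv_le_one_of_one_le₀ hq1
          linarith) (by positivity) (by ring)
      simp only [ENNReal.one_rpow, one_mul, lintegral_const, ← ENNReal.rpow_mul,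
        mul_inv_cancel₀ hq0.ne', ENNReal.rpow_one] at h1
      calc (∫⁻ y, h x y ∂ν) ^ q
          ≤ ((ν univ) ^ (1 - q⁻¹) * (∫⁻ y, h x y ^ q ∂ν) ^ q⁻¹) ^ q := by gcongr
        _ = _ := by
            rw [ENNReal.mul_rpow_of_nonneg _ _ hq0.le, ← ENNReal.rpow_mul, ← ENNReal.rpow_mul,
              inv_mul_cancel₀ hq0.ne', ENNReal.rpow_one, sub_mul, inv_mul_cancel₀ hq0.ne', one_mul]
    rw [eLpNorm_eq_lintegral_rpow_enorm_toReal hp0 hpt]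
    have hB' : ∀ y, ∫⁻ x, h x y ^ q ∂μ ≤ B ^ q := by
      intro y
      have h2 := hB y
      rw [eLpNorm_eq_lintegral_rpow_enorm_toReal hp0 hpt, ← hq, one_div,
        ENNReal.rpow_inv_le_iff hq0] at h2
      exact h2
    rw [← hq, one_div, ENNReal.rpow_inv_le_iff hq0]
    calc ∫⁻ x, ‖∫⁻ y, h x y ∂ν‖ₑ ^ q ∂μ
        ≤ ∫⁻ x, (ν univ) ^ (q - 1) * ∫⁻ y, h x y ^ q ∂ν ∂μ := lintegral_mono key
      _ = (ν univ) ^ (q - 1) * ∫⁻ x, ∫⁻ y, h x y ^ q ∂ν ∂μ := by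
          rw [lintegral_const_mul]
          exact (hm.pow_const q).lintegral_prod_right'
      _ = (ν univ) ^ (q - 1) * ∫⁻ y, ∫⁻ x, h x y ^ q ∂μ ∂ν := by
          rw [lintegral_lintegral_swap]
          exact (hm.pow_const q).aemeasurable
      _ ≤ (ν univ) ^ (q - 1) * ∫⁻ _, B ^ q ∂ν := by
          gcongr with y
          exact hB' y
      _ = (ν univ * B) ^ q := by
          rw [lintegral_const, ENNReal.mul_rpow_of_nonneg _ _ hq0.le, mul_comm (B ^ q), ← mul_assoc]
          congr 1
          rcases eq_or_ne (ν univ) 0 with h0 | h0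
          · simp [h0, hq0]
          · nth_rewrite 2 [← ENNReal.rpow_one (ν univ)]
            rw [← ENNReal.rpow_add _ _ h0 (measure_ne_top _ _), sub_add_cancel]

/-- The `L¹` norm of a kernel. -/
def kn (K : 𝓢(Sp n, ℂ)) : ℝ≥0∞ := ∫⁻ z, ‖K z‖ₑ

lemma kn_eq (K : 𝓢(Sp n, ℂ)) : kn K = ENNReal.ofReal (∫ z, ‖K z‖) :=
  (ofReal_integral_norm_eq_lintegral_enorm K.integrable).symm

lemma kn_ne_top (K : 𝓢(Sp n, ℂ)) : kn K ≠ ⊤ := by rw [kn_eq]; exact ENNReal.ofReal_ne_top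

lemma eLpNorm_translate {V : Type} [NormedAddCommGroup V] {f : Sp n → V} (hf : Continuous f)
    (p : ℝ≥0∞) (z : Sp n) : eLpNorm (fun x => f (x - z)) p volume = eLpNorm f p volume :=
  eLpNorm_comp_measurePreserving (g := f) hf.aestronglyMeasurable
    (measurePreserving_sub_right volume z)

lemma cvl_eq_integral_sub (K : 𝓢(Sp n, ℂ)) (f : Sp n → ℂ) (x : Sp n) :
    cvl K f x = ∫ z, f (x - z) • K z := by
  unfold cvl
  rw [← integral_sub_left_eq_self _ volume x]
  refine integral_congr_ae (Eventually.of_forall fun z => ?_)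
  simp only [sub_sub_cancel]

/-- Young's inequality. -/
lemma eLpNorm_cvl_le (K : 𝓢(Sp n, ℂ)) {f : Sp n → ℂ} (hf : Continuous f) {p : ℝ≥0∞} (hp : 1 ≤ p) :
    eLpNorm (cvl K f) p volume ≤ kn K * eLpNorm f p volume := by
  have hK : Measurable fun z => ‖K z‖ₑ := K.continuous.enorm.measurable
  -- With `|K|` as a finite measure in `z`, the convolution is an average of translates of `f`, all
  -- having the same `L^p` norm.
  set ν : Measure (Sp n) := volume.withDensity fun z => ‖K z‖ₑ
  have hν : ν univ = kn K := by simp [ν, kn]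
  have : IsFiniteMeasure ν := ⟨by rw [hν]; exact (kn_ne_top K).lt_top⟩
  have hm : Measurable (Function.uncurry fun x z : Sp n => ‖f (x - z)‖ₑ) :=
    (hf.comp (continuous_fst.sub continuous_snd)).enorm.measurable
  rw [← hν]
  refine le_trans ?_ (eLpNorm_lintegral_le (μ := volume) (ν := ν) hm hp
    (fun z => (eLpNorm_congr_enorm_ae (g := fun x => f (x - z))
      (Eventually.of_forall fun x => rfl)).trans_le (eLpNorm_translate hf p z).le))
  refine eLpNorm_mono_enorm fun x => ?_
  rw [cvl_eq_integral_sub]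
  refine (enorm_integral_le_lintegral_enorm _).trans ?_
  change _ ≤ ∫⁻ z, ‖f (x - z)‖ₑ ∂ν
  have hmx : Measurable fun z => ‖f (x - z)‖ₑ := hm.comp measurable_prodMk_left
  rw [lintegral_withDensity_eq_lintegral_mul _ hK hmx]
  refine lintegral_mono fun z => ?_
  simp only [Pi.mul_apply]
  rw [enorm_smul, mul_comm]

lemma memLp_cvl (K : 𝓢(Sp n, ℂ)) {f : Sp n → ℂ} (hc : Continuous f) (hf : MemLp f 2) :
    MemLp (cvl K f) 2 :=
  ⟨(continuous_cvl K (WInt.of_memLp_two hf)).aestronglyMeasurable,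
    (eLpNorm_cvl_le K hc (by norm_num)).trans_lt
      (ENNReal.mul_lt_top (kn_ne_top K).lt_top hf.2)⟩

/-- Hölder's inequality for products of continuous functions. -/
lemma eLpNorm_mul_le {f g : Sp n → ℂ} (hf : Continuous f) (hg : Continuous g) (p q r : ℝ≥0∞)
    [ENNReal.HolderTriple p q r] :
    eLpNorm (fun x => f x * g x) r volume ≤ eLpNorm f p volume * eLpNorm g q volume :=
  eLpNorm_smul_le_mul_eLpNorm (φ := f) (f := g) hg.aestronglyMeasurable hf.aestronglyMeasurable

/-- The first moment of a kernel. -/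
def kn1 (K : 𝓢(Sp n, ℂ)) : ℝ≥0∞ := ∫⁻ z, ‖z‖ₑ * ‖K z‖ₑ

lemma kn1_ne_top (K : 𝓢(Sp n, ℂ)) : kn1 K ≠ ⊤ := by
  have h := K.integrable_pow_mul volume 1
  simp only [pow_one] at h
  have h2 := h.2.ne
  simp only [enorm_mul, enorm_norm] at h2
  exact h2

lemma enorm_sub_le_lintegral {f : Sp n → ℂ} {f' : Sp n → Sp n →L[ℝ] ℂ}
    (hf : ∀ x, HasFDerivAt f (f' x) x) (hf' : Continuous f') (x z : Sp n) :
    ‖f (x - z) - f x‖ₑ ≤ ∫⁻ s in Icc (0 : ℝ) 1, ‖f' (x - s • z)‖ₑ * ‖z‖ₑ := by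
  have hd : ∀ s ∈ uIcc (0 : ℝ) 1, HasDerivAt (fun s : ℝ => f (x - s • z))
      (f' (x - s • z) (-z)) s := fun s _ => by
    have h1 : HasDerivAt (fun s : ℝ => x - s • z) (-z) s := by
      simpa using ((hasDerivAt_id s).smul_const z).const_sub x
    exact (hf (x - s • z)).comp_hasDerivAt s h1
  have hc : Continuous fun s : ℝ => f' (x - s • z) (-z) :=
    (hf'.comp (by fun_prop)).clm_apply continuous_const
  have h := intervalIntegral.integral_eq_sub_of_hasDerivAt hd (hc.intervalIntegrable 0 1)
  simp only [one_smul, zero_smul, sub_zero] at h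
  rw [← h, intervalIntegral.integral_of_le zero_le_one, ← integral_Icc_eq_integral_Ioc]
  refine (enorm_integral_le_lintegral_enorm _).trans (lintegral_mono fun s => ?_)
  exact ((f' (x - s • z)).le_opENorm (-z)).trans_eq (by rw [enorm_neg])

/-- The commutator of convolution with multiplication gains a derivative. -/
lemma eLpNorm_commutator_le (K : 𝓢(Sp n, ℂ)) {f g : Sp n → ℂ} {f' : Sp n → Sp n →L[ℝ] ℂ}
    (hf : ∀ x, HasFDerivAt f (f' x) x) (hf' : Continuous f') (hg : Continuous g)
    (p q r : ℝ≥0∞) [ENNReal.HolderTriple p q r] (hr : 1 ≤ r) :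
    eLpNorm (fun x => ∫ z, ((f (x - z) - f x) * g (x - z)) • K z) r volume
      ≤ kn1 K * (eLpNorm f' p volume * eLpNorm g q volume) := by
  have hK : Measurable fun z => ‖z‖ₑ * ‖K z‖ₑ :=
    continuous_id.enorm.measurable.mul K.continuous.enorm.measurable
  set ν₁ : Measure (Sp n) := volume.withDensity fun z => ‖z‖ₑ * ‖K z‖ₑ
  have hν₁ : ν₁ univ = kn1 K := by simp [ν₁, kn1]
  have : IsFiniteMeasure ν₁ := ⟨by rw [hν₁]; exact (kn1_ne_top K).lt_top⟩
  -- The difference `f(x - z) - f(x)` is an average over `s ∈ [0, 1]` of `f'(x - s z)` times `z`.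
  -- The factor `‖z‖` joins the kernel in `ν₁`, and for each `(z, s)` Hölder's inequality applies to
  -- translates of `f'` and `g`.
  set ν : Measure (Sp n × ℝ) := ν₁.prod (volume.restrict (Icc 0 1))
  have hν : ν univ = kn1 K := by
    simp [ν, ← univ_prod_univ, Measure.prod_prod, hν₁]
  have hc1 : Continuous fun w : Sp n × (Sp n × ℝ) => f' (w.1 - w.2.2 • w.2.1) :=
    hf'.comp (by fun_prop)
  have hc2 : Continuous fun w : Sp n × (Sp n × ℝ) => g (w.1 - w.2.1) := hg.comp (by fun_prop)
  set h : Sp n → Sp n × ℝ → ℝ≥0∞ := fun x w => ‖f' (x - w.2 • w.1)‖ₑ * ‖g (x - w.1)‖ₑ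
  have hm : Measurable (Function.uncurry h) := hc1.enorm.measurable.mul hc2.enorm.measurable
  rw [← hν]
  refine le_trans ?_ (eLpNorm_lintegral_le (μ := volume) (ν := ν) hm hr (fun w => ?_))
  · refine eLpNorm_mono_enorm fun x => ?_
    refine (enorm_integral_le_lintegral_enorm _).trans ?_
    rw [show (‖∫⁻ w, h x w ∂ν‖ₑ : ℝ≥0∞) = ∫⁻ w, h x w ∂ν from rfl]
    have hmx : Measurable (h x) := hm.of_uncurry_left
    rw [lintegral_prod _ hmx.aemeasurable,
      lintegral_withDensity_eq_lintegral_mul _ hK hmx.lintegral_prod_right']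
    refine lintegral_mono fun z => ?_
    simp only [Pi.mul_apply, h]
    have hms : Measurable fun s : ℝ => ‖f' (x - s • z)‖ₑ :=
      (hf'.comp (by fun_prop : Continuous fun s : ℝ => x - s • z)).enorm.measurable
    rw [enorm_smul, enorm_mul, lintegral_mul_const _ hms]
    have h1 := enorm_sub_le_lintegral hf hf' x z
    rw [lintegral_mul_const _ hms] at h1
    calc ‖f (x - z) - f x‖ₑ * ‖g (x - z)‖ₑ * ‖K z‖ₑ
        ≤ ((∫⁻ s in Icc (0 : ℝ) 1, ‖f' (x - s • z)‖ₑ) * ‖z‖ₑ) * ‖g (x - z)‖ₑ * ‖K z‖ₑ := by gcongr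
      _ = _ := by ring
  · obtain ⟨z, s⟩ := w
    have hcf : Continuous fun x => f' (x - s • z) := hf'.comp (by fun_prop)
    have hcg : Continuous fun x => g (x - z) := hg.comp (by fun_prop)
    have e : eLpNorm (fun x => h x (z, s)) r volume
        = eLpNorm ((fun x => ‖f' (x - s • z)‖) • fun x => g (x - z)) r volume := by
      refine eLpNorm_congr_enorm_ae (Eventually.of_forall fun x => ?_)
      simp only [h, Pi.smul_apply']
      rw [enorm_smul, enorm_norm]
      rfl
    have e2 : eLpNorm (fun x => ‖f' (x - s • z)‖) p volume = eLpNorm f' p volume :=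
      (eLpNorm_norm _).trans (eLpNorm_translate hf' p (s • z))
    have e3 : eLpNorm (fun x => g (x - z)) q volume = eLpNorm g q volume := eLpNorm_translate hg q z
    have h1 := eLpNorm_smul_le_mul_eLpNorm (p := p) (q := q) (r := r) (μ := volume)
      hcg.aestronglyMeasurable hcf.norm.aestronglyMeasurable
    rw [e2, e3] at h1
    exact e.trans_le h1

/-- The `j`-th coordinate direction. -/
abbrev dir (j : Fin n) : Sp n := EuclideanSpace.single j (1 : ℝ)

lemma opNorm_le_sum (A : Sp n →L[ℝ] ℂ) : ‖A‖ ≤ ∑ j, ‖A (dir j)‖ := by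
  refine A.opNorm_le_bound (Finset.sum_nonneg fun j _ => norm_nonneg _) fun v => ?_
  have hv : v = ∑ j, v j • dir j := by
    have := (EuclideanSpace.basisFun (Fin n) ℝ).sum_repr v
    simpa using this.symm
  conv_lhs => rw [hv]
  rw [map_sum, Finset.sum_mul]
  refine (norm_sum_le _ _).trans (Finset.sum_le_sum fun j _ => ?_)
  rw [map_smul, norm_smul, mul_comm]
  gcongr
  exact PiLp.norm_apply_le v j

lemma eLpNorm_fderiv_le_sum {f' : Sp n → Sp n →L[ℝ] ℂ} (hf' : Continuous f') {p : ℝ≥0∞}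
    (hp : 1 ≤ p) : eLpNorm f' p volume ≤ ∑ j, eLpNorm (fun x => f' x (dir j)) p volume := by
  have h1 := eLpNorm_sum_le (μ := (volume : Measure (Sp n))) (f := fun j x => ‖f' x (dir j)‖)
    (s := Finset.univ)
    (fun j _ => (hf'.clm_apply continuous_const).norm.aestronglyMeasurable) hp
  simp only [eLpNorm_norm] at h1
  refine le_trans (eLpNorm_mono_real fun x => ?_) h1
  rw [Finset.sum_apply]
  exact opNorm_le_sum _

section

/-! ### Frequency-localized pieces -/

/-- Continuous square-integrable functions. -/
def Nice (f : Sp n → ℂ) : Prop := Continuous f ∧ MemLp f 2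

lemma Nice.wint {f : Sp n → ℂ} (hf : Nice f) : WInt f := WInt.of_memLp_two hf.2

lemma Nice.cvl {f : Sp n → ℂ} (hf : Nice f) (K : 𝓢(Sp n, ℂ)) : Nice (cvl K f) :=
  ⟨continuous_cvl K hf.wint, memLp_cvl K hf.1 hf.2⟩

lemma Nice.proj {f : Sp n → ℂ} (hf : Nice f) (hη : IsBump η) (k : ℤ) : Nice (proj η k f) := by
  rw [funext (proj_eq_cvl hη k hf.2)]
  exact hf.cvl _

lemma Nice.integrable_mul {f g : Sp n → ℂ} (hf : Nice f) (hg : Nice g) :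
    Integrable fun x => f x * g x := hf.2.integrable_mul hg.2

lemma Nice.wint_mul {f g : Sp n → ℂ} (hf : Nice f) (hg : Nice g) : WInt fun x => f x * g x :=
  WInt.of_integrable (hf.integrable_mul hg)

lemma cvl_kerLE_proj (hη : IsBump η) {f : Sp n → ℂ} (hf : MemLp f 2) {j k : ℤ} (h : k + 1 ≤ j) :
    cvl (kerLE hη j) (proj η k f) = proj η k f :=
  funext fun x => (lowFreq_proj hη k hf).cvl_kerLE hη (zpow_le_zpow_right₀ (by norm_num) h) x

/-- The derivative of a Littlewood-Paley piece. -/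
def dproj (hη : IsBump η) (k : ℤ) (f : Sp n → ℂ) (x : Sp n) : Sp n →L[ℝ] ℂ :=
  cvl (fderivCLM ℂ (Sp n) ℂ (kerLE hη (k + 1))) (proj η k f) x

/-- A piece at frequency `2^k` is reproduced by `P_{≤k+1}`, so its derivative is a convolution of
the piece itself with the derivative of a kernel of scale `2^{-k-1}`. Bernstein's inequality in the
lemmas below rests on this form. -/
lemma hasFDerivAt_proj (hη : IsBump η) (k : ℤ) {f : Sp n → ℂ} (hf : Nice f) (x : Sp n) :
    HasFDerivAt (proj η k f) (dproj hη k f x) x := by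
  have h := hasFDerivAt_cvl (kerLE hη (k + 1)) (hf.proj hη k).wint x
  rwa [cvl_kerLE_proj hη hf.2 le_rfl] at h

lemma continuous_dproj (hη : IsBump η) (k : ℤ) {f : Sp n → ℂ} (hf : Nice f) :
    Continuous (dproj hη k f) := continuous_cvl _ (hf.proj hη k).wint

lemma dproj_apply (hη : IsBump η) (k : ℤ) {f : Sp n → ℂ} (hf : Nice f) (v : Sp n) :
    (fun x => dproj hη k f x v) = cvl (∂_{v} (kerLE hη (k + 1))) (proj η k f) :=
  funext fun x => cvl_fderivCLM_apply _ (hf.proj hη k).wint x v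

lemma nice_dproj_apply (hη : IsBump η) (k : ℤ) {f : Sp n → ℂ} (hf : Nice f) (v : Sp n) :
    Nice fun x => dproj hη k f x v := by
  rw [dproj_apply hη k hf v]
  exact (hf.proj hη k).cvl _

/-- Differentiation commutes with the projections. -/
lemma dproj_eq_proj (hη : IsBump η) (k : ℤ) {f : Sp n → ℂ} (hf : Nice f) {v : Sp n}
    (hd : Differentiable ℝ f) (hf' : Nice fun x => fderiv ℝ f x v) (x : Sp n) :
    dproj hη k f x v = proj η k (fun y => fderiv ℝ f y v) x := by
  rw [proj_eq_cvl hη k hf'.2, cvl_fderiv _ v hd hf.wint hf'.wint, ← (hasFDerivAt_proj hη k hf x).fderiv]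
  have h := (hasFDerivAt_cvl (kerP hη k) hf.wint x).fderiv
  rw [funext (proj_eq_cvl hη k hf.2), h, cvl_fderivCLM_apply _ hf.wint]

/-! ### Dyadic weights and Bernstein's inequality. -/

/-- The Bernstein constant. -/
def bern (hη : IsBump η) : ℝ≥0∞ := 2 * ∑ j : Fin n, kn (∂_{dir j} (kerLE hη 0))

lemma bern_ne_top (hη : IsBump η) : bern hη ≠ ⊤ := by
  unfold bern
  exact ENNReal.mul_ne_top (by norm_num) (ENNReal.sum_ne_top.2 fun j _ => kn_ne_top _)

/-- Dyadic weights. -/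
def dy (k : ℤ) : ℝ≥0∞ := ENNReal.ofReal ((2 : ℝ) ^ k)

lemma dy_ne_top (k : ℤ) : dy k ≠ ⊤ := ENNReal.ofReal_ne_top

lemma dy_mono {j k : ℤ} (h : j ≤ k) : dy j ≤ dy k :=
  ENNReal.ofReal_le_ofReal (zpow_le_zpow_right₀ (by norm_num) h)

lemma dy_zero : dy 0 = 1 := by simp [dy]

lemma dy_add (j k : ℤ) : dy (j + k) = dy j * dy k := by
  unfold dy
  rw [zpow_add₀ two_ne_zero, ENNReal.ofReal_mul (by positivity)]

/-- Scaling gives the factor `2^{k+1}`; the extra `2` and the sum over directions are built into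
`bern`. -/
lemma kn_lineDeriv_kerLE_le (hη : IsBump η) (k : ℤ) (j : Fin n) :
    kn (∂_{dir j} (kerLE hη (k + 1))) ≤ bern hη * dy k := by
  rw [kn_eq, integral_norm_lineDeriv_kerLE, ENNReal.ofReal_mul (by positivity), ← kn_eq]
  change dy (k + 1) * _ ≤ _
  have h2 : dy 1 = 2 := by simp [dy]
  rw [dy_add, h2, bern]
  calc dy k * 2 * kn (∂_{dir j} (kerLE hη 0))
      ≤ dy k * 2 * ∑ j : Fin n, kn (∂_{dir j} (kerLE hη 0)) := by
        gcongr
        exact Finset.single_le_sum (f := fun j : Fin n => kn (∂_{dir j} (kerLE hη 0)))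
          (fun _ _ => zero_le) (Finset.mem_univ j)
    _ = _ := by ring

lemma eLpNorm_dproj_apply_le (hη : IsBump η) (k : ℤ) {f : Sp n → ℂ} (hf : Nice f) (j : Fin n)
    {p : ℝ≥0∞} (hp : 1 ≤ p) : eLpNorm (fun x => dproj hη k f x (dir j)) p volume
      ≤ bern hη * dy k * eLpNorm (proj η k f) p volume := by
  rw [dproj_apply hη k hf]
  refine (eLpNorm_cvl_le _ (hf.proj hη k).1 hp).trans ?_
  gcongr
  exact kn_lineDeriv_kerLE_le hη k j

lemma eLpNorm_dproj_le (hη : IsBump η) (k : ℤ) {f : Sp n → ℂ} (hf : Nice f)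
    {p : ℝ≥0∞} (hp : 1 ≤ p) : eLpNorm (dproj hη k f) p volume
      ≤ n * (bern hη * dy k * eLpNorm (proj η k f) p volume) := by
  refine (eLpNorm_fderiv_le_sum (continuous_dproj hη k hf) hp).trans ?_
  refine (Finset.sum_le_sum fun j _ => eLpNorm_dproj_apply_le hη k hf j hp).trans_eq ?_
  simp

lemma LowFreq.dproj_apply {f : Sp n → ℂ} (hη : IsBump η) (k : ℤ) (hf : Nice f) (v : Sp n) :
    LowFreq (2 ^ (k + 1)) fun x => dproj hη k f x v := by
  rw [WaveMaps.dproj_apply hη k hf]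
  exact (lowFreq_proj hη k hf.2).cvl _

/-! ### The bilinear form -/

/-- The bilinear form `P_0 (f ∂_j g) - P_{≤ -10} f ∂_j P_0 g`, with `g' = ∂_j g`. -/
def bil (hη : IsBump η) (j : Fin n) (f g' g : Sp n → ℂ) (x : Sp n) : ℂ :=
  cvl (kerP hη 0) (fun y => f y * g' y) x
    - cvl (kerLE hη (-10)) f x * cvl (∂_{dir j} (kerP hη 0)) g x

lemma cvl_lineDeriv_proj (hη : IsBump η) (k : ℤ) {f : Sp n → ℂ} (hf : Nice f) (K : 𝓢(Sp n, ℂ))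
    (v x : Sp n) : cvl (∂_{v} K) (proj η k f) x = cvl K (fun y => dproj hη k f y v) x := by
  have hd : Differentiable ℝ (proj η k f) := fun x => (hasFDerivAt_proj hη k hf x).differentiableAt
  have e : (fun y => fderiv ℝ (proj η k f) y v) = fun y => dproj hη k f y v :=
    funext fun y => by rw [(hasFDerivAt_proj hη k hf y).fderiv]
  rw [← cvl_fderiv K v hd (hf.proj hη k).wint (by rw [e]; exact (nice_dproj_apply hη k hf v).wint), e]

/-- Integration by parts for a product of two pieces. -/
lemma cvl_lineDeriv_mul_proj (hη : IsBump η) (k l : ℤ) {f g : Sp n → ℂ} (hf : Nice f) (hg : Nice g)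
    (K : 𝓢(Sp n, ℂ)) (v x : Sp n) :
    cvl (∂_{v} K) (fun y => proj η k f y * proj η l g y) x
      = cvl K (fun y => proj η k f y * dproj hη l g y v) x
        + cvl K (fun y => dproj hη k f y v * proj η l g y) x := by
  have hD : ∀ y, HasFDerivAt (fun y => proj η k f y * proj η l g y)
      (proj η k f y • dproj hη l g y + proj η l g y • dproj hη k f y) y := fun y =>
    (hasFDerivAt_proj hη k hf y).mul (hasFDerivAt_proj hη l hg y)
  have e : (fun y => fderiv ℝ (fun y => proj η k f y * proj η l g y) y v)
      = fun y => proj η k f y * dproj hη l g y v + dproj hη k f y v * proj η l g y := by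
    funext y
    rw [(hD y).fderiv]
    simp [mul_comm]
  have h1 := (hf.proj hη k).wint_mul (nice_dproj_apply hη l hg v)
  have h2 := (nice_dproj_apply hη k hf v).wint_mul (hg.proj hη l)
  rw [← cvl_fderiv K v (fun y => (hD y).differentiableAt) ((hf.proj hη k).wint_mul (hg.proj hη l))
    (by rw [e]; exact h1.add h2), e, cvl_add K h1 h2]

/-- Both pieces have frequency below `1/4`, so their product and the factor `∂_j P_l g` have
frequency below `1/2`, where the symbol of `P_0` vanishes. -/
lemma bil_proj_low (hη : IsBump η) (j : Fin n) {k l : ℤ} (hk : k ≤ -10) (hl : l ≤ -10)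
    {f g : Sp n → ℂ} (hf : Nice f) (hg : Nice g) :
    bil hη j (proj η k f) (fun x => dproj hη l g x (dir j)) (proj η l g) = 0 := by
  funext x
  have hk' : (2 : ℝ) ^ (k + 1) ≤ 1 / 4 :=
    (zpow_le_zpow_right₀ (by norm_num) (by lia : k + 1 ≤ -2)).trans (by norm_num)
  have hl' : (2 : ℝ) ^ (l + 1) ≤ 1 / 4 :=
    (zpow_le_zpow_right₀ (by norm_num) (by lia : l + 1 ≤ -2)).trans (by norm_num)
  have h0 : (2 : ℝ) ^ ((0 : ℤ) - 1) = 1 / 2 := by norm_num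
  unfold bil
  rw [cvl_lineDeriv_proj hη l hg,
    (LowFreq.dproj_apply hη l hg (dir j)).cvl_kerP hη (by rw [h0]; linarith),
    ((lowFreq_proj hη k hf.2).mul (LowFreq.dproj_apply hη l hg (dir j))).cvl_kerP hη
      (by rw [h0]; linarith)]
  simp

/-- The constant in the bilinear estimate. -/
def bilC (hη : IsBump η) : ℝ≥0∞ :=
  (kn (kerP hη 0) + kn (kerLE hη (-10)) * kn (kerP hη 0)) * bern hη
    + ∑ j : Fin n, (kn (∂_{dir j} (kerP hη 0)) * dy 10
      + kn (kerLE hη (-10)) * kn (∂_{dir j} (kerP hη 0)) * dy 10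
      + kn1 (∂_{dir j} (kerP hη 0)) * (n * bern hη))

lemma bilC_ne_top (hη : IsBump η) : bilC hη ≠ ⊤ := by
  unfold bilC
  have h1 := kn_ne_top (kerP hη 0)
  have h2 := kn_ne_top (kerLE hη (-10))
  have h3 := bern_ne_top hη
  have h4 := dy_ne_top 10
  refine ENNReal.add_ne_top.2 ⟨by finiteness, ENNReal.sum_ne_top.2 fun j _ => ?_⟩
  have h5 := kn_ne_top (∂_{dir j} (kerP hη 0))
  have h6 := kn1_ne_top (∂_{dir j} (kerP hη 0))
  finiteness

lemma le_bilC (hη : IsBump η) (j : Fin n) :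
    (kn (kerP hη 0) + kn (kerLE hη (-10)) * kn (kerP hη 0)) * bern hη
    + (kn (∂_{dir j} (kerP hη 0)) * dy 10
      + kn (kerLE hη (-10)) * kn (∂_{dir j} (kerP hη 0)) * dy 10
      + kn1 (∂_{dir j} (kerP hη 0)) * (n * bern hη)) ≤ bilC hη := by
  unfold bilC
  gcongr
  exact Finset.single_le_sum (f := fun j : Fin n => (kn (∂_{dir j} (kerP hη 0)) * dy 10
      + kn (kerLE hη (-10)) * kn (∂_{dir j} (kerP hη 0)) * dy 10
      + kn1 (∂_{dir j} (kerP hη 0)) * (n * bern hη))) (fun _ _ => zero_le) (Finset.mem_univ j)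

variable {p q : ℝ≥0∞}

lemma eLpNorm_sub_le' {f g : Sp n → ℂ} (hf : Continuous f) (hg : Continuous g) :
    eLpNorm (fun x => f x - g x) 2 volume ≤ eLpNorm f 2 volume + eLpNorm g 2 volume :=
  eLpNorm_sub_le hf.aestronglyMeasurable hg.aestronglyMeasurable (by norm_num)

/-- No cancellation is used: the two terms are estimated separately and the derivative on the piece
at `l` costs `2^l`. The bound is efficient when `l ≤ k`. -/
lemma bil_proj_high_low (hη : IsBump η) (j : Fin n) [ENNReal.HolderTriple q p 2] (hp : 1 ≤ p)
    (hq : 1 ≤ q) (k l : ℤ) {f g : Sp n → ℂ} (hf : Nice f) (hg : Nice g) :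
    eLpNorm (bil hη j (proj η k f) (fun x => dproj hη l g x (dir j)) (proj η l g)) 2 volume
      ≤ bilC hη * (dy l * eLpNorm (proj η l g) p volume * eLpNorm (proj η k f) q volume) := by
  have hu := hf.proj hη k
  have hv' := nice_dproj_apply hη l hg (dir j)
  have e : bil hη j (proj η k f) (fun x => dproj hη l g x (dir j)) (proj η l g)
      = fun x => cvl (kerP hη 0) (fun y => proj η k f y * dproj hη l g y (dir j)) x -
        cvl (kerLE hη (-10)) (proj η k f) x * cvl (kerP hη 0) (fun y => dproj hη l g y (dir j)) x := by
    funext x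
    unfold bil
    rw [cvl_lineDeriv_proj hη l hg]
  have hB := eLpNorm_dproj_apply_le hη l hg j hp
  rw [e]
  refine (eLpNorm_sub_le' (continuous_cvl _ (hu.wint_mul hv'))
    ((hu.cvl _).1.mul (hv'.cvl _).1)).trans ?_
  have h1 := (eLpNorm_cvl_le (kerP hη 0) (hu.1.mul hv'.1) (p := 2) (by norm_num)).trans
    (mul_le_mul_right (eLpNorm_mul_le hu.1 hv'.1 q p 2) _)
  have h2 := (eLpNorm_mul_le (hu.cvl (kerLE hη (-10))).1 (hv'.cvl (kerP hη 0)).1 q p 2).trans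
    (mul_le_mul' (eLpNorm_cvl_le (kerLE hη (-10)) hu.1 hq) (eLpNorm_cvl_le (kerP hη 0) hv'.1 hp))
  set U := eLpNorm (proj η k f) q volume
  set V := eLpNorm (proj η l g) p volume
  calc _ ≤ kn (kerP hη 0) * (U * (bern hη * dy l * V)) +
        kn (kerLE hη (-10)) * U * (kn (kerP hη 0) * (bern hη * dy l * V)) := by
        refine add_le_add (h1.trans ?_) (h2.trans ?_) <;> gcongr
    _ = (kn (kerP hη 0) + kn (kerLE hη (-10)) * kn (kerP hη 0)) * bern hη * (dy l * V * U) := by ring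
    _ ≤ bilC hη * (dy l * V * U) := by
        gcongr
        exact le_self_add.trans (le_bilC hη j)

/-- Leibniz' rule moves the derivative off `g`. The last term has it on `f`; the bracket has it on
the kernel of `P_0` and becomes a commutator once `P_{≤-10}` fixes the piece of `f`. -/
lemma bil_proj_eq (hη : IsBump η) (j : Fin n) (k l : ℤ) {f g : Sp n → ℂ} (hf : Nice f)
    (hg : Nice g) (x : Sp n) :
    bil hη j (proj η k f) (fun x => dproj hη l g x (dir j)) (proj η l g) x
      = (cvl (∂_{dir j} (kerP hη 0)) (fun y => proj η k f y * proj η l g y) x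
        - cvl (kerLE hη (-10)) (proj η k f) x * cvl (∂_{dir j} (kerP hη 0)) (proj η l g) x)
        - cvl (kerP hη 0) (fun y => dproj hη k f y (dir j) * proj η l g y) x := by
  rw [cvl_lineDeriv_mul_proj hη k l hf hg]
  unfold bil
  ring

/-- The gain is now `2^k`, from the frequency of `f`. It comes from `∂_j f` in the last term of
`bil_proj_eq` and from the commutator estimate in the bracket. -/
lemma bil_proj_low_high (hη : IsBump η) (j : Fin n) [ENNReal.HolderTriple p q 2] (hp : 1 ≤ p)
    (hq : 1 ≤ q) (k l : ℤ) {f g : Sp n → ℂ} (hf : Nice f) (hg : Nice g) :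
    eLpNorm (bil hη j (proj η k f) (fun x => dproj hη l g x (dir j)) (proj η l g)) 2 volume
      ≤ bilC hη * (dy k * eLpNorm (proj η k f) p volume * eLpNorm (proj η l g) q volume) := by
  have hu := hf.proj hη k
  have hv := hg.proj hη l
  have hu' := nice_dproj_apply hη k hf (dir j)
  have hB := eLpNorm_dproj_apply_le hη k hf j hp
  have hB' := eLpNorm_dproj_le hη k hf hp
  have hmain := le_bilC hη j
  set A := ∂_{dir j} (kerP hη 0)
  set U := eLpNorm (proj η k f) p volume
  set V := eLpNorm (proj η l g) q volume
  have c1 : Continuous (cvl A fun y => proj η k f y * proj η l g y) :=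
    continuous_cvl _ (hu.wint_mul hv)
  have c2 : Continuous fun x => cvl (kerLE hη (-10)) (proj η k f) x * cvl A (proj η l g) x :=
    (hu.cvl _).1.mul (hv.cvl _).1
  have c3 : Continuous (cvl (kerP hη 0) fun y => dproj hη k f y (dir j) * proj η l g y) :=
    continuous_cvl _ (hu'.wint_mul hv)
  rw [funext (bil_proj_eq hη j k l hf hg)]
  refine (eLpNorm_sub_le' (c1.sub c2) c3).trans ?_
  have h3 : eLpNorm (cvl (kerP hη 0) fun y => dproj hη k f y (dir j) * proj η l g y) 2 volume
      ≤ kn (kerP hη 0) * bern hη * (dy k * U * V) := by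
    calc _ ≤ kn (kerP hη 0) * (bern hη * dy k * U * V) := by
          refine (eLpNorm_cvl_le _ (hu'.1.mul hv.1) (by norm_num)).trans ?_
          gcongr
          refine (eLpNorm_mul_le hu'.1 hv.1 p q 2).trans ?_
          gcongr
      _ = _ := by ring
  -- For such `k` the projection `P_{≤-10}` reproduces the piece, so the bracket is the commutator
  -- of a convolution with multiplication by the piece.
  by_cases hk : k ≤ -11
  · have e : (fun x => cvl A (fun y => proj η k f y * proj η l g y) x
        - cvl (kerLE hη (-10)) (proj η k f) x * cvl A (proj η l g) x)
        = fun x => ∫ z, ((proj η k f (x - z) - proj η k f x) * proj η l g (x - z)) • A z := by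
      funext x
      rw [cvl_kerLE_proj hη hf.2 (by lia), cvl_eq_integral_sub, cvl_eq_integral_sub,
        ← integral_const_mul, ← integral_sub]
      · refine integral_congr_ae (Eventually.of_forall fun z => ?_)
        simp only [smul_eq_mul]
        ring
      · have := ((hu.wint_mul hv).integrable_smul A x).comp_sub_left x
        simpa using this
      · have := (hv.wint.integrable_smul A x).comp_sub_left x
        simpa using this.const_mul (proj η k f x)
    have h12 : eLpNorm (fun x => cvl A (fun y => proj η k f y * proj η l g y) x
        - cvl (kerLE hη (-10)) (proj η k f) x * cvl A (proj η l g) x) 2 volume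
        ≤ kn1 A * (n * bern hη) * (dy k * U * V) := by
      rw [e]
      calc _ ≤ kn1 A * (n * (bern hη * dy k * U) * V) := by
            refine (eLpNorm_commutator_le A (hasFDerivAt_proj hη k hf) (continuous_dproj hη k hf)
              hv.1 p q 2 (by norm_num)).trans ?_
            gcongr
        _ = _ := by ring
    refine (add_le_add h12 h3).trans ?_
    rw [← add_mul]
    gcongr
    refine le_trans ?_ hmain
    calc kn1 A * (n * bern hη) + kn (kerP hη 0) * bern hη
        ≤ (kn1 A * (n * bern hη) + kn (kerP hη 0) * bern hη)
          + (kn (kerLE hη (-10)) * kn (kerP hη 0) * bern hη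
            + kn A * dy 10 + kn (kerLE hη (-10)) * kn A * dy 10) := le_self_add
      _ = _ := by ring
  -- Now `k ≥ -10`, so the gain `2^k` is bounded below and is inserted for free up to the constant
  -- `2^{10}`; no cancellation is needed.
  · have hdy : 1 ≤ dy 10 * dy k := by
      rw [← dy_add, ← dy_zero]
      exact dy_mono (by lia)
    have h1 : eLpNorm (cvl A fun y => proj η k f y * proj η l g y) 2 volume
        ≤ kn A * dy 10 * (dy k * U * V) := by
      calc _ ≤ kn A * (1 * (U * V)) := by
            rw [one_mul]
            refine (eLpNorm_cvl_le _ (hu.1.mul hv.1) (by norm_num)).trans ?_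
            gcongr
            exact eLpNorm_mul_le hu.1 hv.1 p q 2
        _ ≤ kn A * ((dy 10 * dy k) * (U * V)) := by gcongr
        _ = _ := by ring
    have h2 : eLpNorm (fun x => cvl (kerLE hη (-10)) (proj η k f) x * cvl A (proj η l g) x) 2 volume
        ≤ kn (kerLE hη (-10)) * kn A * dy 10 * (dy k * U * V) := by
      calc _ ≤ kn (kerLE hη (-10)) * U * (kn A * V) * 1 := by
            rw [mul_one]
            refine (eLpNorm_mul_le (hu.cvl _).1 (hv.cvl _).1 p q 2).trans ?_
            gcongr
            · exact eLpNorm_cvl_le _ hu.1 hp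
            · exact eLpNorm_cvl_le _ hv.1 hq
        _ ≤ kn (kerLE hη (-10)) * U * (kn A * V) * (dy 10 * dy k) := by gcongr
        _ = _ := by ring
    refine (add_le_add ((eLpNorm_sub_le' c1 c2).trans (add_le_add h1 h2)) h3).trans ?_
    rw [← add_mul, ← add_mul]
    gcongr
    refine le_trans ?_ hmain
    calc kn A * dy 10 + kn (kerLE hη (-10)) * kn A * dy 10 + kn (kerP hη 0) * bern hη
        ≤ (kn A * dy 10 + kn (kerLE hη (-10)) * kn A * dy 10 + kn (kerP hη 0) * bern hη)
          + (kn (kerLE hη (-10)) * kn (kerP hη 0) * bern hη + kn1 A * (n * bern hη)) := le_self_add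
      _ = _ := by ring

end

section

/-! ### The trilinear forms -/

/-- The trilinear form `P_0 (f g h)`. -/
def triA (hη : IsBump η) (f g h : Sp n → ℂ) (x : Sp n) : ℂ :=
  cvl (kerP hη 0) (fun y => f y * (g y * h y)) x

/-- The trilinear form `P_{≤ -10} f P_0 (g h)`. -/
def triB (hη : IsBump η) (f g h : Sp n → ℂ) (x : Sp n) : ℂ :=
  cvl (kerLE hη (-10)) f x * cvl (kerP hη 0) (fun y => g y * h y) x

lemma Nice.bdd_proj {f : Sp n → ℂ} (hf : Nice f) (hη : IsBump η) (k : ℤ) :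
    ∃ B : ℝ, ∀ x, ‖WaveMaps.proj η k f x‖ ≤ B := by
  rw [proj_eq_fourierInv hη k hf.2]
  exact ⟨_, norm_fourierInv_le⟩

lemma Nice.mul_bdd {f g : Sp n → ℂ} (hf : Nice f) (hg : Continuous g)
    (hb : ∃ B : ℝ, ∀ x, ‖g x‖ ≤ B) : Nice fun x => f x * g x := by
  obtain ⟨B, hB⟩ := hb
  refine ⟨hf.1.mul hg, ?_⟩
  have hg' : MemLp g ⊤ volume := memLp_top_of_bound hg.aestronglyMeasurable B (Eventually.of_forall hB)
  exact hg'.mul' (p := 2) (q := ⊤) (r := 2) hf.2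

lemma Nice.mul_proj {f g : Sp n → ℂ} (hf : Nice f) (hg : Nice g) (hη : IsBump η) (k : ℤ) :
    Nice fun x => f x * WaveMaps.proj η k g x :=
  hf.mul_bdd (hg.proj hη k).1 (hg.bdd_proj hη k)

lemma Nice.proj_mul {f g : Sp n → ℂ} (hf : Nice f) (hg : Nice g) (hη : IsBump η) (k : ℤ) :
    Nice fun x => WaveMaps.proj η k g x * f x := by
  simpa [mul_comm] using hf.mul_proj hg hη k

/-- Three frequencies below `1/8` add up to less than `1/2`, which `P_0` annihilates. -/
lemma triA_proj_low (hη : IsBump η) {k l m : ℤ} (hk : k ≤ -10) (hl : l ≤ -10) (hm : m ≤ -10)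
    {f g h : Sp n → ℂ} (hf : Nice f) (hg : Nice g) (hh : Nice h) :
    triA hη (proj η k f) (proj η l g) (proj η m h) = 0 := by
  have key : ∀ i : ℤ, i ≤ -10 → (2 : ℝ) ^ (i + 1) ≤ 1 / 8 := fun i hi =>
    (zpow_le_zpow_right₀ (by norm_num) (by lia : i + 1 ≤ -3)).trans (by norm_num)
  have h0 : (2 : ℝ) ^ ((0 : ℤ) - 1) = 1 / 2 := by norm_num
  funext x
  exact ((lowFreq_proj hη k hf.2).mul ((lowFreq_proj hη l hg.2).mul
    (lowFreq_proj hη m hh.2))).cvl_kerP hη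
    (by rw [h0]; linarith [key k hk, key l hl, key m hm]) x

lemma triB_proj_low (hη : IsBump η) {k l m : ℤ} (hl : l ≤ -10) (hm : m ≤ -10)
    {f g h : Sp n → ℂ} (hg : Nice g) (hh : Nice h) :
    triB hη (proj η k f) (proj η l g) (proj η m h) = 0 := by
  have key : ∀ i : ℤ, i ≤ -10 → (2 : ℝ) ^ (i + 1) ≤ 1 / 8 := fun i hi =>
    (zpow_le_zpow_right₀ (by norm_num) (by lia : i + 1 ≤ -3)).trans (by norm_num)
  have h0 : (2 : ℝ) ^ ((0 : ℤ) - 1) = 1 / 2 := by norm_num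
  funext x
  unfold triB
  rw [((lowFreq_proj hη l hg.2).mul (lowFreq_proj hη m hh.2)).cvl_kerP hη
    (by rw [h0]; linarith [key l hl, key m hm])]
  simp

/-- The constant in the trilinear estimates. -/
def triC (hη : IsBump η) : ℝ≥0∞ := kn (kerP hη 0) + kn (kerLE hη (-10)) * kn (kerP hη 0)

lemma triC_ne_top (hη : IsBump η) : triC hη ≠ ⊤ := by
  unfold triC
  have h1 := kn_ne_top (kerP hη 0)
  have h2 := kn_ne_top (kerLE hη (-10))
  finiteness

/-- A trilinear form obeying the Hölder bounds of a pointwise product. -/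
def TriBound (C : ℝ≥0∞) (M : (Sp n → ℂ) → (Sp n → ℂ) → (Sp n → ℂ) → Sp n → ℂ) : Prop :=
  ∀ (p q r s : ℝ≥0∞) [ENNReal.HolderTriple q r s] [ENNReal.HolderTriple p s 2], 1 ≤ p → 1 ≤ s →
    ∀ f g h : Sp n → ℂ, Nice f → Nice g → Nice h →
      -- Boundedness of the middle factor keeps `g h` in `L²`; it enters qualitatively, to make the
      -- convolution in `triB` continuous, and leaves the constant unchanged.
      (∃ B : ℝ, ∀ x, ‖g x‖ ≤ B) →
      eLpNorm (M f g h) 2 volume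
        ≤ C * (eLpNorm f p volume * eLpNorm g q volume * eLpNorm h r volume)

lemma triBound_triA (hη : IsBump η) : TriBound (triC hη) (triA hη) := by
  intro p q r s _ _ hp hs f g h hf hg hh _
  calc eLpNorm (triA hη f g h) 2 volume
      ≤ kn (kerP hη 0) * (eLpNorm f p volume * (eLpNorm g q volume * eLpNorm h r volume)) := by
        refine (eLpNorm_cvl_le _ (hf.1.mul (hg.1.mul hh.1)) (by norm_num)).trans ?_
        gcongr
        refine (eLpNorm_mul_le hf.1 (hg.1.mul hh.1) p s 2).trans ?_
        gcongr
        exact eLpNorm_mul_le hg.1 hh.1 q r s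
    _ ≤ _ := by
        rw [← mul_assoc (eLpNorm f p volume)]
        gcongr
        exact le_self_add

lemma triBound_triB (hη : IsBump η) : TriBound (triC hη) (triB hη) := by
  intro p q r s _ _ hp hs f g h hf hg hh hb
  have hgh : Nice fun x => g x * h x := by
    simpa [mul_comm] using hh.mul_bdd hg.1 hb
  calc eLpNorm (triB hη f g h) 2 volume
      ≤ (kn (kerLE hη (-10)) * eLpNorm f p volume) *
          (kn (kerP hη 0) * (eLpNorm g q volume * eLpNorm h r volume)) := by
        refine (eLpNorm_mul_le (hf.cvl _).1 (hgh.cvl _).1 p s 2).trans ?_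
        gcongr
        · exact eLpNorm_cvl_le _ hf.1 hp
        · refine (eLpNorm_cvl_le _ (hg.1.mul hh.1) hs).trans ?_
          gcongr
          exact eLpNorm_mul_le hg.1 hh.1 q r s
    _ = kn (kerLE hη (-10)) * kn (kerP hη 0) *
          (eLpNorm f p volume * eLpNorm g q volume * eLpNorm h r volume) := by ring
    _ ≤ _ := by
        gcongr
        exact le_add_self

/-! ### Expanding into pieces -/

/-- Pairing with a fixed `L²` function is continuous, so `L²` convergence of the expansion becomes
convergence of numbers. With translated kernels in `W` this gives pointwise convergence of expanded
convolutions. -/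
lemma tendsto_sum_integral_proj_mul [NeZero n] (hη : IsBump η) {f W : Sp n → ℂ} (hf : MemLp f 2)
    (hW : MemLp W 2) (hfc : Continuous f) :
    Tendsto (fun m : ℕ => ∑ k ∈ Finset.Icc (-(m : ℤ)) m, ∫ y, proj η k f y * W y) atTop
      (𝓝 (∫ y, f y * W y)) := by
  have hN : Nice f := ⟨hfc, hf⟩
  have hp : ∀ k, MemLp (proj η k f) 2 := fun k => (hN.proj hη k).2
  have hs : ∀ m : ℕ, MemLp (fun y => ∑ k ∈ Finset.Icc (-(m : ℤ)) m, proj η k f y) 2 := fun m =>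
    memLp_finsetSum _ fun k _ => hp k
  rw [tendsto_iff_norm_sub_tendsto_zero]
  have h0 := ENNReal.Tendsto.mul_const (tendsto_sum_proj hη hf) (Or.inr hW.2.ne)
    (b := eLpNorm W 2 volume)
  rw [zero_mul] at h0
  have h1 := (ENNReal.tendsto_toReal ENNReal.zero_ne_top).comp h0
  rw [ENNReal.toReal_zero] at h1
  refine squeeze_zero (fun m => norm_nonneg _) (fun m => ?_) h1
  have hd : MemLp (fun y => ∑ k ∈ Finset.Icc (-(m : ℤ)) m, proj η k f y - f y) 2 := (hs m).sub hf
  have hi : ∀ k, Integrable fun y => proj η k f y * W y := fun k => (hp k).integrable_mul hW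
  rw [← integral_finsetSum _ fun k _ => hi k]
  have e : (∫ y, ∑ k ∈ Finset.Icc (-(m : ℤ)) m, proj η k f y * W y) - ∫ y, f y * W y
      = ∫ y, (∑ k ∈ Finset.Icc (-(m : ℤ)) m, proj η k f y - f y) * W y := by
    have hi' : Integrable fun y => f y * W y := hf.integrable_mul hW
    rw [← integral_sub (integrable_finsetSum _ fun k _ => hi k) hi']
    simp_rw [sub_mul, Finset.sum_mul]
  rw [e]
  simp only [Function.comp_apply]
  rw [← toReal_enorm]
  refine ENNReal.toReal_mono (ENNReal.mul_ne_top hd.2.ne hW.2.ne) ?_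
  refine (enorm_integral_le_lintegral_enorm _).trans ?_
  rw [← eLpNorm_one_eq_lintegral_enorm]
  have := eLpNorm_smul_le_mul_eLpNorm (p := 2) (q := 2) (r := 1) hW.1 hd.1
  simpa only [Pi.smul_def', smul_eq_mul, Pi.mul_def] using this

lemma tendsto_sum_cvl_proj_mul [NeZero n] (hη : IsBump η) (K : 𝓢(Sp n, ℂ)) {f G : Sp n → ℂ}
    (hf : Nice f) (hG : Nice G) (x : Sp n) :
    Tendsto (fun m : ℕ => ∑ k ∈ Finset.Icc (-(m : ℤ)) m, cvl K (fun y => proj η k f y * G y) x)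
      atTop (𝓝 (cvl K (fun y => f y * G y) x)) := by
  have hW : MemLp (fun y => G y * K (x - y)) 2 := by
    obtain ⟨B, -, hB⟩ := exists_kernel_bound K 0
    exact (hG.mul_bdd (g := fun y => K (x - y)) (K.continuous.comp (by fun_prop))
      ⟨B, fun y => by simpa using hB (x - y)⟩).2
  have := tendsto_sum_integral_proj_mul hη hf.2 hW hf.1
  simpa only [cvl, smul_eq_mul, mul_assoc] using this

lemma tendsto_sum_cvl_proj [NeZero n] (hη : IsBump η) (K : 𝓢(Sp n, ℂ)) {f : Sp n → ℂ}
    (hf : Nice f) (x : Sp n) :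
    Tendsto (fun m : ℕ => ∑ k ∈ Finset.Icc (-(m : ℤ)) m, cvl K (proj η k f) x)
      atTop (𝓝 (cvl K f x)) := by
  have hW : MemLp (fun y => K (x - y)) 2 :=
    (K.memLp 2).comp_measurePreserving (Measure.measurePreserving_sub_left volume x)
  have := tendsto_sum_integral_proj_mul hη hf.2 hW hf.1
  simpa only [cvl, smul_eq_mul] using this

/-- Fatou's lemma and the triangle inequality: pointwise convergence of symmetric partial sums
suffices, without norm convergence of the series. -/
lemma eLpNorm_le_tsum_of_tendsto {u : Sp n → ℂ} {v : ℤ → Sp n → ℂ} (hv : ∀ k, Continuous (v k))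
    (h : ∀ x, Tendsto (fun m : ℕ => ∑ k ∈ Finset.Icc (-(m : ℤ)) m, v k x) atTop (𝓝 (u x)))
    {p : ℝ≥0∞} (hp : 1 ≤ p) :
    eLpNorm u p volume ≤ ∑' k, eLpNorm (v k) p volume := by
  refine Lp.eLpNorm_le_of_ae_tendsto (u := atTop)
    (f := fun (m : ℕ) x => ∑ k ∈ Finset.Icc (-(m : ℤ)) m, v k x)
    (Eventually.of_forall fun m => ?_)
    (fun m => (continuous_finsetSum _ fun k _ => hv k).aestronglyMeasurable)
    (Eventually.of_forall h)
  have := eLpNorm_sum_le (μ := (volume : Measure (Sp n))) (f := v)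
    (s := Finset.Icc (-(m : ℤ)) m) (fun k _ => (hv k).aestronglyMeasurable) hp
  refine le_trans (le_of_eq ?_) (this.trans (ENNReal.sum_le_tsum _))
  congr 1
  funext x
  simp

/-! ### Fixed-time estimates -/

/-- Majorants for the Lebesgue norms of the pieces of a function. -/
structure Major (η : Sp n → ℝ) (p q : ℝ≥0∞) (a b e : ℤ → ℝ≥0∞) (f : Sp n → ℂ) : Prop where
  nice : Nice f
  le_a : ∀ k, eLpNorm (proj η k f) p volume ≤ a k
  le_b : ∀ k, eLpNorm (proj η k f) q volume ≤ b k
  le_e : ∀ k, eLpNorm (proj η k f) ⊤ volume ≤ e k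

/-- The summand of the bilinear bound, for ordered frequencies. -/
def gSum (a b : ℤ → ℝ≥0∞) (i j : ℤ) : ℝ≥0∞ := if -9 ≤ i ∧ j ≤ i then dy j * a j * b i else 0

/-- The summand of the trilinear bound, for ordered frequencies. -/
def hSum (a b e : ℤ → ℝ≥0∞) (i j l : ℤ) : ℝ≥0∞ :=
  if -9 ≤ i ∧ j ≤ i ∧ l ≤ j then b i * a j * e l else 0

variable {p q : ℝ≥0∞} {a b e : ℤ → ℝ≥0∞}

/-- The estimate that puts the gain on the lower of the two frequencies is chosen. Unless both are
at most `-10`, the higher one is at least `-9`, which is the cutoff in `gSum`. -/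
lemma eLpNorm_bil_proj_le (hη : IsBump η) (j : Fin n) [ENNReal.HolderTriple p q 2] (hp : 1 ≤ p)
    (hq : 1 ≤ q) {f g : Sp n → ℂ} (hf : Major η p q a b e f) (hg : Major η p q a b e g) (k l : ℤ) :
    eLpNorm (bil hη j (proj η k f) (fun x => dproj hη l g x (dir j)) (proj η l g)) 2 volume
      ≤ bilC hη * (gSum a b k l + gSum a b l k) := by
  have : ENNReal.HolderTriple q p 2 := ENNReal.HolderTriple.symm
  by_cases hlow : k ≤ -10 ∧ l ≤ -10
  · rw [bil_proj_low hη j hlow.1 hlow.2 hf.nice hg.nice]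
    simp
  · rcases le_total l k with h | h
    · refine (bil_proj_high_low hη j hp hq k l hf.nice hg.nice).trans ?_
      gcongr
      refine le_trans ?_ le_self_add
      rw [gSum, if_pos ⟨by lia, h⟩]
      gcongr
      · exact hg.le_a l
      · exact hf.le_b k
    · refine (bil_proj_low_high hη j hp hq k l hf.nice hg.nice).trans ?_
      gcongr
      refine le_trans ?_ le_add_self
      rw [gSum, if_pos ⟨by lia, h⟩]
      gcongr
      · exact hf.le_a k
      · exact hg.le_b l

/-- The bilinear form at a fixed time. -/
lemma eLpNorm_bil_le [NeZero n] (hη : IsBump η) (j : Fin n) [ENNReal.HolderTriple p q 2]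
    (hp : 1 ≤ p) (hq : 1 ≤ q) {f g : Sp n → ℂ} (hf : Major η p q a b e f)
    (hg : Major η p q a b e g) (hd : Differentiable ℝ g)
    (hg' : Nice fun x => fderiv ℝ g x (dir j)) :
    eLpNorm (bil hη j f (fun x => fderiv ℝ g x (dir j)) g) 2 volume
      ≤ 2 * bilC hη * ∑' i, ∑' l, gSum a b i l := by
  set g' := fun x => fderiv ℝ g x (dir j)
  -- The pieces of `∂_j g` are the derivatives of the pieces of `g`, so expanding `g` and `∂_j g`
  -- simultaneously yields the bilinear form of pieces.
  have hdp : ∀ l, (fun x => dproj hη l g x (dir j)) = proj η l g' := fun l =>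
    funext fun x => dproj_eq_proj hη l hg.nice hd hg' x
  have s1 : eLpNorm (bil hη j f g' g) 2 volume
      ≤ ∑' k, eLpNorm (bil hη j (proj η k f) g' g) 2 volume := by
    refine eLpNorm_le_tsum_of_tendsto (fun k => ?_) (fun x => ?_) (by norm_num)
    · have hk := hf.nice.proj hη k
      exact (continuous_cvl _ (hk.wint_mul hg')).sub ((hk.cvl _).1.mul (hg.nice.cvl _).1)
    · simp only [bil, Finset.sum_sub_distrib, ← Finset.sum_mul]
      exact (tendsto_sum_cvl_proj_mul hη _ hf.nice hg' x).sub
        ((tendsto_sum_cvl_proj hη _ hf.nice x).mul_const _)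
  have s2 : ∀ k, eLpNorm (bil hη j (proj η k f) g' g) 2 volume
      ≤ ∑' l, eLpNorm (bil hη j (proj η k f) (proj η l g') (proj η l g)) 2 volume := by
    intro k
    have hk := hf.nice.proj hη k
    refine eLpNorm_le_tsum_of_tendsto (fun l => ?_) (fun x => ?_) (by norm_num)
    · exact (continuous_cvl _ (hk.wint_mul (hg'.proj hη l))).sub
        ((hk.cvl _).1.mul ((hg.nice.proj hη l).cvl _).1)
    · simp only [bil, Finset.sum_sub_distrib, ← Finset.mul_sum]
      have h1 := tendsto_sum_cvl_proj_mul hη (kerP hη 0) hg' hk x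
      simp_rw [mul_comm _ (proj η k f _)] at h1
      exact h1.sub ((tendsto_sum_cvl_proj hη _ hg.nice x).const_mul _)
  calc _ ≤ ∑' k, ∑' l, bilC hη * (gSum a b k l + gSum a b l k) := by
        refine s1.trans (ENNReal.tsum_le_tsum fun k => (s2 k).trans
          (ENNReal.tsum_le_tsum fun l => ?_))
        rw [← hdp]
        exact eLpNorm_bil_proj_le hη j hp hq hf hg k l
    _ = bilC hη * (∑' k, ∑' l, gSum a b k l + ∑' k, ∑' l, gSum a b l k) := by
        simp_rw [ENNReal.tsum_mul_left, ENNReal.tsum_add]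
    _ = _ := by
        rw [ENNReal.tsum_comm (f := fun k l => gSum a b l k)]
        ring

/-- The sum over all arrangements of three frequencies. -/
def hSym (a b e : ℤ → ℝ≥0∞) (k l m : ℤ) : ℝ≥0∞ :=
  hSum a b e k l m + hSum a b e k m l + hSum a b e l k m + hSum a b e l m k
    + hSum a b e m k l + hSum a b e m l k

lemma tsum_hSym (a b e : ℤ → ℝ≥0∞) :
    ∑' k, ∑' l, ∑' m, hSym a b e k l m = 6 * ∑' k, ∑' l, ∑' m, hSum a b e k l m := by
  unfold hSym
  simp_rw [ENNReal.tsum_add]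
  have h2 : ∑' k, ∑' l, ∑' m, hSum a b e k m l = ∑' k, ∑' l, ∑' m, hSum a b e k l m :=
    tsum_congr fun k => ENNReal.tsum_comm
  have h3 : ∑' k, ∑' l, ∑' m, hSum a b e l k m = ∑' k, ∑' l, ∑' m, hSum a b e k l m :=
    ENNReal.tsum_comm
  have h4 : ∑' k, ∑' l, ∑' m, hSum a b e l m k = ∑' k, ∑' l, ∑' m, hSum a b e k l m := by
    rw [ENNReal.tsum_comm]
    exact tsum_congr fun k => ENNReal.tsum_comm
  have h5 : ∑' k, ∑' l, ∑' m, hSum a b e m k l = ∑' k, ∑' l, ∑' m, hSum a b e k l m := by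
    rw [← h3]
    exact tsum_congr fun k => ENNReal.tsum_comm
  have h6 : ∑' k, ∑' l, ∑' m, hSum a b e m l k = ∑' k, ∑' l, ∑' m, hSum a b e k l m := by
    rw [← h4]
    exact tsum_congr fun k => ENNReal.tsum_comm
  rw [h2, h3, h4, h5, h6]
  ring

/-- For each ordering of the frequencies the highest factor is placed in `L^q`, the middle one in
`L^p` and the lowest in `L^∞`, as `hSum` prescribes; `hSym` collects the six orderings. -/
lemma eLpNorm_tri_proj_le {C : ℝ≥0∞} {M : (Sp n → ℂ) → (Sp n → ℂ) → (Sp n → ℂ) → Sp n → ℂ}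
    (hM : TriBound C M) (hη : IsBump η)
    (hlow : ∀ k l m : ℤ, k ≤ -10 → l ≤ -10 → m ≤ -10 → ∀ f g h : Sp n → ℂ, Nice f → Nice g →
      Nice h → M (proj η k f) (proj η l g) (proj η m h) = 0)
    [ENNReal.HolderTriple p q 2] (hp : 1 ≤ p) (hq : 1 ≤ q) {f g h : Sp n → ℂ}
    (hf : Major η p q a b e f) (hg : Major η p q a b e g) (hh : Major η p q a b e h) (k l m : ℤ) :
    eLpNorm (M (proj η k f) (proj η l g) (proj η m h)) 2 volume ≤ C * hSym a b e k l m := by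
  have hqp : ENNReal.HolderTriple q p 2 := ENNReal.HolderTriple.symm
  by_cases h10 : k ≤ -10 ∧ l ≤ -10 ∧ m ≤ -10
  · rw [hlow k l m h10.1 h10.2.1 h10.2.2 f g h hf.nice hg.nice hh.nice]
    simp
  have F := hf.nice.proj hη k
  have G := hg.nice.proj hη l
  have H := hh.nice.proj hη m
  have B := hg.nice.bdd_proj hη l
  have h12 : (1 : ℝ≥0∞) ≤ 2 := by norm_num
  have ht : (1 : ℝ≥0∞) ≤ ⊤ := le_top
  have key : ∀ i j o : ℤ, (-9 ≤ i ∧ j ≤ i ∧ o ≤ j) → hSum a b e i j o = b i * a j * e o :=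
    fun i j o hio => if_pos hio
  unfold hSym
  rcases le_total l k with h1 | h1 <;> rcases le_total m k with h2 | h2 <;>
    rcases le_total m l with h3 | h3
  · refine (hM q p ⊤ p hq hp _ _ _ F G H B).trans ?_
    rw [key k l m ⟨by lia, h1, h3⟩]
    gcongr
    refine le_trans ?_ (le_self_add.trans (le_self_add.trans (le_self_add.trans
      (le_self_add.trans le_self_add))))
    exact mul_le_mul' (mul_le_mul' (hf.le_b k) (hg.le_a l)) (hh.le_e m)
  · refine (hM q ⊤ p p hq hp _ _ _ F G H B).trans ?_
    rw [key k m l ⟨by lia, h2, h3⟩]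
    gcongr
    refine le_trans ?_ ((le_add_self.trans le_self_add).trans (le_self_add.trans
      (le_self_add.trans le_self_add)))
    rw [mul_right_comm]
    exact mul_le_mul' (mul_le_mul' (hf.le_b k) (hh.le_a m)) (hg.le_e l)
  -- The three comparisons are cyclic here, hence all frequencies coincide and any assignment of
  -- exponents serves.
  · have hkm : m = k := by lia
    refine (hM q p ⊤ p hq hp _ _ _ F G H B).trans ?_
    rw [key k l m ⟨by lia, h1, by lia⟩]
    gcongr
    refine le_trans ?_ (le_self_add.trans (le_self_add.trans (le_self_add.trans
      (le_self_add.trans le_self_add))))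
    exact mul_le_mul' (mul_le_mul' (hf.le_b k) (hg.le_a l)) (hh.le_e m)
  · refine (hM p ⊤ q q hp hq _ _ _ F G H B).trans ?_
    rw [key m k l ⟨by lia, h2, h1⟩]
    gcongr
    refine le_trans ?_ (le_add_self.trans le_self_add)
    calc _ = eLpNorm (proj η m h) q volume * eLpNorm (proj η k f) p volume
          * eLpNorm (proj η l g) ⊤ volume := by ring
      _ ≤ _ := mul_le_mul' (mul_le_mul' (hh.le_b m) (hf.le_a k)) (hg.le_e l)
  · refine (hM p q ⊤ q hp hq _ _ _ F G H B).trans ?_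
    rw [key l k m ⟨by lia, h1, h2⟩]
    gcongr
    refine le_trans ?_ (le_add_self.trans (le_self_add.trans (le_self_add.trans le_self_add)))
    calc _ = eLpNorm (proj η l g) q volume * eLpNorm (proj η k f) p volume
          * eLpNorm (proj η m h) ⊤ volume := by ring
      _ ≤ _ := mul_le_mul' (mul_le_mul' (hg.le_b l) (hf.le_a k)) (hh.le_e m)
  · have hkm : m = k := by lia
    have hlm : l = k := by lia
    refine (hM q p ⊤ p hq hp _ _ _ F G H B).trans ?_
    rw [key k l m ⟨by lia, by lia, by lia⟩]
    gcongr
    refine le_trans ?_ (le_self_add.trans (le_self_add.trans (le_self_add.trans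
      (le_self_add.trans le_self_add))))
    exact mul_le_mul' (mul_le_mul' (hf.le_b k) (hg.le_a l)) (hh.le_e m)
  · refine (hM ⊤ q p 2 ht h12 _ _ _ F G H B).trans ?_
    rw [key l m k ⟨by lia, h3, h2⟩]
    gcongr
    refine le_trans ?_ (le_add_self.trans (le_self_add.trans le_self_add))
    calc _ = eLpNorm (proj η l g) q volume * eLpNorm (proj η m h) p volume
          * eLpNorm (proj η k f) ⊤ volume := by ring
      _ ≤ _ := mul_le_mul' (mul_le_mul' (hg.le_b l) (hh.le_a m)) (hf.le_e k)
  · refine (hM ⊤ p q 2 ht h12 _ _ _ F G H B).trans ?_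
    rw [key m l k ⟨by lia, h3, h1⟩]
    gcongr
    refine le_trans ?_ le_add_self
    calc _ = eLpNorm (proj η m h) q volume * eLpNorm (proj η l g) p volume
          * eLpNorm (proj η k f) ⊤ volume := by ring
      _ ≤ _ := mul_le_mul' (mul_le_mul' (hh.le_b m) (hg.le_a l)) (hf.le_e k)

lemma eLpNorm_triA_le [NeZero n] (hη : IsBump η) [ENNReal.HolderTriple p q 2] (hp : 1 ≤ p)
    (hq : 1 ≤ q) {f g h : Sp n → ℂ} (hf : Major η p q a b e f) (hg : Major η p q a b e g)
    (hh : Major η p q a b e h) (hgh : Nice fun x => g x * h x) :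
    eLpNorm (triA hη f g h) 2 volume
      ≤ 6 * triC hη * ∑' i, ∑' j, ∑' l, hSum a b e i j l := by
  have s1 : eLpNorm (triA hη f g h) 2 volume
      ≤ ∑' k, eLpNorm (triA hη (proj η k f) g h) 2 volume := by
    refine eLpNorm_le_tsum_of_tendsto (fun k => ?_) (fun x => ?_) (by norm_num)
    · exact continuous_cvl _ ((hf.nice.proj hη k).wint_mul hgh)
    · exact tendsto_sum_cvl_proj_mul hη _ hf.nice hgh x
  have s2 : ∀ k, eLpNorm (triA hη (proj η k f) g h) 2 volume
      ≤ ∑' l, eLpNorm (triA hη (proj η k f) (proj η l g) h) 2 volume := by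
    intro k
    refine eLpNorm_le_tsum_of_tendsto (fun l => ?_) (fun x => ?_) (by norm_num)
    · exact continuous_cvl _ ((hf.nice.proj hη k).wint_mul (hh.nice.proj_mul hg.nice hη l))
    · have := tendsto_sum_cvl_proj_mul hη (kerP hη 0) hg.nice (hh.nice.proj_mul hf.nice hη k) x
      simpa only [triA, mul_left_comm] using this
  have s3 : ∀ k l, eLpNorm (triA hη (proj η k f) (proj η l g) h) 2 volume
      ≤ ∑' m, eLpNorm (triA hη (proj η k f) (proj η l g) (proj η m h)) 2 volume := by
    intro k l
    have hkl := (hf.nice.proj hη k).mul_proj hg.nice hη l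
    refine eLpNorm_le_tsum_of_tendsto (fun m => ?_) (fun x => ?_) (by norm_num)
    · exact continuous_cvl _ ((hf.nice.proj hη k).wint_mul
        ((hg.nice.proj hη l).mul_proj hh.nice hη m))
    · have := tendsto_sum_cvl_proj_mul hη (kerP hη 0) hh.nice hkl x
      simp_rw [mul_comm (proj η _ h _) (_ * _), mul_comm (h _) (_ * _), mul_assoc] at this
      exact this
  calc _ ≤ ∑' k, ∑' l, ∑' m, triC hη * hSym a b e k l m :=
        s1.trans (ENNReal.tsum_le_tsum fun k => (s2 k).trans (ENNReal.tsum_le_tsum fun l =>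
          (s3 k l).trans (ENNReal.tsum_le_tsum fun m =>
            eLpNorm_tri_proj_le (triBound_triA hη) hη
              (fun _ _ _ h1 h2 h3 _ _ _ hf hg hh => triA_proj_low hη h1 h2 h3 hf hg hh)
              hp hq hf hg hh k l m)))
    _ = _ := by
        simp_rw [ENNReal.tsum_mul_left]
        rw [tsum_hSym]
        ring

lemma eLpNorm_triB_le [NeZero n] (hη : IsBump η) [ENNReal.HolderTriple p q 2] (hp : 1 ≤ p)
    (hq : 1 ≤ q) {f g h : Sp n → ℂ} (hf : Major η p q a b e f) (hg : Major η p q a b e g)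
    (hh : Major η p q a b e h) :
    eLpNorm (triB hη f g h) 2 volume
      ≤ 6 * triC hη * ∑' i, ∑' j, ∑' l, hSum a b e i j l := by
  have s1 : eLpNorm (triB hη f g h) 2 volume
      ≤ ∑' k, eLpNorm (triB hη (proj η k f) g h) 2 volume := by
    refine eLpNorm_le_tsum_of_tendsto (fun k => ?_) (fun x => ?_) (by norm_num)
    · exact ((hf.nice.proj hη k).cvl _).1.mul (continuous_cvl _ (hg.nice.wint_mul hh.nice))
    · simp only [triB, ← Finset.sum_mul]
      exact (tendsto_sum_cvl_proj hη _ hf.nice x).mul_const _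
  have s2 : ∀ k, eLpNorm (triB hη (proj η k f) g h) 2 volume
      ≤ ∑' l, eLpNorm (triB hη (proj η k f) (proj η l g) h) 2 volume := by
    intro k
    refine eLpNorm_le_tsum_of_tendsto (fun l => ?_) (fun x => ?_) (by norm_num)
    · exact ((hf.nice.proj hη k).cvl _).1.mul
        (continuous_cvl _ ((hg.nice.proj hη l).wint_mul hh.nice))
    · simp only [triB, ← Finset.mul_sum]
      exact (tendsto_sum_cvl_proj_mul hη (kerP hη 0) hg.nice hh.nice x).const_mul _
  have s3 : ∀ k l, eLpNorm (triB hη (proj η k f) (proj η l g) h) 2 volume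
      ≤ ∑' m, eLpNorm (triB hη (proj η k f) (proj η l g) (proj η m h)) 2 volume := by
    intro k l
    refine eLpNorm_le_tsum_of_tendsto (fun m => ?_) (fun x => ?_) (by norm_num)
    · exact ((hf.nice.proj hη k).cvl _).1.mul
        (continuous_cvl _ ((hg.nice.proj hη l).wint_mul (hh.nice.proj hη m)))
    · simp only [triB, ← Finset.mul_sum]
      have := tendsto_sum_cvl_proj_mul hη (kerP hη 0) hh.nice (hg.nice.proj hη l) x
      simp_rw [mul_comm _ (proj η l g _)] at this
      exact this.const_mul _
  calc _ ≤ ∑' k, ∑' l, ∑' m, triC hη * hSym a b e k l m :=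
        s1.trans (ENNReal.tsum_le_tsum fun k => (s2 k).trans (ENNReal.tsum_le_tsum fun l =>
          (s3 k l).trans (ENNReal.tsum_le_tsum fun m =>
            eLpNorm_tri_proj_le (triBound_triB hη) hη
              (fun _ _ _ _ h2 h3 _ _ _ _ hg hh => triB_proj_low hη h2 h3 hg hh)
              hp hq hf hg hh k l m)))
    _ = _ := by
        simp_rw [ENNReal.tsum_mul_left]
        rw [tsum_hSym]
        ring

end

/-! ### Regularity at a fixed time -/

/-- A summable two-sided geometric weight. -/
def gw (k : ℤ) : ℝ≥0∞ := ENNReal.ofReal ((2 : ℝ) ^ (-|(k : ℝ)| / 4))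

lemma summable_two_rpow {s : ℝ} (hs : s < 0) : Summable fun m : ℕ => (2 : ℝ) ^ (s * m) := by
  simp_rw [Real.rpow_mul (zero_le_two : (0 : ℝ) ≤ 2), Real.rpow_natCast]
  exact summable_geometric_of_lt_one (by positivity) (Real.rpow_lt_one_of_one_lt_of_neg one_lt_two hs)

lemma tsum_gw_ne_top : ∑' k, gw k ≠ ⊤ := by
  unfold gw
  have hs := summable_two_rpow (s := -1 / 4) (by norm_num)
  refine Summable.tsum_ofReal_ne_top (Summable.of_nat_of_neg ?_ ?_)
  · refine hs.congr fun m => ?_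
    simp only [Int.cast_natCast, Nat.abs_cast]
    ring_nf
  · refine hs.congr fun m => ?_
    simp only [Int.cast_neg, Int.cast_natCast, abs_neg, Nat.abs_cast]
    ring_nf

/-- The `L²` convergence of the expansion gives almost everywhere convergence along a subsequence,
and Fatou's lemma carries the triangle inequality to any exponent. -/
lemma eLpNorm_le_tsum_proj [NeZero n] (hη : IsBump η) {f : Sp n → ℂ} (hf : Nice f) {p : ℝ≥0∞}
    (hp : 1 ≤ p) : eLpNorm f p volume ≤ ∑' k, eLpNorm (proj η k f) p volume := by
  set s : ℕ → Sp n → ℂ := fun m x => ∑ k ∈ Finset.Icc (-(m : ℤ)) m, proj η k f x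
  have hc : ∀ m, Continuous (s m) := fun m =>
    continuous_finsetSum _ fun k _ => (hf.proj hη k).1
  have h := tendstoInMeasure_of_tendsto_eLpNorm (by norm_num : (2 : ℝ≥0∞) ≠ 0)
    (fun m => (hc m).aestronglyMeasurable) hf.1.aestronglyMeasurable (tendsto_sum_proj hη hf.2)
  obtain ⟨ns, -, hns⟩ := h.exists_seq_tendsto_ae
  refine Lp.eLpNorm_le_of_ae_tendsto (u := atTop) (Eventually.of_forall fun m => ?_)
    (fun m => (hc (ns m)).aestronglyMeasurable) hns
  have := eLpNorm_sum_le (μ := (volume : Measure (Sp n))) (f := fun k => proj η k f)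
    (s := Finset.Icc (-(ns m : ℤ)) (ns m)) (fun k _ => (hf.proj hη k).1.aestronglyMeasurable) hp
  refine le_trans (le_of_eq ?_) (this.trans (ENNReal.sum_le_tsum _))
  congr 1
  funext x
  simp [s]

/-! ### Gradient bounds through difference quotients. -/

lemma eLpNorm_translate_sub_le {f : Sp n → ℂ} {f' : Sp n → Sp n →L[ℝ] ℂ}
    (hf : ∀ x, HasFDerivAt f (f' x) x) (hf' : Continuous f') (z : Sp n) {p : ℝ≥0∞} (hp : 1 ≤ p) :
    eLpNorm (fun x => f (x - z) - f x) p volume ≤ ‖z‖ₑ * eLpNorm f' p volume := by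
  set h : Sp n → ℝ → ℝ≥0∞ := fun x s => ‖f' (x - s • z)‖ₑ * ‖z‖ₑ
  have hm : Measurable (Function.uncurry h) :=
    (hf'.comp (by fun_prop : Continuous fun w : Sp n × ℝ => w.1 - w.2 • z)).enorm.measurable.mul
      measurable_const
  have hν : (volume.restrict (Icc (0 : ℝ) 1)) univ = 1 := by simp
  have key := eLpNorm_lintegral_le (μ := volume) (ν := volume.restrict (Icc (0 : ℝ) 1)) hm hp
    (B := ‖z‖ₑ * eLpNorm f' p volume) (fun s => ?_)
  · rw [hν, one_mul] at key
    exact (eLpNorm_mono_enorm fun x => enorm_sub_le_lintegral hf hf' x z).trans key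
  · have e1 : eLpNorm (fun x => h x s) p volume
        = eLpNorm (‖z‖ • fun x => ‖f' (x - s • z)‖) p volume := by
      refine eLpNorm_congr_enorm_ae (Eventually.of_forall fun x => ?_)
      simp only [h, Pi.smul_apply, smul_eq_mul]
      rw [enorm_mul, enorm_norm, enorm_norm, mul_comm]
      rfl
    rw [e1, eLpNorm_const_smul, enorm_norm, eLpNorm_norm, eLpNorm_translate hf' p (s • z)]

/-- The constant in the gradient estimate. -/
def gradC (hη : IsBump η) (f : Sp n → ℂ) : ℝ≥0∞ :=
  n * bern hη * ∑' k, dy k * eLpNorm (proj η k f) 2 volume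

/-- The estimate holds for the partial sums by Bernstein's inequality, uniformly in `m`. Replacing
them by `f` costs twice the `L²` distance, which tends to zero. -/
lemma eLpNorm_translate_sub_le_gradC [NeZero n] (hη : IsBump η) {f : Sp n → ℂ} (hf : Nice f)
    (z : Sp n) : eLpNorm (fun x => f (x - z) - f x) 2 volume ≤ ‖z‖ₑ * gradC hη f := by
  set s : ℕ → Sp n → ℂ := fun m x => ∑ k ∈ Finset.Icc (-(m : ℤ)) m, proj η k f x
  have hc : ∀ m, Continuous (s m) := fun m =>
    continuous_finsetSum _ fun k _ => (hf.proj hη k).1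
  have hS : ∀ m, eLpNorm (fun x => s m (x - z) - s m x) 2 volume ≤ ‖z‖ₑ * gradC hη f := by
    intro m
    have h1 := eLpNorm_sum_le (μ := (volume : Measure (Sp n)))
      (f := fun k x => proj η k f (x - z) - proj η k f x) (p := 2) (s := Finset.Icc (-(m : ℤ)) m)
      (fun k _ => (((hf.proj hη k).1.comp (continuous_sub_right z)).sub
        (hf.proj hη k).1).aestronglyMeasurable) (by norm_num)
    calc _ ≤ ∑ k ∈ Finset.Icc (-(m : ℤ)) m,
          eLpNorm (fun x => proj η k f (x - z) - proj η k f x) 2 volume := by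
          refine le_trans (le_of_eq ?_) h1
          congr 1
          funext x
          simp [s]
      _ ≤ ∑ k ∈ Finset.Icc (-(m : ℤ)) m,
          ‖z‖ₑ * (n * bern hη * (dy k * eLpNorm (proj η k f) 2 volume)) := by
          refine Finset.sum_le_sum fun k _ => ?_
          refine (eLpNorm_translate_sub_le (hasFDerivAt_proj hη k hf) (continuous_dproj hη k hf) z
            (by norm_num)).trans ?_
          gcongr
          refine (eLpNorm_dproj_le hη k hf (by norm_num)).trans_eq ?_
          ring
      _ ≤ ‖z‖ₑ * gradC hη f := by
          rw [← Finset.mul_sum, ← Finset.mul_sum]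
          unfold gradC
          gcongr
          exact ENNReal.sum_le_tsum _
  have hlim : Tendsto (fun m : ℕ => ‖z‖ₑ * gradC hη f + 2 * eLpNorm (fun x => s m x - f x) 2 volume)
      atTop (𝓝 (‖z‖ₑ * gradC hη f + 2 * 0)) :=
    tendsto_const_nhds.add (ENNReal.Tendsto.const_mul (tendsto_sum_proj hη hf.2) (by simp))
  rw [mul_zero, add_zero] at hlim
  refine ge_of_tendsto hlim (Eventually.of_forall fun m => ?_)
  have hd : Continuous fun x => s m x - f x := (hc m).sub hf.1
  have e : (fun x => f (x - z) - f x)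
      = fun x => (s m (x - z) - s m x) + (s m x - f x - (s m (x - z) - f (x - z))) := by
    funext x
    ring
  have ht := eLpNorm_translate hd 2 z
  rw [e]
  refine (eLpNorm_add_le (f := fun x => s m (x - z) - s m x)
    (g := fun x => s m x - f x - (s m (x - z) - f (x - z)))
    (((hc m).comp (continuous_sub_right z)).sub (hc m)).aestronglyMeasurable
    (hd.sub (hd.comp (continuous_sub_right z))).aestronglyMeasurable (by norm_num)).trans ?_
  refine add_le_add (hS m) ?_
  refine (eLpNorm_sub_le' hd (hd.comp (continuous_sub_right z))).trans_eq ?_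
  rw [two_mul]
  exact congrArg _ ht

/-- Commuting the derivative with the projections through `dproj_eq_proj` would presuppose that it
is in `L²`. Difference quotients with steps `1/(m+1)` are bounded uniformly instead, and Fatou's
lemma passes to the limit. -/
lemma eLpNorm_fderiv_apply_le_gradC [NeZero n] (hη : IsBump η) {f : Sp n → ℂ} (hf : Nice f)
    (hd : Differentiable ℝ f) (j : Fin n) :
    eLpNorm (fun x => fderiv ℝ f x (dir j)) 2 volume ≤ gradC hη f := by
  set h : ℕ → ℝ := fun m => 1 / ((m : ℝ) + 1)
  have hpos : ∀ m, 0 < h m := fun m => by positivity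
  have hto : Tendsto h atTop (𝓝[≠] 0) :=
    tendsto_nhdsWithin_iff.2 ⟨tendsto_one_div_add_atTop_nhds_zero_nat,
      Eventually.of_forall fun m => (hpos m).ne'⟩
  refine Lp.eLpNorm_le_of_ae_tendsto (u := atTop)
    (f := fun m => (h m)⁻¹ • fun x => f (x - (-h m) • dir j) - f x)
    (Eventually.of_forall fun m => ?_) (fun m => ?_) (Eventually.of_forall fun x => ?_)
  · rw [eLpNorm_const_smul]
    refine (mul_le_mul_right (eLpNorm_translate_sub_le_gradC hη hf _) _).trans ?_
    rw [enorm_smul, ← mul_assoc, ← mul_assoc, enorm_neg, ← enorm_mul, inv_mul_cancel₀ (hpos m).ne']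
    simp [enorm]
  · exact ((hf.1.comp (continuous_sub_right _)).sub hf.1).aestronglyMeasurable.const_smul _
  · have := ((hd x).hasFDerivAt.hasLineDerivAt (dir j)).tendsto_slope_zero.comp hto
    refine this.congr fun m => ?_
    simp [sub_eq_add_neg]

lemma kn_kerP_le (hη : IsBump η) (k : ℤ) : kn (kerP hη k) ≤ 2 * kn (kerLE hη 0) := by
  have h : ∀ j, kn (kerLE hη j) = kn (kerLE hη 0) := fun j => by
    rw [kn_eq, integral_norm_kerLE, ← kn_eq]
  rw [kerP_eq, two_mul]
  nth_rewrite 1 [← h k]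
  rw [← h (k - 1)]
  unfold kn
  rw [← lintegral_add_left (kerLE hη k).continuous.enorm.measurable]
  exact lintegral_mono fun z => enorm_sub_le

lemma eLpNorm_proj_two_le (hη : IsBump η) (k : ℤ) {f : Sp n → ℂ} (hf : Nice f) :
    eLpNorm (proj η k f) 2 volume ≤ 2 * kn (kerLE hη 0) * eLpNorm f 2 volume := by
  rw [funext (proj_eq_cvl hη k hf.2)]
  refine (eLpNorm_cvl_le _ hf.1 (by norm_num)).trans ?_
  gcongr
  exact kn_kerP_le hη k

/-- Interpolation: `|g|²` in `L²` is estimated by Hölder with exponents `2` and `∞`. -/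
lemma eLpNorm_four_sq_le {g : Sp n → ℂ} (hg : Continuous g) :
    eLpNorm g 4 volume ^ 2 ≤ eLpNorm g 2 volume * eLpNorm g ⊤ volume := by
  have h := eLpNorm_norm_rpow (p := 2) (μ := volume) g (q := 2) (by norm_num)
  have h4 : (2 : ℝ≥0∞) * ENNReal.ofReal 2 = 4 := by
    rw [show ENNReal.ofReal 2 = 2 by simp]
    norm_num
  rw [h4, ENNReal.rpow_two] at h
  rw [← h]
  refine le_trans (le_of_eq ?_) (eLpNorm_mul_le hg hg 2 ⊤ 2)
  refine eLpNorm_congr_norm_ae (Eventually.of_forall fun x => ?_)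
  simp only [Real.rpow_two, norm_pow, norm_norm, norm_mul]
  ring

/-- Bounds on the pieces that give control of `f` in `L⁴` and of its gradient in `L²`. -/
structure PieceBounds (η : Sp n → ℝ) (B : ℝ≥0) (f : Sp n → ℂ) : Prop where
  nice : Nice f
  two : eLpNorm f 2 volume ≤ B
  piece_two : ∀ k : ℤ, eLpNorm (proj η k f) 2 volume
    ≤ B * ENNReal.ofReal ((2 : ℝ) ^ (-(k : ℝ) * (n / 2 - 1)))
  piece_four : ∀ k : ℤ, eLpNorm (proj η k f) 4 volume
    ≤ B * ENNReal.ofReal ((2 : ℝ) ^ (-(k : ℝ) * (n / 4 - 1)))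
  piece_top : ∀ k : ℤ, eLpNorm (proj η k f) ⊤ volume ≤ B * dy k

lemma dy_eq_rpow (k : ℤ) : dy k = ENNReal.ofReal ((2 : ℝ) ^ (k : ℝ)) := by
  rw [dy, Real.rpow_intCast]

lemma ofReal_two_rpow_mono {s t : ℝ} (h : s ≤ t) :
    ENNReal.ofReal ((2 : ℝ) ^ s) ≤ ENNReal.ofReal ((2 : ℝ) ^ t) :=
  ENNReal.ofReal_le_ofReal (Real.rpow_le_rpow_of_exponent_le one_le_two h)

lemma ofReal_two_rpow_add (s t : ℝ) : ENNReal.ofReal ((2 : ℝ) ^ (s + t))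
    = ENNReal.ofReal ((2 : ℝ) ^ s) * ENNReal.ofReal ((2 : ℝ) ^ t) := by
  rw [Real.rpow_add two_pos, ENNReal.ofReal_mul (by positivity)]

/-- For `k ≥ 0` the decay `2^{-k(n/4-1)}` is at least `2^{-k/4}`-fast because `n ≥ 5`. For `k ≤ 0`
the `L⁴` bound has no decay available in general, and interpolation between `L²` and the `L^∞` bound
`2^k` is used. -/
lemma PieceBounds.four_le {B : ℝ≥0} {f : Sp n → ℂ} (h : PieceBounds η B f) (hη : IsBump η)
    (hn : 5 ≤ n) (k : ℤ) :
    eLpNorm (proj η k f) 4 volume ≤ (2 * kn (kerLE hη 0) + 1) * B * gw k := by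
  have hn' : (5 : ℝ) ≤ n := by exact_mod_cast hn
  rcases le_total 0 k with hk | hk
  · have hk' : (0 : ℝ) ≤ k := by exact_mod_cast hk
    refine (h.piece_four k).trans ?_
    unfold gw
    gcongr ?_ * ?_
    · exact le_mul_of_one_le_left' le_add_self
    · refine ofReal_two_rpow_mono ?_
      rw [abs_of_nonneg hk']
      nlinarith
  · have hk' : (k : ℝ) ≤ 0 := by exact_mod_cast hk
    rw [← ENNReal.pow_le_pow_left_iff (two_ne_zero)]
    refine (eLpNorm_four_sq_le (h.nice.proj hη k).1).trans ?_
    have e : gw k ^ 2 = ENNReal.ofReal ((2 : ℝ) ^ ((k : ℝ) / 2)) := by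
      rw [gw, sq, ← ofReal_two_rpow_add, abs_of_nonpos hk']
      ring_nf
    have hd : dy k ≤ gw k ^ 2 := by
      rw [e, dy_eq_rpow]
      exact ofReal_two_rpow_mono (by linarith)
    calc _ ≤ (2 * kn (kerLE hη 0) * B) * (B * gw k ^ 2) := by
          gcongr
          · exact (eLpNorm_proj_two_le hη k h.nice).trans (by gcongr; exact h.two)
          · exact (h.piece_top k).trans (by gcongr)
      _ ≤ ((2 * kn (kerLE hη 0) + 1) * B) * ((2 * kn (kerLE hη 0) + 1) * B * gw k ^ 2) := by
          exact mul_le_mul' (mul_le_mul' le_self_add le_rfl)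
            (mul_le_mul' (le_mul_of_one_le_left' le_add_self) le_rfl)
      _ = _ := by ring

/-- High frequencies decay because `n/2 - 2 ≥ 1/2`; at low frequencies the factor `2^k` alone
suffices against the plain `L²` bound. -/
lemma PieceBounds.grad_le {B : ℝ≥0} {f : Sp n → ℂ} (h : PieceBounds η B f) (hη : IsBump η)
    (hn : 5 ≤ n) (k : ℤ) :
    dy k * eLpNorm (proj η k f) 2 volume ≤ (2 * kn (kerLE hη 0) + 1) * B * gw k := by
  have hn' : (5 : ℝ) ≤ n := by exact_mod_cast hn
  rcases le_total 0 k with hk | hk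
  · have hk' : (0 : ℝ) ≤ k := by exact_mod_cast hk
    calc _ ≤ dy k * (B * ENNReal.ofReal ((2 : ℝ) ^ (-(k : ℝ) * (n / 2 - 1)))) := by
          gcongr
          exact h.piece_two k
      _ = 1 * B * ENNReal.ofReal ((2 : ℝ) ^ ((k : ℝ) + -(k : ℝ) * (n / 2 - 1))) := by
          rw [ofReal_two_rpow_add, dy_eq_rpow]
          ring
      _ ≤ _ := by
          unfold gw
          gcongr ?_ * _ * ?_
          · exact le_add_self
          · refine ofReal_two_rpow_mono ?_
            rw [abs_of_nonneg hk']
            nlinarith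
  · have hk' : (k : ℝ) ≤ 0 := by exact_mod_cast hk
    calc _ ≤ gw k * (2 * kn (kerLE hη 0) * B) := by
          gcongr
          · rw [dy_eq_rpow, gw, abs_of_nonpos hk']
            exact ofReal_two_rpow_mono (by linarith)
          · exact (eLpNorm_proj_two_le hη k h.nice).trans (by gcongr; exact h.two)
      _ ≤ gw k * ((2 * kn (kerLE hη 0) + 1) * B) := by
          gcongr
          exact le_self_add
      _ = _ := by ring

/-- The constant in the regularity estimates. -/
def regC (hη : IsBump η) (B : ℝ≥0) : ℝ≥0∞ :=
  (n * bern hη + 1) * ((2 * kn (kerLE hη 0) + 1) * B * ∑' k, gw k)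

lemma regC_ne_top (hη : IsBump η) (B : ℝ≥0) : regC hη B ≠ ⊤ := by
  unfold regC
  have h1 := kn_ne_top (kerLE hη 0)
  have h2 := bern_ne_top hη
  have h3 := tsum_gw_ne_top
  finiteness

lemma PieceBounds.eLpNorm_four_le [NeZero n] {B : ℝ≥0} {f : Sp n → ℂ} (h : PieceBounds η B f)
    (hη : IsBump η) (hn : 5 ≤ n) : eLpNorm f 4 volume ≤ regC hη B := by
  refine (eLpNorm_le_tsum_proj hη h.nice (by norm_num)).trans
    ((ENNReal.tsum_le_tsum (h.four_le hη hn)).trans ?_)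
  rw [ENNReal.tsum_mul_left]
  exact le_mul_of_one_le_left' le_add_self

lemma PieceBounds.eLpNorm_fderiv_le [NeZero n] {B : ℝ≥0} {f : Sp n → ℂ} (h : PieceBounds η B f)
    (hη : IsBump η) (hn : 5 ≤ n) (hd : Differentiable ℝ f) (j : Fin n) :
    eLpNorm (fun x => fderiv ℝ f x (dir j)) 2 volume ≤ regC hη B := by
  refine (eLpNorm_fderiv_apply_le_gradC hη h.nice hd j).trans ?_
  unfold gradC regC
  gcongr
  · exact le_self_add
  · rw [← ENNReal.tsum_mul_left]
    exact ENNReal.tsum_le_tsum (h.grad_le hη hn)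

/-! ### The error term at a fixed time -/

section ErrorTerm

variable {N : ℕ}

/-- The right-hand side `C^a_{bc} φ^b_α φ^c_β` of the curl equation. -/
def quadCurl (S : Fin N → Fin N → Fin N → ℝ) (u : Fin N → Fin (n + 1) → Sp n → ℂ)
    (a : Fin N) (α β : Fin (n + 1)) (y : Sp n) : ℂ :=
  ∑ b, ∑ c, (S a b c : ℂ) * (u b α y * u c β y)

/-- The right-hand side `-Γ^a_{bc} φ^b_β φ^c_γ m^{βγ}` of the divergence equation. -/
def quadDiv (S : Fin N → Fin N → Fin N → ℝ) (u : Fin N → Fin (n + 1) → Sp n → ℂ)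
    (a : Fin N) (y : Sp n) : ℂ :=
  ∑ b, ∑ c, ∑ β : Fin (n + 1), (-(conn S a b c * mink β) : ℂ) * (u b β y * u c β y)

/-- The expression for `□ φ^a_α` in terms of first derivatives `du μ b α = ∂_μ φ^b_α`. -/
def inhom (S : Fin N → Fin N → Fin N → ℝ) (u : Fin N → Fin (n + 1) → Sp n → ℂ)
    (du : Fin (n + 1) → Fin N → Fin (n + 1) → Sp n → ℂ) (a : Fin N) (α : Fin (n + 1))
    (y : Sp n) : ℂ :=
  ∑ b, ∑ c, ∑ β : Fin (n + 1), (-(conn S a b c * mink β) : ℂ) *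
      (du α b β y * u c β y + u b β y * du α c β y)
    + ∑ β : Fin (n + 1), (mink β : ℂ) *
      ∑ b, ∑ c, (S a b c : ℂ) * (du β b α y * u c β y + u b α y * du β c β y)

/-- The error in the equation for `P_0 φ^a_α`. -/
def errF (hη : IsBump η) (S : Fin N → Fin N → Fin N → ℝ) (u : Fin N → Fin (n + 1) → Sp n → ℂ)
    (du : Fin (n + 1) → Fin N → Fin (n + 1) → Sp n → ℂ) (a : Fin N) (α : Fin (n + 1))
    (x : Sp n) : ℂ :=
  cvl (kerP hη 0) (inhom S u du a α) x
    + ∑ b, ∑ c, ∑ β : Fin (n + 1), (2 * conn S a c b * mink β : ℂ) *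
      (cvl (kerLE hη (-10)) (u c β) x * cvl (kerP hη 0) (du β b α) x)

/-- The last two terms in the definition of `conn` are symmetric in `b` and `c` and cancel;
antisymmetry doubles the first. -/
lemma struct_eq_conn_sub (S : Fin N → Fin N → Fin N → ℝ) (hS : ∀ a b c, S a b c = -S a c b)
    (a b c : Fin N) : S a b c = conn S a b c - conn S a c b := by
  unfold conn
  linarith [hS a b c]

/-- The structural cancellation. In the terms from the divergence equation `∂_α φ_β` is replaced by
`∂_β φ_α` up to `quadCurl`; in those from the curl equation `C` is split as `Γ^a_{bc} - Γ^a_{cb}`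
and the contracted derivative `∂^β φ_β` becomes `quadDiv`. The `Γ^a_{bc}` parts cancel and the
`Γ^a_{cb}` parts add up, which produces the coefficient `-2`. -/
lemma inhom_eq (S : Fin N → Fin N → Fin N → ℝ) (hS : ∀ a b c, S a b c = -S a c b)
    {u : Fin N → Fin (n + 1) → Sp n → ℂ} {du : Fin (n + 1) → Fin N → Fin (n + 1) → Sp n → ℂ}
    {y : Sp n} (hcurl : ∀ a α β, du β a α y - du α a β y = quadCurl S u a α β y)
    (hdiv : ∀ a, ∑ α, (mink α : ℂ) * du α a α y = quadDiv S u a y) (a : Fin N)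
    (α : Fin (n + 1)) :
    inhom S u du a α y = ∑ b, ∑ c, ∑ β : Fin (n + 1),
        (-(2 * conn S a c b * mink β) : ℂ) * (u c β y * du β b α y)
      + ∑ b, ∑ c, ∑ β : Fin (n + 1), (conn S a b c * mink β : ℂ) * (u c β y * quadCurl S u b α β y)
      + ∑ b, ∑ c, ∑ β : Fin (n + 1), (conn S a b c * mink β : ℂ) * (u b β y * quadCurl S u c α β y)
      + ∑ b, ∑ c, (S a b c : ℂ) * (u b α y * quadDiv S u c y) := by
  have e1 : ∑ β : Fin (n + 1), (mink β : ℂ) *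
      ∑ b, ∑ c, (S a b c : ℂ) * (du β b α y * u c β y + u b α y * du β c β y)
      = ∑ b, ∑ c, ∑ β : Fin (n + 1), (S a b c * mink β : ℂ) * (u c β y * du β b α y)
        + ∑ b, ∑ c, (S a b c : ℂ) * (u b α y * quadDiv S u c y) := by
    simp_rw [← hdiv, Finset.mul_sum]
    rw [Finset.sum_comm, ← Finset.sum_add_distrib]
    refine Finset.sum_congr rfl fun b _ => ?_
    rw [Finset.sum_comm, ← Finset.sum_add_distrib]
    refine Finset.sum_congr rfl fun c _ => ?_
    rw [← Finset.sum_add_distrib]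
    refine Finset.sum_congr rfl fun β _ => ?_
    ring
  -- Exchanging the names of `b` and `c` turns `Γ^a_{bc}` into `Γ^a_{cb}`.
  have e2 : ∑ b, ∑ c, ∑ β : Fin (n + 1), (conn S a b c * mink β : ℂ) * (u b β y * du β c α y)
      = ∑ b, ∑ c, ∑ β : Fin (n + 1), (conn S a c b * mink β : ℂ) * (u c β y * du β b α y) :=
    Finset.sum_comm
  have e3 : ∑ b, ∑ c, ∑ β : Fin (n + 1), (-(conn S a b c * mink β) : ℂ) *
      (du α b β y * u c β y + u b β y * du α c β y)
      = -(∑ b, ∑ c, ∑ β : Fin (n + 1), (conn S a b c * mink β : ℂ) * (u c β y * du β b α y))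
        - ∑ b, ∑ c, ∑ β : Fin (n + 1), (conn S a b c * mink β : ℂ) * (u b β y * du β c α y)
        + ∑ b, ∑ c, ∑ β : Fin (n + 1), (conn S a b c * mink β : ℂ) *
          (u c β y * quadCurl S u b α β y)
        + ∑ b, ∑ c, ∑ β : Fin (n + 1), (conn S a b c * mink β : ℂ) *
          (u b β y * quadCurl S u c α β y) := by
    simp_rw [← hcurl, ← Finset.sum_neg_distrib, ← Finset.sum_sub_distrib, ← Finset.sum_add_distrib]
    refine Finset.sum_congr rfl fun b _ => Finset.sum_congr rfl fun c _ =>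
      Finset.sum_congr rfl fun β _ => ?_
    ring
  have e4 : ∑ b, ∑ c, ∑ β : Fin (n + 1), (S a b c * mink β : ℂ) * (u c β y * du β b α y)
      = ∑ b, ∑ c, ∑ β : Fin (n + 1), (conn S a b c * mink β : ℂ) * (u c β y * du β b α y)
        - ∑ b, ∑ c, ∑ β : Fin (n + 1), (conn S a c b * mink β : ℂ) * (u c β y * du β b α y) := by
    simp_rw [← Finset.sum_sub_distrib]
    refine Finset.sum_congr rfl fun b _ => Finset.sum_congr rfl fun c _ =>
      Finset.sum_congr rfl fun β _ => ?_
    rw [struct_eq_conn_sub S hS a b c]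
    push_cast
    ring
  have e5 : ∑ b, ∑ c, ∑ β : Fin (n + 1),
        (-(2 * conn S a c b * mink β) : ℂ) * (u c β y * du β b α y)
      = -2 * ∑ b, ∑ c, ∑ β : Fin (n + 1), (conn S a c b * mink β : ℂ) *
        (u c β y * du β b α y) := by
    simp_rw [Finset.mul_sum]
    refine Finset.sum_congr rfl fun b _ => Finset.sum_congr rfl fun c _ =>
      Finset.sum_congr rfl fun β _ => ?_
    ring
  unfold inhom
  rw [e1, e3, e2, e4, e5]
  ring

/-- A solution of the system at a fixed time, with majorants for its pieces. -/
structure Slice (S : Fin N → Fin N → Fin N → ℝ) (η : Sp n → ℝ) (p q : ℝ≥0∞) where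
  u : Fin N → Fin (n + 1) → Sp n → ℂ
  du : Fin (n + 1) → Fin N → Fin (n + 1) → Sp n → ℂ
  a : ℤ → ℝ≥0∞
  b : ℤ → ℝ≥0∞
  e : ℤ → ℝ≥0∞
  major : ∀ i α, Major η p q a b e (u i α)
  differentiable : ∀ i α, Differentiable ℝ (u i α)
  fderiv_eq : ∀ j i α x, fderiv ℝ (u i α) x (dir j) = du (Fin.succ j) i α x
  nice_du : ∀ μ i α, Nice (du μ i α)
  nice_mul : ∀ i α j β, Nice fun y => u i α y * u j β y
  curl : ∀ i α β y, du β i α y - du α i β y = quadCurl S u i α β y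
  div : ∀ i y, ∑ α, (mink α : ℂ) * du α i α y = quadDiv S u i y

variable {S : Fin N → Fin N → Fin N → ℝ} {p q : ℝ≥0∞}

lemma Slice.nice (D : Slice S η p q) (i : Fin N) (α : Fin (n + 1)) : Nice (D.u i α) :=
  (D.major i α).nice

/-- The quantity that dominates the error term. -/
def Slice.bound (D : Slice S η p q) : ℝ≥0∞ :=
  ∑' i, ∑' l, gSum D.a D.b i l + ∑' i, ∑' j, ∑' l, hSum D.a D.b D.e i j l

/-! ### Calculus of controlled expressions and pairings. -/

/-- Expressions dominated by `Slice.bound`, uniformly in the solution. -/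
def Controlled (G : Slice S η p q → Sp n → ℂ) : Prop :=
  ∃ κ : ℝ≥0, ∀ D, Continuous (G D) ∧ eLpNorm (G D) 2 volume ≤ κ * D.bound

lemma Controlled.of_le {G : Slice S η p q → Sp n → ℂ} {κ : ℝ≥0∞} (hκ : κ ≠ ⊤)
    (hc : ∀ D, Continuous (G D)) (h : ∀ D, eLpNorm (G D) 2 volume ≤ κ * D.bound) :
    Controlled G := by
  lift κ to ℝ≥0 using hκ
  exact ⟨κ, fun D => ⟨hc D, h D⟩⟩

lemma Controlled.add {G H : Slice S η p q → Sp n → ℂ} (hG : Controlled G) (hH : Controlled H) :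
    Controlled fun D x => G D x + H D x := by
  obtain ⟨κ, hκ⟩ := hG
  obtain ⟨κ', hκ'⟩ := hH
  refine ⟨κ + κ', fun D => ⟨(hκ D).1.add (hκ' D).1, ?_⟩⟩
  refine (eLpNorm_add_le (hκ D).1.aestronglyMeasurable (hκ' D).1.aestronglyMeasurable
    (by norm_num)).trans ?_
  push_cast
  rw [add_mul]
  exact add_le_add (hκ D).2 (hκ' D).2

lemma Controlled.const_mul {G : Slice S η p q → Sp n → ℂ} (hG : Controlled G) (c : ℂ) :
    Controlled fun D x => c * G D x := by
  obtain ⟨κ, hκ⟩ := hG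
  refine ⟨‖c‖₊ * κ, fun D => ⟨continuous_const.mul (hκ D).1, ?_⟩⟩
  have := eLpNorm_const_smul c (G D) 2 volume
  push_cast
  rw [mul_assoc]
  refine this.trans_le ?_
  rw [enorm_eq_nnnorm]
  gcongr
  exact (hκ D).2

lemma Controlled.sum {ι : Type} (s : Finset ι) {G : ι → Slice S η p q → Sp n → ℂ}
    (hG : ∀ i ∈ s, Controlled (G i)) : Controlled fun D x => ∑ i ∈ s, G i D x := by
  classical
  induction s using Finset.induction_on with
  | empty =>
    refine ⟨0, fun D => ⟨by simpa using! continuous_const, ?_⟩⟩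
    simp
  | insert i s his ih =>
    simp_rw [Finset.sum_insert his]
    exact (hG i (Finset.mem_insert_self i s)).add
      (ih fun j hj => hG j (Finset.mem_insert_of_mem hj))

/-- `P_0 (φ^c_β G) - z P_{≤ -10} φ^c_β P_0 G`. -/
def pairing (hη : IsBump η) (z : ℂ) (c : Fin N) (β : Fin (n + 1)) (G : Slice S η p q → Sp n → ℂ)
    (D : Slice S η p q) (x : Sp n) : ℂ :=
  cvl (kerP hη 0) (fun y => D.u c β y * G D y) x
    - z * (cvl (kerLE hη (-10)) (D.u c β) x * cvl (kerP hη 0) (G D) x)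

/-- Functions with a controlled pairing. -/
structure Pairs (hη : IsBump η) (z : ℂ) (c : Fin N) (β : Fin (n + 1))
    (G : Slice S η p q → Sp n → ℂ) : Prop where
  wint : ∀ D, WInt (G D)
  wint_mul : ∀ D, WInt fun y => D.u c β y * G D y
  controlled : Controlled (pairing hη z c β G)

variable {hη : IsBump η} {z : ℂ} {c : Fin N} {β : Fin (n + 1)}

lemma Pairs.add {G H : Slice S η p q → Sp n → ℂ} (hG : Pairs hη z c β G) (hH : Pairs hη z c β H) :
    Pairs hη z c β fun D y => G D y + H D y := by
  refine ⟨fun D => (hG.wint D).add (hH.wint D), fun D => ?_, ?_⟩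
  · simp_rw [mul_add]
    exact (hG.wint_mul D).add (hH.wint_mul D)
  · convert hG.controlled.add hH.controlled using 3 with D x
    unfold pairing
    simp_rw [mul_add]
    rw [cvl_add _ (hG.wint_mul D) (hH.wint_mul D), cvl_add _ (hG.wint D) (hH.wint D)]
    ring

lemma Pairs.const_mul {G : Slice S η p q → Sp n → ℂ} (hG : Pairs hη z c β G) (w : ℂ) :
    Pairs hη z c β fun D y => w * G D y := by
  refine ⟨fun D => (hG.wint D).const_mul w, fun D => ?_, ?_⟩
  · simp_rw [mul_left_comm _ w]
    exact (hG.wint_mul D).const_mul w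
  · convert hG.controlled.const_mul w using 3 with D x
    unfold pairing
    simp_rw [mul_left_comm _ w]
    rw [cvl_const_mul, cvl_const_mul]
    simp only [smul_eq_mul]
    ring

lemma WInt.zero : WInt fun _ : Sp n => (0 : ℂ) := by
  simpa using! WInt.sum (∅ : Finset ℕ) (f := fun _ _ => (0 : ℂ)) (by simp)

lemma Pairs.sum {ι : Type} (s : Finset ι) {G : ι → Slice S η p q → Sp n → ℂ}
    (hG : ∀ i ∈ s, Pairs hη z c β (G i)) : Pairs hη z c β fun D y => ∑ i ∈ s, G i D y := by
  classical
  induction s using Finset.induction_on with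
  | empty =>
    refine ⟨fun D => by simpa using! WInt.zero, fun D => by simpa using! WInt.zero, ?_⟩
    refine ⟨0, fun D => ?_⟩
    have : pairing hη z c β (fun D y => ∑ i ∈ ∅, G i D y) D = 0 := by
      funext x
      simp [pairing, cvl]
    rw [this]
    exact ⟨continuous_zero, by simp⟩
  | insert i s his ih =>
    simp_rw [Finset.sum_insert his]
    exact (hG i (Finset.mem_insert_self i s)).add
      (ih fun j hj => hG j (Finset.mem_insert_of_mem hj))

/-- For every `z` the pairing with a product is a combination of `triA` and `triB`. It is used with
`z = 0` for the cubic terms of `inhom_eq` and with `z = 1` for the quadratic terms that arise when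
time derivatives are eliminated. -/
lemma pairs_mul [NeZero n] [ENNReal.HolderTriple p q 2] (hp : 1 ≤ p) (hq : 1 ≤ q)
    (d e : Fin N) (γ δ : Fin (n + 1)) :
    Pairs hη z c β fun (D : Slice S η p q) y => D.u d γ y * D.u e δ y := by
  refine ⟨fun D => (D.nice d γ).wint_mul (D.nice e δ),
    fun D => (D.nice c β).wint_mul (D.nice_mul d γ e δ), ?_⟩
  have hA : Controlled fun (D : Slice S η p q) x => triA hη (D.u c β) (D.u d γ) (D.u e δ) x := by
    refine Controlled.of_le (κ := 6 * triC hη) (ENNReal.mul_ne_top (by norm_num) (triC_ne_top hη))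
      (fun D => continuous_cvl _ ((D.nice c β).wint_mul (D.nice_mul d γ e δ))) fun D => ?_
    refine (eLpNorm_triA_le hη hp hq (D.major c β) (D.major d γ) (D.major e δ)
      (D.nice_mul d γ e δ)).trans ?_
    gcongr
    exact le_add_self
  have hB : Controlled fun (D : Slice S η p q) x => triB hη (D.u c β) (D.u d γ) (D.u e δ) x := by
    refine Controlled.of_le (κ := 6 * triC hη) (ENNReal.mul_ne_top (by norm_num) (triC_ne_top hη))
      (fun D => ((D.nice c β).cvl _).1.mul ((D.nice_mul d γ e δ).cvl _).1) fun D => ?_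
    refine (eLpNorm_triB_le hη hp hq (D.major c β) (D.major d γ) (D.major e δ)).trans ?_
    gcongr
    exact le_add_self
  convert hA.add (hB.const_mul (-z)) using 3 with D x
  unfold pairing triA triB
  ring

lemma pairs_quadCurl [NeZero n] [ENNReal.HolderTriple p q 2] (hp : 1 ≤ p) (hq : 1 ≤ q)
    (b : Fin N) (α γ : Fin (n + 1)) :
    Pairs hη z c β fun (D : Slice S η p q) y => quadCurl S D.u b α γ y :=
  Pairs.sum _ fun d _ => Pairs.sum _ fun e _ => (pairs_mul hp hq d e α γ).const_mul _

lemma pairs_quadDiv [NeZero n] [ENNReal.HolderTriple p q 2] (hp : 1 ≤ p) (hq : 1 ≤ q)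
    (b : Fin N) : Pairs hη z c β fun (D : Slice S η p q) y => quadDiv S D.u b y :=
  Pairs.sum _ fun d _ => Pairs.sum _ fun e _ => Pairs.sum _ fun γ _ =>
    (pairs_mul hp hq d e γ γ).const_mul _

/-- With `z = 1` and a spatial derivative, moving the derivative onto the kernel in the second term
turns the pairing into the bilinear form `bil`. -/
lemma pairs_du_succ [NeZero n] [ENNReal.HolderTriple p q 2] (hp : 1 ≤ p) (hq : 1 ≤ q)
    (j : Fin n) (b : Fin N) (α : Fin (n + 1)) :
    Pairs hη 1 c β fun (D : Slice S η p q) y => D.du j.succ b α y := by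
  refine ⟨fun D => (D.nice_du _ _ _).wint, fun D => (D.nice c β).wint_mul (D.nice_du _ _ _), ?_⟩
  have e : ∀ D : Slice S η p q, (fun y => fderiv ℝ (D.u b α) y (dir j)) = D.du j.succ b α :=
    fun D => funext fun y => D.fderiv_eq j b α y
  have e' : ∀ D : Slice S η p q,
      pairing hη 1 c β (fun (D : Slice S η p q) y => D.du j.succ b α y) D
        = bil hη j (D.u c β) (fun y => fderiv ℝ (D.u b α) y (dir j)) (D.u b α) := fun D => by
    funext x
    have := cvl_fderiv (kerP hη 0) (dir j) (D.differentiable b α) (D.nice b α).wint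
      (by rw [e]; exact (D.nice_du _ _ _).wint) x
    unfold pairing bil
    rw [← this, e, one_mul]
  refine Controlled.of_le (κ := 2 * bilC hη) (ENNReal.mul_ne_top (by norm_num) (bilC_ne_top hη))
    (fun D => ?_) fun D => ?_
  · unfold pairing
    exact (continuous_cvl _ ((D.nice c β).wint_mul (D.nice_du _ _ _))).sub
      (continuous_const.mul (((D.nice c β).cvl _).1.mul ((D.nice_du _ _ _).cvl _).1))
  · rw [e' D]
    refine (eLpNorm_bil_le hη j hp hq (D.major c β) (D.major b α) (D.differentiable b α)
      (by rw [e]; exact D.nice_du _ _ _)).trans ?_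
    gcongr
    exact le_self_add

/-- Integration by parts is available in space only. The equations express `∂_t φ_0` by spatial
derivatives and `quadDiv`, and `∂_t φ_i` by `∂_i φ_0` and `quadCurl`; pairings are linear in `G`, so
these cases reduce to the spatial and the cubic one. -/
lemma pairs_du [NeZero n] [ENNReal.HolderTriple p q 2] (hp : 1 ≤ p) (hq : 1 ≤ q)
    (μ : Fin (n + 1)) (b : Fin N) (α : Fin (n + 1)) :
    Pairs hη 1 c β fun (D : Slice S η p q) y => D.du μ b α y := by
  refine Fin.cases ?_ (fun j => pairs_du_succ hp hq j b α) μ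
  refine Fin.cases ?_ (fun i => ?_) α
  · have h := (Pairs.sum (hη := hη) (c := c) (β := β) Finset.univ fun j (_ : j ∈ Finset.univ) =>
      pairs_du_succ (S := S) hp hq j b j.succ).add ((pairs_quadDiv hp hq b).const_mul (-1))
    convert h using 3 with D y
    have := D.div b y
    rw [Fin.sum_univ_succ] at this
    simp only [mink, Fin.succ_ne_zero, if_true, if_false] at this
    push_cast at this
    simp only [one_mul] at this
    rw [← this]
    ring
  · have h := (pairs_du_succ (S := S) (hη := hη) (c := c) (β := β) hp hq i b 0).add
      (pairs_quadCurl hp hq b i.succ 0)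
    convert h using 3 with D y
    have := D.curl b i.succ 0 y
    rw [← this]
    ring

lemma Pairs.pairing_zero {G : Slice S η p q → Sp n → ℂ} (hG : Pairs hη 0 c β G) :
    Controlled fun D x => cvl (kerP hη 0) (fun y => D.u c β y * G D y) x := by
  convert hG.controlled using 3 with D x
  simp [pairing]

/-- The error term is controlled. -/
theorem controlled_errF [NeZero n] [ENNReal.HolderTriple p q 2] (hp : 1 ≤ p) (hq : 1 ≤ q)
    (hη : IsBump η) (hS : ∀ a b c, S a b c = -S a c b) (a : Fin N) (α : Fin (n + 1)) :
    Controlled fun D : Slice S η p q => errF hη S D.u D.du a α := by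
  have h1 : ∀ b c β, Controlled fun (D : Slice S η p q) x =>
      (-(2 * conn S a c b * mink β) : ℂ) * pairing hη 1 c β (fun D => D.du β b α) D x :=
    fun b c β => (pairs_du hp hq β b α).controlled.const_mul _
  have h2 : ∀ b c β, Controlled fun (D : Slice S η p q) x => (conn S a b c * mink β : ℂ) *
      cvl (kerP hη 0) (fun y => D.u c β y * quadCurl S D.u b α β y) x :=
    fun b c β => (pairs_quadCurl hp hq b α β).pairing_zero.const_mul _
  have h3 : ∀ b c β, Controlled fun (D : Slice S η p q) x => (conn S a b c * mink β : ℂ) *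
      cvl (kerP hη 0) (fun y => D.u b β y * quadCurl S D.u c α β y) x :=
    fun b c β => (pairs_quadCurl hp hq c α β).pairing_zero.const_mul _
  have h4 : ∀ b c, Controlled fun (D : Slice S η p q) x => (S a b c : ℂ) *
      cvl (kerP hη 0) (fun y => D.u b α y * quadDiv S D.u c y) x :=
    fun b c => (pairs_quadDiv hp hq c).pairing_zero.const_mul _
  -- The four groups match the four sums of `inhom_eq`. The low-frequency term in `errF` completes
  -- each product in the first group to a pairing with `z = 1`.
  have H := (((Controlled.sum Finset.univ fun b _ => Controlled.sum Finset.univ fun c _ =>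
    Controlled.sum Finset.univ fun β _ => h1 b c β).add
    (Controlled.sum Finset.univ fun b _ => Controlled.sum Finset.univ fun c _ =>
    Controlled.sum Finset.univ fun β _ => h2 b c β)).add
    (Controlled.sum Finset.univ fun b _ => Controlled.sum Finset.univ fun c _ =>
    Controlled.sum Finset.univ fun β _ => h3 b c β)).add
    (Controlled.sum Finset.univ fun b _ => Controlled.sum Finset.univ fun c _ => h4 b c)
  convert H using 3 with D x
  have w1 : ∀ b c β, WInt fun y => (-(2 * conn S a c b * mink β) : ℂ) *
      (D.u c β y * D.du β b α y) :=
    fun b c β => ((D.nice c β).wint_mul (D.nice_du β b α)).const_mul _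
  have w2 : ∀ b c β, WInt fun y => (conn S a b c * mink β : ℂ) *
      (D.u c β y * quadCurl S D.u b α β y) :=
    fun b c β => ((pairs_quadCurl (hη := hη) (z := 0) hp hq b α β).wint_mul D).const_mul _
  have w3 : ∀ b c β, WInt fun y => (conn S a b c * mink β : ℂ) *
      (D.u b β y * quadCurl S D.u c α β y) :=
    fun b c β => ((pairs_quadCurl (hη := hη) (z := 0) hp hq c α β).wint_mul D).const_mul _
  have w4 : ∀ b c, WInt fun y => (S a b c : ℂ) * (D.u b α y * quadDiv S D.u c y) :=
    fun b c => ((pairs_quadDiv (hη := hη) (z := 0) hp hq c).wint_mul D).const_mul _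
  have W1 := WInt.sum Finset.univ fun b _ => WInt.sum Finset.univ fun c _ =>
    WInt.sum Finset.univ fun β _ => w1 b c β
  have W2 := WInt.sum Finset.univ fun b _ => WInt.sum Finset.univ fun c _ =>
    WInt.sum Finset.univ fun β _ => w2 b c β
  have W3 := WInt.sum Finset.univ fun b _ => WInt.sum Finset.univ fun c _ =>
    WInt.sum Finset.univ fun β _ => w3 b c β
  have W4 := WInt.sum Finset.univ fun b _ => WInt.sum Finset.univ fun c _ => w4 b c
  unfold errF
  rw [funext fun y => inhom_eq S hS (fun i α β => D.curl i α β y) (fun i => D.div i y) a α,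
    cvl_add _ ((W1.add W2).add W3) W4, cvl_add _ (W1.add W2) W3, cvl_add _ W1 W2]
  have s3 : ∀ (G : Fin N → Fin N → Fin (n + 1) → ℂ) (H : Fin N → Fin N → Fin (n + 1) → Sp n → ℂ),
      (∀ b c β, WInt fun y => G b c β * H b c β y) →
      cvl (kerP hη 0) (fun y => ∑ b, ∑ c, ∑ β, G b c β * H b c β y) x
        = ∑ b, ∑ c, ∑ β, G b c β * cvl (kerP hη 0) (H b c β) x := by
    intro G H hw
    rw [cvl_sum _ _ fun b _ => WInt.sum _ fun c _ => WInt.sum _ fun β _ => hw b c β]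
    refine Finset.sum_congr rfl fun b _ => ?_
    rw [cvl_sum _ _ fun c _ => WInt.sum _ fun β _ => hw b c β]
    refine Finset.sum_congr rfl fun c _ => ?_
    rw [cvl_sum _ _ fun β _ => hw b c β]
    exact Finset.sum_congr rfl fun β _ => cvl_const_mul _ _ _ _
  have s2 : cvl (kerP hη 0) (fun y => ∑ b, ∑ c, (S a b c : ℂ) * (D.u b α y * quadDiv S D.u c y)) x
      = ∑ b, ∑ c, (S a b c : ℂ) * cvl (kerP hη 0) (fun y => D.u b α y * quadDiv S D.u c y) x := by
    rw [cvl_sum _ _ fun b _ => WInt.sum _ fun c _ => w4 b c]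
    refine Finset.sum_congr rfl fun b _ => ?_
    rw [cvl_sum _ _ fun c _ => w4 b c]
    exact Finset.sum_congr rfl fun c _ => cvl_const_mul _ _ _ _
  rw [s3 _ _ w1, s3 _ _ w2, s3 _ _ w3, s2]
  have s1 : ∑ b, ∑ c, ∑ β, (-(2 * conn S a c b * mink β) : ℂ) *
        pairing hη 1 c β (fun D => D.du β b α) D x
      = ∑ b, ∑ c, ∑ β, (-(2 * conn S a c b * mink β) : ℂ) *
          cvl (kerP hη 0) (fun y => D.u c β y * D.du β b α y) x
        + ∑ b, ∑ c, ∑ β, (2 * conn S a c b * mink β : ℂ) *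
          (cvl (kerLE hη (-10)) (D.u c β) x * cvl (kerP hη 0) (D.du β b α) x) := by
    simp_rw [← Finset.sum_add_distrib]
    refine Finset.sum_congr rfl fun b _ => Finset.sum_congr rfl fun c _ =>
      Finset.sum_congr rfl fun β _ => ?_
    unfold pairing
    ring
  rw [s1]
  ring

end ErrorTerm

/-! ### Partial derivatives -/

section Partial

variable {V W : Type} [NormedAddCommGroup V] [NormedSpace ℝ V] [NormedAddCommGroup W]
  [NormedSpace ℝ W] {f : ℝ → Sp n → V} {t T : ℝ} {x : Sp n}

/-- The coordinate directions of space-time. -/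
def bas (μ : Fin (n + 1)) : ℝ × Sp n := Fin.cases (1, 0) (fun j => (0, dir j)) μ

lemma pd_zero (f : ℝ → Sp n → V) (t : ℝ) (x : Sp n) : pd 0 f t x = deriv (fun s => f s x) t := rfl

lemma pd_succ (f : ℝ → Sp n → V) (j : Fin n) (t : ℝ) (x : Sp n) :
    pd j.succ f t x = deriv (fun h : ℝ => f t (x + h • dir j)) 0 := rfl

lemma hasFDerivAt_slice {A : ℝ × Sp n →L[ℝ] V} (h : HasFDerivAt (Function.uncurry f) A (t, x)) :
    HasFDerivAt (f t) (A.comp (ContinuousLinearMap.inr ℝ ℝ (Sp n))) x :=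
  HasFDerivAt.comp x h (hasFDerivAt_prodMk_right t x)

lemma hasDerivAt_slice_time {A : ℝ × Sp n →L[ℝ] V}
    (h : HasFDerivAt (Function.uncurry f) A (t, x)) : HasDerivAt (fun s => f s x) (A (1, 0)) t := by
  have := HasFDerivAt.comp (f := fun s => (s, x)) t h (hasFDerivAt_prodMk_left t x)
  simpa using! this.hasDerivAt

lemma pd_succ_eq (h : DifferentiableAt ℝ (f t) x) (j : Fin n) :
    pd j.succ f t x = fderiv ℝ (f t) x (dir j) := by
  rw [pd_succ]
  exact h.hasFDerivAt.hasLineDerivAt (dir j) |>.deriv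

lemma pd_eq_fderiv (h : DifferentiableAt ℝ (Function.uncurry f) (t, x)) (μ : Fin (n + 1)) :
    pd μ f t x = fderiv ℝ (Function.uncurry f) (t, x) (bas μ) := by
  refine Fin.cases ?_ (fun j => ?_) μ
  · exact (hasDerivAt_slice_time h.hasFDerivAt).deriv
  · have h1 := hasFDerivAt_slice h.hasFDerivAt
    rw [pd_succ_eq h1.differentiableAt, h1.fderiv]
    rfl

lemma pd_clm (L : V →L[ℝ] W) (h : DifferentiableAt ℝ (Function.uncurry f) (t, x))
    (μ : Fin (n + 1)) : pd μ (fun s y => L (f s y)) t x = L (pd μ f t x) := by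
  have h1 : HasFDerivAt (Function.uncurry fun s y => L (f s y))
      (L.comp (fderiv ℝ (Function.uncurry f) (t, x))) (t, x) := L.hasFDerivAt.comp _ h.hasFDerivAt
  rw [pd_eq_fderiv h, pd_eq_fderiv h1.differentiableAt, h1.fderiv]
  rfl

lemma isOpen_slab (T : ℝ) : IsOpen (Ioo 0 T ×ˢ (univ : Set (Sp n))) := isOpen_Ioo.prod isOpen_univ

lemma contDiffAt_slab {m : WithTop ℕ∞} (h : ContDiffOn ℝ m (Function.uncurry f) (Ioo 0 T ×ˢ univ))
    (ht : t ∈ Ioo 0 T) (x : Sp n) : ContDiffAt ℝ m (Function.uncurry f) (t, x) :=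
  h.contDiffAt ((isOpen_slab T).mem_nhds ⟨ht, mem_univ _⟩)

lemma differentiableAt_slab (h : ContDiffOn ℝ 1 (Function.uncurry f) (Ioo 0 T ×ˢ univ))
    (ht : t ∈ Ioo 0 T) (x : Sp n) : DifferentiableAt ℝ (Function.uncurry f) (t, x) :=
  (contDiffAt_slab h ht x).differentiableAt one_ne_zero

lemma hasDerivAt_pd_zero (h : ContDiffOn ℝ 1 (Function.uncurry f) (Ioo 0 T ×ˢ univ))
    (ht : t ∈ Ioo 0 T) (x : Sp n) : HasDerivAt (fun s => f s x) (pd 0 f t x) t :=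
  (hasDerivAt_slice_time (differentiableAt_slab h ht x).hasFDerivAt).differentiableAt.hasDerivAt

lemma differentiable_slice (h : ContDiffOn ℝ 1 (Function.uncurry f) (Ioo 0 T ×ˢ univ))
    (ht : t ∈ Ioo 0 T) : Differentiable ℝ (f t) := fun x =>
  (hasFDerivAt_slice (differentiableAt_slab h ht x).hasFDerivAt).differentiableAt

lemma contDiffOn_pd {m : ℕ} (h : ContDiffOn ℝ (m + 1) (Function.uncurry f) (Ioo 0 T ×ˢ univ))
    (μ : Fin (n + 1)) : ContDiffOn ℝ m (Function.uncurry (pd μ f)) (Ioo 0 T ×ˢ univ) := by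
  have h1 := (h.fderiv_of_isOpen (isOpen_slab T) (m := m) le_rfl).clm_apply
    (contDiffOn_const (c := bas μ))
  refine h1.congr fun z hz => ?_
  obtain ⟨t, x⟩ := z
  exact pd_eq_fderiv (differentiableAt_slab (h.of_le (by simp)) hz.1 x) μ

lemma pd_congr {g : ℝ → Sp n → V} (h : ∀ s ∈ Ioo 0 T, ∀ y, f s y = g s y) (ht : t ∈ Ioo 0 T)
    (x : Sp n) (μ : Fin (n + 1)) : pd μ f t x = pd μ g t x := by
  refine Fin.cases ?_ (fun j => ?_) μ
  · rw [pd_zero, pd_zero]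
    refine Filter.EventuallyEq.deriv_eq ?_
    filter_upwards [isOpen_Ioo.mem_nhds ht] with s hs using h s hs x
  · rw [pd_succ, pd_succ]
    congr 1
    funext s
    exact h t ht _

/-- Partial derivatives of `C²` functions commute. -/
lemma pd_comm (h : ContDiffOn ℝ 2 (Function.uncurry f) (Ioo 0 T ×ˢ univ)) (ht : t ∈ Ioo 0 T)
    (x : Sp n) (μ ν : Fin (n + 1)) : pd μ (pd ν f) t x = pd ν (pd μ f) t x := by
  have hd : ∀ s ∈ Ioo 0 T, ∀ y, DifferentiableAt ℝ (Function.uncurry f) (s, y) := fun s hs y =>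
    differentiableAt_slab (h.of_le (by norm_num)) hs y
  have hdd : DifferentiableAt ℝ (fderiv ℝ (Function.uncurry f)) (t, x) :=
    ((contDiffAt_slab h ht x).fderiv_right (m := 1) (by norm_num)).differentiableAt one_ne_zero
  have key : ∀ μ ν : Fin (n + 1), pd μ (pd ν f) t x
      = fderiv ℝ (fderiv ℝ (Function.uncurry f)) (t, x) (bas μ) (bas ν) := by
    intro μ ν
    have h1 : HasFDerivAt (Function.uncurry fun s y => fderiv ℝ (Function.uncurry f) (s, y) (bas ν))
        ((ContinuousLinearMap.apply ℝ V (bas ν)).comp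
          (fderiv ℝ (fderiv ℝ (Function.uncurry f)) (t, x))) (t, x) :=
      (ContinuousLinearMap.apply ℝ V (bas ν)).hasFDerivAt.comp (t, x) hdd.hasFDerivAt
    rw [pd_congr (fun s hs y => pd_eq_fderiv (hd s hs y) ν) ht x μ,
      pd_eq_fderiv h1.differentiableAt, h1.fderiv]
    rfl
  rw [key, key]
  exact (contDiffAt_slab h ht x).isSymmSndFDerivAt (by simp) _ _

lemma pd_add {g : ℝ → Sp n → V} (hf : ContDiffOn ℝ 1 (Function.uncurry f) (Ioo 0 T ×ˢ univ))
    (hg : ContDiffOn ℝ 1 (Function.uncurry g) (Ioo 0 T ×ˢ univ)) (ht : t ∈ Ioo 0 T) (x : Sp n)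
    (μ : Fin (n + 1)) : pd μ (fun s y => f s y + g s y) t x = pd μ f t x + pd μ g t x := by
  have h1 := (differentiableAt_slab hf ht x).hasFDerivAt
  have h2 := (differentiableAt_slab hg ht x).hasFDerivAt
  have h3 : HasFDerivAt (Function.uncurry fun s y => f s y + g s y) _ (t, x) := h1.add h2
  rw [pd_eq_fderiv h1.differentiableAt, pd_eq_fderiv h2.differentiableAt,
    pd_eq_fderiv h3.differentiableAt, h3.fderiv]
  rfl

lemma pd_const_mul {f : ℝ → Sp n → ℂ} (c : ℂ)
    (hf : ContDiffOn ℝ 1 (Function.uncurry f) (Ioo 0 T ×ˢ univ)) (ht : t ∈ Ioo 0 T) (x : Sp n)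
    (μ : Fin (n + 1)) : pd μ (fun s y => c * f s y) t x = c * pd μ f t x :=
  pd_clm (ContinuousLinearMap.mul ℝ ℂ c) (differentiableAt_slab hf ht x) μ

lemma pd_sum {ι : Type} (s : Finset ι) {f : ι → ℝ → Sp n → V}
    (hf : ∀ i ∈ s, ContDiffOn ℝ 1 (Function.uncurry (f i)) (Ioo 0 T ×ˢ univ)) (ht : t ∈ Ioo 0 T)
    (x : Sp n) (μ : Fin (n + 1)) :
    pd μ (fun s' y => ∑ i ∈ s, f i s' y) t x = ∑ i ∈ s, pd μ (f i) t x := by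
  have h1 : ∀ i ∈ s, HasFDerivAt (Function.uncurry (f i)) _ (t, x) := fun i hi =>
    (differentiableAt_slab (hf i hi) ht x).hasFDerivAt
  have h2 := HasFDerivAt.fun_sum h1
  have h3 : HasFDerivAt (Function.uncurry fun s' y => ∑ i ∈ s, f i s' y) _ (t, x) := h2
  rw [pd_eq_fderiv h3.differentiableAt, h3.fderiv, sum_apply]
  exact Finset.sum_congr rfl fun i hi => (pd_eq_fderiv (h1 i hi).differentiableAt μ).symm

lemma pd_mul {f g : ℝ → Sp n → ℂ} (hf : ContDiffOn ℝ 1 (Function.uncurry f) (Ioo 0 T ×ˢ univ))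
    (hg : ContDiffOn ℝ 1 (Function.uncurry g) (Ioo 0 T ×ˢ univ)) (ht : t ∈ Ioo 0 T) (x : Sp n)
    (μ : Fin (n + 1)) :
    pd μ (fun s y => f s y * g s y) t x = pd μ f t x * g t x + f t x * pd μ g t x := by
  have h1 := (differentiableAt_slab hf ht x).hasFDerivAt
  have h2 := (differentiableAt_slab hg ht x).hasFDerivAt
  have h3 : HasFDerivAt (Function.uncurry fun s y => f s y * g s y) _ (t, x) := h1.mul h2
  rw [pd_eq_fderiv h1.differentiableAt, pd_eq_fderiv h2.differentiableAt,
    pd_eq_fderiv h3.differentiableAt, h3.fderiv]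
  simp [Function.uncurry]
  ring

end Partial

/-! ### Consequences of the bootstrap assumption -/

section Boot

variable {N : ℕ} {Φ : ℝ → Sp n → Arr N n ℝ} {T C : ℝ} {c : ℤ → ℝ}

/-- A component of an array, as a complex function. -/
def cpt (Φ : ℝ → Sp n → Arr N n ℝ) (a : Fin N) (α : Fin (n + 1)) (t : ℝ) (x : Sp n) : ℂ := Φ t x a α

lemma norm_arr_apply_le {𝕜 : Type} [NormedAddCommGroup 𝕜] (v : Arr N n 𝕜) (a : Fin N)
    (α : Fin (n + 1)) : ‖v a α‖ ≤ ‖v‖ := (norm_le_pi_norm (v a) α).trans (norm_le_pi_norm v a)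

lemma eLpNorm_cpt_le (t : ℝ) (a : Fin N) (α : Fin (n + 1)) (p : ℝ≥0∞) :
    eLpNorm (cpt Φ a α t) p volume ≤ eLpNorm (Φ t) p volume :=
  eLpNorm_mono fun x => by
    rw [cpt, Complex.norm_real]
    exact norm_arr_apply_le (Φ t x) a α

lemma eLpNorm_proj_cpt_le (k : ℤ) (t : ℝ) (a : Fin N) (α : Fin (n + 1)) (p : ℝ≥0∞) :
    eLpNorm (proj η k (cpt Φ a α t)) p volume ≤ eLpNorm (projArr η k Φ t) p volume :=
  eLpNorm_mono fun x => norm_arr_apply_le (projArr η k Φ t x) a α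

/-- A single pair of exponents and the undifferentiated term are kept from the supremum, and the
dyadic weight is inverted. -/
lemma Bootstrap.mixedNorm_le (h : Bootstrap η T C c Φ) {q r : ℝ≥0∞} (hqr : Admissible n q r)
    (k : ℤ) : mixedNorm T q r (projArr η k Φ) ≤ ENNReal.ofReal (2 * C * c k) *
      ENNReal.ofReal ((2 : ℝ) ^ (-(k : ℝ) * (q⁻¹.toReal + n * r⁻¹.toReal - 1))) := by
  have h1 := (le_iSup_of_le q (le_iSup_of_le r (le_iSup_of_le hqr le_rfl))).trans (h k)
  set s := q⁻¹.toReal + n * r⁻¹.toReal - 1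
  have h2 := (mul_le_mul_right (le_self_add) (ENNReal.ofReal ((2 : ℝ) ^ ((k : ℝ) * s)))).trans h1
  have e : ENNReal.ofReal ((2 : ℝ) ^ ((k : ℝ) * s)) * ENNReal.ofReal ((2 : ℝ) ^ (-(k : ℝ) * s)) = 1 := by
    rw [← ofReal_two_rpow_add]
    simp
  calc mixedNorm T q r (projArr η k Φ)
      = ENNReal.ofReal ((2 : ℝ) ^ ((k : ℝ) * s)) * mixedNorm T q r (projArr η k Φ)
        * ENNReal.ofReal ((2 : ℝ) ^ (-(k : ℝ) * s)) := by
        rw [mul_right_comm, e, one_mul]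
    _ ≤ _ := by gcongr

lemma admissible_top {r : ℝ≥0∞} (hn : 5 ≤ n) (hr : 2 ≤ r) : Admissible n ⊤ r := by
  have hn' : (5 : ℝ) ≤ n := by exact_mod_cast hn
  refine ⟨le_top, hr, ?_⟩
  have h1 : r⁻¹.toReal ≤ 1 / 2 := by
    have := ENNReal.toReal_mono (by simp) (ENNReal.inv_le_inv.2 hr)
    simpa using this
  simp only [ENNReal.inv_top, ENNReal.toReal_zero, zero_add]
  nlinarith

lemma Bootstrap.ae_le (h : Bootstrap η T C c Φ) (hn : 5 ≤ n) {r : ℝ≥0∞} (hr : 2 ≤ r) (k : ℤ) :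
    ∀ᵐ t ∂volume.restrict (Icc 0 T), eLpNorm (projArr η k Φ t) r volume
      ≤ ENNReal.ofReal (2 * C * c k) *
        ENNReal.ofReal ((2 : ℝ) ^ (-(k : ℝ) * (n * r⁻¹.toReal - 1))) := by
  have h1 := h.mixedNorm_le (admissible_top hn hr) k
  simp only [ENNReal.inv_top, ENNReal.toReal_zero, zero_add] at h1
  rw [mixedNorm, eLpNorm_exponent_top] at h1
  filter_upwards [ae_le_eLpNormEssSup (f := fun t => eLpNorm (projArr η k Φ t) r volume)
    (μ := volume.restrict (Icc 0 T))] with t ht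
  exact ht.trans h1

lemma continuousOn_cpt (hΦ : ContinuousOn (Function.uncurry Φ) (Ioo 0 T ×ˢ univ)) (a : Fin N)
    (α : Fin (n + 1)) : ContinuousOn (Function.uncurry (cpt Φ a α)) (Ioo 0 T ×ˢ univ) :=
  Complex.continuous_ofReal.comp_continuousOn
    ((continuous_apply α).comp_continuousOn ((continuous_apply a).comp_continuousOn hΦ))

lemma sliceBdd_cpt (hΦ : ContinuousOn (Function.uncurry Φ) (Ioo 0 T ×ˢ univ)) {M : ℝ≥0}
    (hM : ∀ t ∈ Ioo 0 T, eLpNorm (Φ t) 2 volume ≤ M) (a : Fin N) (α : Fin (n + 1)) :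
    SliceBdd T (cpt Φ a α) :=
  SliceBdd.of_eLpNorm_two (continuousOn_cpt hΦ a α)
    fun t ht => (eLpNorm_cpt_le t a α 2).trans (hM t ht)

lemma nice_cpt (hΦ : ContinuousOn (Function.uncurry Φ) (Ioo 0 T ×ˢ univ)) {M : ℝ≥0}
    (hM : ∀ t ∈ Ioo 0 T, eLpNorm (Φ t) 2 volume ≤ M) (a : Fin N) (α : Fin (n + 1)) {t : ℝ}
    (ht : t ∈ Ioo 0 T) : Nice (cpt Φ a α t) := by
  have hc := continuous_slice (continuousOn_cpt hΦ a α) ht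
  exact ⟨hc, hc.aestronglyMeasurable,
    ((eLpNorm_cpt_le t a α 2).trans (hM t ht)).trans_lt ENNReal.coe_lt_top⟩

lemma continuousOn_proj_cpt (hη : IsBump η)
    (hΦ : ContinuousOn (Function.uncurry Φ) (Ioo 0 T ×ˢ univ)) {M : ℝ≥0}
    (hM : ∀ t ∈ Ioo 0 T, eLpNorm (Φ t) 2 volume ≤ M) (k : ℤ) (a : Fin N) (α : Fin (n + 1)) :
    ContinuousOn (Function.uncurry fun t => proj η k (cpt Φ a α t)) (Ioo 0 T ×ˢ univ) :=
  (continuousOn_cvl (kerP hη k) (sliceBdd_cpt hΦ hM a α)).congr fun z hz =>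
    proj_eq_cvl hη k (nice_cpt hΦ hM a α hz.1).2 z.2

/-- The bounds for the pieces hold at all times, not only almost everywhere. -/
lemma Bootstrap.le (h : Bootstrap η T C c Φ) (hη : IsBump η) (hn : 5 ≤ n)
    (hΦ : ContinuousOn (Function.uncurry Φ) (Ioo 0 T ×ˢ univ)) {M : ℝ≥0}
    (hM : ∀ t ∈ Ioo 0 T, eLpNorm (Φ t) 2 volume ≤ M) {r : ℝ≥0∞} (hr : 2 ≤ r) (k : ℤ)
    (a : Fin N) (α : Fin (n + 1)) {t : ℝ} (ht : t ∈ Ioo 0 T) :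
    eLpNorm (proj η k (cpt Φ a α t)) r volume ≤ ENNReal.ofReal (2 * C * c k) *
        ENNReal.ofReal ((2 : ℝ) ^ (-(k : ℝ) * (n * r⁻¹.toReal - 1))) := by
  have h1 := h.ae_le hn hr k
  rw [ae_restrict_iff' measurableSet_Icc] at h1
  set G := {s : ℝ | s ∈ Icc 0 T → eLpNorm (projArr η k Φ s) r volume
      ≤ ENNReal.ofReal (2 * C * c k) *
        ENNReal.ofReal ((2 : ℝ) ^ (-(k : ℝ) * (n * r⁻¹.toReal - 1)))}
  -- Times at which the bound holds are dense, and the pieces are continuous in time at each `x`, so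
  -- Fatou's lemma along good times approaching `t` gives the bound at `t`.
  have hcl : t ∈ closure (Ioo 0 T ∩ G) :=
    (Measure.dense_of_ae h1).open_subset_closure_inter isOpen_Ioo ht
  have : (𝓝[Ioo 0 T ∩ G] t).NeBot := mem_closure_iff_nhdsWithin_neBot.1 hcl
  have hcont := continuousOn_proj_cpt hη hΦ hM k a α
  refine Lp.eLpNorm_le_of_ae_tendsto (u := 𝓝[Ioo 0 T ∩ G] t)
    (f := fun s => indicator (Ioo 0 T) (fun s => proj η k (cpt Φ a α s)) s) ?_ (fun s => ?_)
    (Eventually.of_forall fun x => ?_)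
  · filter_upwards [self_mem_nhdsWithin] with s hs
    rw [indicator_of_mem hs.1]
    exact (eLpNorm_proj_cpt_le k s a α r).trans (hs.2 (Ioo_subset_Icc_self hs.1))
  · by_cases hs : s ∈ Ioo 0 T
    · rw [indicator_of_mem hs]
      exact (continuous_slice hcont hs).aestronglyMeasurable
    · rw [indicator_of_notMem hs]
      exact aestronglyMeasurable_zero
  · have h2 : ContinuousAt (fun s => proj η k (cpt Φ a α s) x) t :=
      (hcont.continuousAt ((isOpen_slab T).mem_nhds ⟨ht, mem_univ x⟩)).comp
        (f := fun s => (s, x)) (by fun_prop)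
    refine (h2.tendsto.mono_left nhdsWithin_le_nhds).congr' ?_
    filter_upwards [self_mem_nhdsWithin] with s hs
    rw [indicator_of_mem hs.1]

lemma Bootstrap.pieceBounds (h : Bootstrap η T C c Φ) (hη : IsBump η) (hn : 5 ≤ n)
    (hΦ : ContinuousOn (Function.uncurry Φ) (Ioo 0 T ×ˢ univ)) {M : ℝ≥0}
    (hM : ∀ t ∈ Ioo 0 T, eLpNorm (Φ t) 2 volume ≤ M) {b : ℝ} (hC : 0 ≤ C) (hb : ∀ k, c k ≤ b)
    (a : Fin N) (α : Fin (n + 1)) {t : ℝ} (ht : t ∈ Ioo 0 T) :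
    PieceBounds η (M + (2 * C * b).toNNReal) (cpt Φ a α t) := by
  have hB : ∀ k, ENNReal.ofReal (2 * C * c k) ≤ ((M + (2 * C * b).toNNReal : ℝ≥0) : ℝ≥0∞) :=
    fun k => by
      push_cast
      refine le_trans ?_ le_add_self
      exact ENNReal.ofReal_le_ofReal (by gcongr; exact hb k)
  refine ⟨nice_cpt hΦ hM a α ht, ?_, fun k => ?_, fun k => ?_, fun k => ?_⟩
  · refine ((eLpNorm_cpt_le t a α 2).trans (hM t ht)).trans ?_
    push_cast
    exact le_self_add
  · refine (h.le hη hn hΦ hM le_rfl k a α ht).trans (mul_le_mul' (hB k) (le_of_eq ?_))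
    simp only [ENNReal.toReal_inv, ENNReal.toReal_ofNat]
    ring_nf
  · refine (h.le hη hn hΦ hM (by norm_num) k a α ht).trans (mul_le_mul' (hB k) (le_of_eq ?_))
    simp only [ENNReal.toReal_inv, ENNReal.toReal_ofNat]
    ring_nf
  · refine (h.le hη hn hΦ hM le_top k a α ht).trans (mul_le_mul' (hB k) (le_of_eq ?_))
    rw [dy_eq_rpow]
    simp

end Boot

/-! ### Uniform bounds in time -/

/-- Continuous functions on `(0, T) × ℝⁿ` whose time slices are bounded in `L^p`. -/
def UB (T : ℝ) (p : ℝ≥0∞) (f : ℝ → Sp n → ℂ) : Prop :=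
  ContinuousOn (Function.uncurry f) (Ioo 0 T ×ˢ univ) ∧
    ∃ M : ℝ≥0, ∀ t ∈ Ioo 0 T, eLpNorm (f t) p volume ≤ M

section UniformBounds

variable {T : ℝ} {p : ℝ≥0∞} {f g : ℝ → Sp n → ℂ}

lemma UB.continuous (hf : UB T p f) {t : ℝ} (ht : t ∈ Ioo 0 T) : Continuous (f t) :=
  continuous_slice hf.1 ht

lemma UB.of_le {M : ℝ≥0∞} (hM : M ≠ ⊤)
    (hc : ContinuousOn (Function.uncurry f) (Ioo 0 T ×ˢ univ))
    (h : ∀ t ∈ Ioo 0 T, eLpNorm (f t) p volume ≤ M) : UB T p f := by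
  lift M to ℝ≥0 using hM
  exact ⟨hc, M, h⟩

lemma UB.add (hp : 1 ≤ p) (hf : UB T p f) (hg : UB T p g) : UB T p fun t x => f t x + g t x := by
  obtain ⟨M, hM⟩ := hf.2
  obtain ⟨M', hM'⟩ := hg.2
  refine ⟨hf.1.add hg.1, M + M', fun t ht => ?_⟩
  push_cast
  exact (eLpNorm_add_le (hf.continuous ht).aestronglyMeasurable
    (hg.continuous ht).aestronglyMeasurable hp).trans (add_le_add (hM t ht) (hM' t ht))

lemma UB.const_mul (hf : UB T p f) (c : ℂ) : UB T p fun t x => c * f t x := by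
  obtain ⟨M, hM⟩ := hf.2
  refine ⟨continuousOn_const.mul hf.1, ‖c‖₊ * M, fun t ht => ?_⟩
  refine (eLpNorm_const_smul c (f t) p volume).trans_le ?_
  push_cast
  rw [enorm_eq_nnnorm]
  gcongr
  exact hM t ht

lemma UB.sum {ι : Type} (hp : 1 ≤ p) (s : Finset ι) {f : ι → ℝ → Sp n → ℂ}
    (hf : ∀ i ∈ s, UB T p (f i)) : UB T p fun t x => ∑ i ∈ s, f i t x := by
  classical
  induction s using Finset.induction_on with
  | empty =>
    refine ⟨by simpa using! continuousOn_const, 0, fun t _ => ?_⟩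
    simp
  | insert i s his ih =>
    simp_rw [Finset.sum_insert his]
    exact (hf i (Finset.mem_insert_self i s)).add hp
      (ih fun j hj => hf j (Finset.mem_insert_of_mem hj))

lemma UB.mul {q r : ℝ≥0∞} [ENNReal.HolderTriple p q r] (hf : UB T p f) (hg : UB T q g) :
    UB T r fun t x => f t x * g t x := by
  obtain ⟨M, hM⟩ := hf.2
  obtain ⟨M', hM'⟩ := hg.2
  refine ⟨hf.1.mul hg.1, M * M', fun t ht => ?_⟩
  push_cast
  exact (eLpNorm_mul_le (hf.continuous ht) (hg.continuous ht) p q r).trans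
    (mul_le_mul' (hM t ht) (hM' t ht))

lemma UB.nice (hf : UB T 2 f) {t : ℝ} (ht : t ∈ Ioo 0 T) : Nice (f t) := by
  obtain ⟨M, hM⟩ := hf.2
  exact ⟨hf.continuous ht, (hf.continuous ht).aestronglyMeasurable,
    (hM t ht).trans_lt ENNReal.coe_lt_top⟩

lemma UB.sliceBdd_one (hf : UB T 1 f) : SliceBdd T f := by
  obtain ⟨M, hM⟩ := hf.2
  exact SliceBdd.of_eLpNorm_one hf.1 hM

lemma UB.sliceBdd_two (hf : UB T 2 f) : SliceBdd T f := by
  obtain ⟨M, hM⟩ := hf.2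
  exact SliceBdd.of_eLpNorm_two hf.1 hM

lemma UB.congr (hf : UB T p f) (h : ∀ t ∈ Ioo 0 T, ∀ x, g t x = f t x) : UB T p g := by
  obtain ⟨M, hM⟩ := hf.2
  refine ⟨hf.1.congr fun z hz => h z.1 hz.1 z.2, M, fun t ht => ?_⟩
  rw [funext (h t ht)]
  exact hM t ht

end UniformBounds

/-! ### Solutions -/

section Solution

variable {N : ℕ} {S : Fin N → Fin N → Fin N → ℝ} {T : ℝ}
  {u : Fin N → Fin (n + 1) → ℝ → Sp n → ℂ}

instance : ENNReal.HolderTriple 4 4 2 where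
  inv_add_inv_eq_inv := by
    rw [← two_mul, ← ENNReal.toReal_eq_toReal_iff' (by finiteness) (by finiteness)]
    simp
    norm_num

/-- Solutions of the system, as complex functions with uniform bounds. -/
structure Sol (S : Fin N → Fin N → Fin N → ℝ) (T : ℝ)
    (u : Fin N → Fin (n + 1) → ℝ → Sp n → ℂ) : Prop where
  smooth : ∀ a α, ContDiffOn ℝ 2 (Function.uncurry (u a α)) (Ioo 0 T ×ˢ univ)
  curl : ∀ t ∈ Ioo 0 T, ∀ x a α β,
    pd β (u a α) t x - pd α (u a β) t x = quadCurl S (fun i γ => u i γ t) a α β x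
  div : ∀ t ∈ Ioo 0 T, ∀ x a,
    ∑ α, (mink α : ℂ) * pd α (u a α) t x = quadDiv S (fun i γ => u i γ t) a x
  ub_two : ∀ a α, UB T 2 (u a α)
  ub_four : ∀ a α, UB T 4 (u a α)
  ub_pd_succ : ∀ j a α, UB T 2 (pd (Fin.succ j) (u a α))

namespace Sol

lemma smooth_one (h : Sol S T u) (a : Fin N) (α : Fin (n + 1)) :
    ContDiffOn ℝ 1 (Function.uncurry (u a α)) (Ioo 0 T ×ˢ univ) :=
  (h.smooth a α).of_le (by norm_num)

lemma ub_mul (h : Sol S T u) (b c : Fin N) (β γ : Fin (n + 1)) :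
    UB T 2 fun t x => u b β t x * u c γ t x := (h.ub_four b β).mul (h.ub_four c γ)

lemma ub_quadCurl (h : Sol S T u) (a : Fin N) (α β : Fin (n + 1)) :
    UB T 2 fun t => quadCurl S (fun i γ => u i γ t) a α β :=
  UB.sum (by norm_num) _ fun b _ => UB.sum (by norm_num) _ fun c _ =>
    (h.ub_mul b c α β).const_mul _

lemma ub_quadDiv (h : Sol S T u) (a : Fin N) :
    UB T 2 fun t => quadDiv S (fun i γ => u i γ t) a :=
  UB.sum (by norm_num) _ fun b _ => UB.sum (by norm_num) _ fun c _ =>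
    UB.sum (by norm_num) _ fun β _ => (h.ub_mul b c β β).const_mul _

lemma pd_zero_zero (h : Sol S T u) (a : Fin N) {t : ℝ} (ht : t ∈ Ioo 0 T) (x : Sp n) :
    pd 0 (u a 0) t x = ∑ j : Fin n, pd j.succ (u a j.succ) t x
      + (-1) * quadDiv S (fun i γ => u i γ t) a x := by
  have := h.div t ht x a
  rw [Fin.sum_univ_succ] at this
  simp only [mink, Fin.succ_ne_zero, if_true, if_false] at this
  push_cast at this
  simp only [one_mul] at this
  rw [← this]
  ring

lemma pd_zero_succ (h : Sol S T u) (a : Fin N) (i : Fin n) {t : ℝ} (ht : t ∈ Ioo 0 T) (x : Sp n) :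
    pd 0 (u a i.succ) t x = pd i.succ (u a 0) t x
      + quadCurl S (fun i γ => u i γ t) a i.succ 0 x := by
  rw [← h.curl t ht x a i.succ 0]
  ring

/-- The equations solve for the time derivatives; their quadratic terms are in `L²` because the
components are in `L⁴`. -/
lemma ub_pd (h : Sol S T u) (μ : Fin (n + 1)) (a : Fin N) (α : Fin (n + 1)) :
    UB T 2 (pd μ (u a α)) := by
  refine Fin.cases ?_ (fun j => h.ub_pd_succ j a α) μ
  refine Fin.cases ?_ (fun i => ?_) α
  · exact ((UB.sum (by norm_num) Finset.univ fun j _ => h.ub_pd_succ j a j.succ).add (by norm_num)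
      ((h.ub_quadDiv a).const_mul (-1))).congr fun t ht x => h.pd_zero_zero a ht x
  · exact ((h.ub_pd_succ i a 0).add (by norm_num) (h.ub_quadCurl a i.succ 0)).congr
      fun t ht x => h.pd_zero_succ a i ht x

end Sol

/-! ### The wave equation -/

/-- Functions to which convolution and differentiation can be applied in any order. -/
structure Adm (T : ℝ) (f : ℝ → Sp n → ℂ) : Prop where
  smooth : ContDiffOn ℝ 1 (Function.uncurry f) (Ioo 0 T ×ˢ univ)
  bdd : SliceBdd T f
  pd_bdd : ∀ μ, SliceBdd T (pd μ f)

variable {f g : ℝ → Sp n → ℂ}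

lemma SliceBdd.congr (hf : SliceBdd T f) (h : ∀ t ∈ Ioo 0 T, ∀ x, g t x = f t x) :
    SliceBdd T g := by
  have e : ∀ t ∈ Ioo 0 T, g t = f t := fun t ht => funext (h t ht)
  obtain ⟨M, hM⟩ := hf.bdd
  exact ⟨hf.cont.congr fun z hz => h z.1 hz.1 z.2, fun t ht => by rw [e t ht]; exact hf.wint t ht,
    M, fun t ht => by rw [e t ht]; exact hM t ht⟩

lemma Adm.const_mul (hf : Adm T f) (c : ℂ) : Adm T fun t x => c * f t x :=
  ⟨contDiffOn_const.mul hf.smooth, hf.bdd.const_mul c, fun μ =>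
    ((hf.pd_bdd μ).const_mul c).congr fun _ ht x => pd_const_mul c hf.smooth ht x μ⟩

lemma Adm.sum {ι : Type} (s : Finset ι) {f : ι → ℝ → Sp n → ℂ} (hf : ∀ i ∈ s, Adm T (f i)) :
    Adm T fun t x => ∑ i ∈ s, f i t x :=
  ⟨ContDiffOn.sum fun i hi => (hf i hi).smooth, SliceBdd.sum s fun i hi => (hf i hi).bdd,
    fun μ => (SliceBdd.sum s fun i hi => (hf i hi).pd_bdd μ).congr fun _ ht x =>
      pd_sum s (fun i hi => (hf i hi).smooth) ht x μ⟩

lemma Sol.adm (h : Sol S T u) (a : Fin N) (α : Fin (n + 1)) : Adm T (u a α) :=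
  ⟨h.smooth_one a α, (h.ub_two a α).sliceBdd_two, fun μ => (h.ub_pd μ a α).sliceBdd_two⟩

/-- Products of components and their first derivatives have slices bounded in `L¹`, each being a
product of two `L²` functions. -/
lemma Sol.adm_mul (h : Sol S T u) (b c : Fin N) (β γ : Fin (n + 1)) :
    Adm T fun t x => u b β t x * u c γ t x :=
  ⟨(h.smooth_one b β).mul (h.smooth_one c γ),
    (UB.mul (r := 1) (h.ub_two b β) (h.ub_two c γ)).sliceBdd_one, fun μ =>
    (UB.add le_rfl (UB.mul (r := 1) (h.ub_pd μ b β) (h.ub_two c γ))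
      (UB.mul (r := 1) (h.ub_two b β) (h.ub_pd μ c γ))).sliceBdd_one.congr fun _ ht x =>
      pd_mul (h.smooth_one b β) (h.smooth_one c γ) ht x μ⟩

lemma Sol.adm_quadCurl (h : Sol S T u) (a : Fin N) (α β : Fin (n + 1)) :
    Adm T fun t => quadCurl S (fun i γ => u i γ t) a α β :=
  Adm.sum _ fun b _ => Adm.sum _ fun c _ => (h.adm_mul b c α β).const_mul _

lemma Sol.adm_quadDiv (h : Sol S T u) (a : Fin N) :
    Adm T fun t => quadDiv S (fun i γ => u i γ t) a :=
  Adm.sum _ fun b _ => Adm.sum _ fun c _ => Adm.sum _ fun β _ => (h.adm_mul b c β β).const_mul _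

lemma Adm.contDiffOn_cvl (hf : Adm T f) (K : 𝓢(Sp n, ℂ)) :
    ContDiffOn ℝ 1 (Function.uncurry fun t => cvl K (f t)) (Ioo 0 T ×ˢ univ) :=
  WaveMaps.contDiffOn_cvl K hf.bdd (hf.pd_bdd 0) fun _ ht y => hasDerivAt_pd_zero hf.smooth ht y

lemma Adm.cvl_pd_succ (hf : Adm T f) (K : 𝓢(Sp n, ℂ)) (j : Fin n) {t : ℝ} (ht : t ∈ Ioo 0 T)
    (x : Sp n) : cvl K (pd j.succ f t) x = cvl (∂_{dir j} K) (f t) x := by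
  have hd := differentiable_slice hf.smooth ht
  have e : pd j.succ f t = fun y => fderiv ℝ (f t) y (dir j) := funext fun y => pd_succ_eq (hd y) j
  have hw := (hf.pd_bdd j.succ).wint t ht
  rw [e] at hw ⊢
  exact cvl_fderiv K (dir j) hd (hf.bdd.wint t ht) hw x

lemma Adm.pd_cvl (hf : Adm T f) (K : 𝓢(Sp n, ℂ)) (μ : Fin (n + 1)) {t : ℝ} (ht : t ∈ Ioo 0 T)
    (x : Sp n) : pd μ (fun t => cvl K (f t)) t x = cvl K (pd μ f t) x := by
  refine Fin.cases ?_ (fun j => ?_) μ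
  · exact (hasDerivAt_cvl_time K hf.bdd (hf.pd_bdd 0)
      (fun _ ht y => hasDerivAt_pd_zero hf.smooth ht y) ht x).deriv
  · have h1 := hasFDerivAt_cvl K (hf.bdd.wint t ht) x
    rw [pd_succ_eq h1.differentiableAt, h1.fderiv, cvl_fderivCLM_apply _ (hf.bdd.wint t ht),
      hf.cvl_pd_succ K j ht]

namespace Sol

/-- There is no bound on `∂_t² φ`. The equations replace `∂_t φ` by spatial derivatives, which go to
the kernel, and by quadratic terms; what remains to be differentiated in time has controlled first
derivatives. -/
lemma contDiffOn_cvl_pd_zero (h : Sol S T u) (K : 𝓢(Sp n, ℂ)) (a : Fin N) (α : Fin (n + 1)) :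
    ContDiffOn ℝ 1 (Function.uncurry fun t => cvl K (pd 0 (u a α) t)) (Ioo 0 T ×ˢ univ) := by
  refine Fin.cases ?_ (fun i => ?_) α
  · have h1 : ContDiffOn ℝ 1 (Function.uncurry fun t x => ∑ j : Fin n,
        cvl (∂_{dir j} K) (u a j.succ t) x
          + (-1) * cvl K (quadDiv S (fun i γ => u i γ t) a) x) (Ioo 0 T ×ˢ univ) :=
      (ContDiffOn.sum fun j _ => (h.adm a j.succ).contDiffOn_cvl (∂_{dir j} K)).add
        (contDiffOn_const.mul ((h.adm_quadDiv a).contDiffOn_cvl K))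
    refine h1.congr ?_
    rintro ⟨t, x⟩ ⟨ht, -⟩
    have w1 : ∀ j : Fin n, WInt (pd j.succ (u a j.succ) t) := fun j =>
      ((h.adm a j.succ).pd_bdd j.succ).wint t ht
    have w2 := (h.adm_quadDiv a).bdd.wint t ht
    simp only [Function.uncurry]
    rw [funext (h.pd_zero_zero a ht), cvl_add _ (WInt.sum _ fun j _ => w1 j) (w2.const_mul _),
      cvl_sum _ _ fun j _ => w1 j, cvl_const_mul, smul_eq_mul]
    congr 1
    exact Finset.sum_congr rfl fun j _ => (h.adm a j.succ).cvl_pd_succ K j ht x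
  · have h1 : ContDiffOn ℝ 1 (Function.uncurry fun t x => cvl (∂_{dir i} K) (u a 0 t) x
          + cvl K (quadCurl S (fun i γ => u i γ t) a i.succ 0) x) (Ioo 0 T ×ˢ univ) :=
      ((h.adm a 0).contDiffOn_cvl (∂_{dir i} K)).add ((h.adm_quadCurl a i.succ 0).contDiffOn_cvl K)
    refine h1.congr ?_
    rintro ⟨t, x⟩ ⟨ht, -⟩
    simp only [Function.uncurry]
    rw [funext (h.pd_zero_succ a i ht), cvl_add _ (((h.adm a 0).pd_bdd i.succ).wint t ht)
      ((h.adm_quadCurl a i.succ 0).bdd.wint t ht), (h.adm a 0).cvl_pd_succ K i ht]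

/-- The projected solution is twice continuously differentiable. -/
lemma contDiffOn_cvl (h : Sol S T u) (K : 𝓢(Sp n, ℂ)) (a : Fin N) (α : Fin (n + 1)) :
    ContDiffOn ℝ 2 (Function.uncurry fun t => cvl K (u a α t)) (Ioo 0 T ×ˢ univ) := by
  have hA := h.adm a α
  have := contDiffOn_succ_uncurry (T := T) 1 (f := fun t => cvl K (u a α t))
    (g := fun t => cvl K (pd 0 (u a α) t))
    (A := fun t => cvl (fderivCLM ℂ (Sp n) ℂ K) (u a α t))
    (fun t ht x => hasDerivAt_cvl_time K hA.bdd (hA.pd_bdd 0)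
      (fun _ ht y => hasDerivAt_pd_zero hA.smooth ht y) ht x)
    (fun t ht x => hasFDerivAt_cvl K (hA.bdd.wint t ht) x)
    (h.contDiffOn_cvl_pd_zero K a α)
    (WaveMaps.contDiffOn_cvl _ hA.bdd (hA.pd_bdd 0)
      fun _ ht y => hasDerivAt_pd_zero hA.smooth ht y)
  exact this.of_le (by norm_num)

lemma cvl_pd (h : Sol S T u) (K : 𝓢(Sp n, ℂ)) (a : Fin N) (α μ : Fin (n + 1)) {t : ℝ}
    (ht : t ∈ Ioo 0 T) (x : Sp n) :
    pd μ (fun t => cvl K (u a α t)) t x = pd α (fun t => cvl K (u a μ t)) t x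
      + cvl K (quadCurl S (fun i γ => u i γ t) a α μ) x := by
  rw [(h.adm a α).pd_cvl K μ ht, (h.adm a μ).pd_cvl K α ht,
    ← cvl_add K (((h.adm a μ).pd_bdd α).wint t ht) ((h.adm_quadCurl a α μ).bdd.wint t ht)]
  congr 1
  funext y
  rw [← h.curl t ht y a α μ]
  ring

lemma sum_pd_cvl (h : Sol S T u) (K : 𝓢(Sp n, ℂ)) (a : Fin N) {t : ℝ} (ht : t ∈ Ioo 0 T)
    (x : Sp n) : ∑ μ, (mink μ : ℂ) * pd μ (fun t => cvl K (u a μ t)) t x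
      = cvl K (quadDiv S (fun i γ => u i γ t) a) x := by
  have w : ∀ μ, WInt (pd μ (u a μ) t) := fun μ => ((h.adm a μ).pd_bdd μ).wint t ht
  rw [← funext fun y => h.div t ht y a, cvl_sum K _ fun μ _ => (w μ).const_mul _]
  refine Finset.sum_congr rfl fun μ _ => ?_
  rw [cvl_const_mul, smul_eq_mul, (h.adm a μ).pd_cvl K μ ht]

lemma pd_quadCurl (h : Sol S T u) (a : Fin N) (α β μ : Fin (n + 1)) {t : ℝ} (ht : t ∈ Ioo 0 T)
    (x : Sp n) : pd μ (fun t => quadCurl S (fun i γ => u i γ t) a α β) t x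
      = ∑ b, ∑ c, (S a b c : ℂ) *
        (pd μ (u b α) t x * u c β t x + u b α t x * pd μ (u c β) t x) := by
  have A := fun b c => (h.adm_mul b c α β).const_mul (S a b c : ℂ)
  unfold quadCurl
  rw [pd_sum _ (fun b _ => (Adm.sum _ fun c _ => A b c).smooth) ht]
  refine Finset.sum_congr rfl fun b _ => ?_
  rw [pd_sum _ (fun c _ => (A b c).smooth) ht]
  refine Finset.sum_congr rfl fun c _ => ?_
  rw [pd_const_mul _ (h.adm_mul b c α β).smooth ht, pd_mul (h.smooth_one b α) (h.smooth_one c β) ht]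

lemma pd_quadDiv (h : Sol S T u) (a : Fin N) (μ : Fin (n + 1)) {t : ℝ} (ht : t ∈ Ioo 0 T)
    (x : Sp n) : pd μ (fun t => quadDiv S (fun i γ => u i γ t) a) t x
      = ∑ b, ∑ c, ∑ β : Fin (n + 1), (-(conn S a b c * mink β) : ℂ) *
        (pd μ (u b β) t x * u c β t x + u b β t x * pd μ (u c β) t x) := by
  have A := fun b c (β : Fin (n + 1)) => (h.adm_mul b c β β).const_mul (-(conn S a b c * mink β) : ℂ)
  unfold quadDiv
  rw [pd_sum _ (fun b _ => (Adm.sum _ fun c _ => Adm.sum _ fun β _ => A b c β).smooth) ht]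
  refine Finset.sum_congr rfl fun b _ => ?_
  rw [pd_sum _ (fun c _ => (Adm.sum _ fun β _ => A b c β).smooth) ht]
  refine Finset.sum_congr rfl fun c _ => ?_
  rw [pd_sum _ (fun β _ => (A b c β).smooth) ht]
  refine Finset.sum_congr rfl fun β _ => ?_
  rw [pd_const_mul _ (h.adm_mul b c β β).smooth ht, pd_mul (h.smooth_one b β) (h.smooth_one c β) ht]

/-- The wave equation for the projected solution. -/
theorem box_cvl (h : Sol S T u) (K : 𝓢(Sp n, ℂ)) (a : Fin N) (α : Fin (n + 1)) {t : ℝ}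
    (ht : t ∈ Ioo 0 T) (x : Sp n) :
    box (fun t => cvl K (u a α t)) t x
      = cvl K (inhom S (fun i γ => u i γ t) (fun μ i γ => pd μ (u i γ) t) a α) x := by
  have hψ := fun γ => h.contDiffOn_cvl K a γ
  have hψ1 := fun γ => (hψ γ).of_le (show (1 : WithTop ℕ∞) ≤ 2 by norm_num)
  have hpd : ∀ μ γ, ContDiffOn ℝ 1 (Function.uncurry (pd μ fun t => cvl K (u a γ t)))
      (Ioo 0 T ×ˢ univ) := fun μ γ => by
    have := contDiffOn_pd (m := 1) (f := fun t => cvl K (u a γ t)) (by simpa [one_add_one_eq_two] using hψ γ) μ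
    simpa using this
  -- The curl equation for the projected functions is differentiated and the derivatives exchanged.
  -- This is done after projection, where `C²` regularity is known, so second derivatives of `u`
  -- never have to be integrated.
  have h1 : ∀ μ, pd μ (pd μ fun t => cvl K (u a α t)) t x
      = pd α (pd μ fun t => cvl K (u a μ t)) t x
        + cvl K (pd μ (fun t => quadCurl S (fun i γ => u i γ t) a α μ) t) x := fun μ => by
    rw [pd_congr (fun s hs y => h.cvl_pd K a α μ hs y) ht,
      pd_add (hpd α μ) ((h.adm_quadCurl a α μ).contDiffOn_cvl K) ht, pd_comm (hψ μ) ht,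
      (h.adm_quadCurl a α μ).pd_cvl K μ ht]
  have h2 : ∑ μ, (mink μ : ℂ) * pd α (pd μ fun t => cvl K (u a μ t)) t x
      = cvl K (pd α (fun t => quadDiv S (fun i γ => u i γ t) a) t) x := by
    rw [← (h.adm_quadDiv a).pd_cvl K α ht, ← pd_congr (fun s hs y => h.sum_pd_cvl K a hs y) ht,
      pd_sum _ (fun μ _ => contDiffOn_const.mul (hpd μ μ)) ht]
    exact Finset.sum_congr rfl fun μ _ => (pd_const_mul _ (hpd μ μ) ht x α).symm
  have w : ∀ μ, WInt (pd μ (fun t => quadCurl S (fun i γ => u i γ t) a α μ) t) := fun μ =>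
    ((h.adm_quadCurl a α μ).pd_bdd μ).wint t ht
  calc box (fun t => cvl K (u a α t)) t x
      = ∑ μ, (mink μ : ℂ) * pd α (pd μ fun t => cvl K (u a μ t)) t x
        + ∑ μ, (mink μ : ℂ) *
          cvl K (pd μ (fun t => quadCurl S (fun i γ => u i γ t) a α μ) t) x := by
        rw [box, ← Finset.sum_add_distrib]
        refine Finset.sum_congr rfl fun μ _ => ?_
        rw [h1, Complex.real_smul, mul_add]
    _ = cvl K (fun y => pd α (fun t => quadDiv S (fun i γ => u i γ t) a) t y
        + ∑ μ, (mink μ : ℂ) * pd μ (fun t => quadCurl S (fun i γ => u i γ t) a α μ) t y) x := by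
        rw [h2, cvl_add K (((h.adm_quadDiv a).pd_bdd α).wint t ht)
          (WInt.sum _ fun μ _ => (w μ).const_mul _), cvl_sum K _ fun μ _ => (w μ).const_mul _]
        simp_rw [cvl_const_mul, smul_eq_mul]
    _ = _ := by
        congr 1
        funext y
        simp_rw [h.pd_quadDiv a α ht y, h.pd_quadCurl a α _ _ ht y]
        rfl

end Sol

end Solution

/-! ### Summation over frequencies -/

lemma tsum_le_int (j : ℤ) (F : ℤ → ℝ≥0∞) :
    ∑' l, (if l ≤ j then F l else 0) = ∑' m : ℕ, F (j - m) := by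
  have hinj : Function.Injective fun m : ℕ => j - (m : ℤ) := fun a b h => by
    simpa using h
  rw [← hinj.tsum_eq]
  · exact tsum_congr fun m => by simp
  · intro l hl
    by_cases h : l ≤ j
    · exact ⟨(j - l).toNat, by simp only; lia⟩
    · simp [h] at hl

lemma tsum_le_dy (j : ℤ) : ∑' l, (if l ≤ j then dy l else 0) = 2 * dy j := by
  rw [tsum_le_int]
  have h : ∀ m : ℕ, dy (j - m) = dy j * 2⁻¹ ^ m := fun m => by
    rw [sub_eq_add_neg, dy_add]
    congr 1
    rw [dy, zpow_neg, ENNReal.ofReal_inv_of_pos (by positivity), zpow_natCast,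
      ENNReal.ofReal_pow (by norm_num), ENNReal.inv_pow]
    simp
  simp_rw [h]
  rw [ENNReal.tsum_mul_left, ENNReal.tsum_geometric, mul_comm]
  norm_num

/-- The trilinear sum is dominated by the bilinear one when the low frequencies are small. -/
lemma tsum_hSum_le {a b e : ℤ → ℝ≥0∞} (he : ∀ l, e l ≤ 2⁻¹ * dy l) :
    ∑' i, ∑' j, ∑' l, hSum a b e i j l ≤ ∑' i, ∑' j, gSum a b i j := by
  refine ENNReal.tsum_le_tsum fun i => ENNReal.tsum_le_tsum fun j => ?_
  by_cases h : -9 ≤ i ∧ j ≤ i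
  · calc ∑' l, hSum a b e i j l
        ≤ ∑' l, b i * a j * (2⁻¹ * if l ≤ j then dy l else 0) := by
          refine ENNReal.tsum_le_tsum fun l => ?_
          unfold hSum
          split_ifs with h1 h2 h2
          · gcongr
            exact he l
          · exact absurd h1.2.2 h2
          · exact zero_le
          · exact zero_le
      -- The sum of `2^l` over `l ≤ j` equals `2 · 2^j`, and the factor `2⁻¹` in the smallness
      -- assumption cancels the `2`.
      _ = gSum a b i j := by
          rw [ENNReal.tsum_mul_left, ENNReal.tsum_mul_left, tsum_le_dy, gSum, if_pos h,
            ← mul_assoc 2⁻¹, ENNReal.inv_mul_cancel (by norm_num) (by norm_num)]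
          ring
  · have : ∀ l, hSum a b e i j l = 0 := fun l => if_neg fun h' => h ⟨h'.1, h'.2.1⟩
    simp [this]

/-- The summand of the frequency sum in the final estimate. -/
def zSum (γ β σ : ℝ) (i j : ℤ) : ℝ≥0∞ :=
  if -9 ≤ i ∧ j ≤ i then ENNReal.ofReal ((2 : ℝ) ^ (γ * j))
    * ENNReal.ofReal ((2 : ℝ) ^ (-β * i + σ * |(i : ℝ)|)) else 0

/-- Since `γ > 0`, the inner sum over `j ≤ i` is geometric and of size `2^{γ i}`. The outer sum then
has exponent `γ - β + σ < 0` for positive `i`, and only finitely many negative `i` occur. -/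
lemma tsum_zSum_ne_top {γ β σ : ℝ} (hγ : 0 < γ) (hσ : 0 ≤ σ) (h : γ - β + σ < 0) :
    ∑' i, ∑' j, zSum γ β σ i j ≠ ⊤ := by
  set G : ℝ≥0∞ := ∑' m : ℕ, ENNReal.ofReal ((2 : ℝ) ^ (-γ * m))
  have hG : G ≠ ⊤ := (summable_two_rpow (by linarith)).tsum_ofReal_ne_top
  set H : ℝ≥0∞ := ∑' m : ℕ, ENNReal.ofReal ((2 : ℝ) ^ ((γ - β + σ) * m))
  have hH : H ≠ ⊤ := (summable_two_rpow h).tsum_ofReal_ne_top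
  -- The loss from starting at `i = -9`: with `i = m - 9` and `|m - 9| ≤ m + 9`, the exponent
  -- exceeds that of the geometric series in `m` by at most this constant.
  set D : ℝ≥0∞ := ENNReal.ofReal ((2 : ℝ) ^ (-9 * (γ - β) + 9 * σ))
  have h1 : ∀ i : ℤ, ∑' j, zSum γ β σ i j ≤ if -9 ≤ i then
      G * ENNReal.ofReal ((2 : ℝ) ^ ((γ - β) * i + σ * |(i : ℝ)|)) else 0 := by
    intro i
    by_cases hi : -9 ≤ i
    · rw [if_pos hi]
      have e : ∀ j, zSum γ β σ i j = (if j ≤ i then ENNReal.ofReal ((2 : ℝ) ^ (γ * j)) else 0)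
          * ENNReal.ofReal ((2 : ℝ) ^ (-β * i + σ * |(i : ℝ)|)) := fun j => by
        simp [zSum, hi]
      simp_rw [e]
      rw [ENNReal.tsum_mul_right, tsum_le_int]
      have e2 : ∀ m : ℕ, ENNReal.ofReal ((2 : ℝ) ^ (γ * ((i - m : ℤ) : ℝ)))
          = ENNReal.ofReal ((2 : ℝ) ^ (-γ * m)) * ENNReal.ofReal ((2 : ℝ) ^ (γ * i)) := fun m => by
        rw [← ofReal_two_rpow_add]
        push_cast
        ring_nf
      simp_rw [e2]
      have e3 : γ * i + (-β * i + σ * |(i : ℝ)|) = (γ - β) * i + σ * |(i : ℝ)| := by ring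
      rw [ENNReal.tsum_mul_right, mul_assoc, ← ofReal_two_rpow_add, e3]
    · have : ∀ j, zSum γ β σ i j = 0 := fun j => if_neg fun h' => hi h'.1
      simp [this]
  refine ne_top_of_le_ne_top (b := G * (D * H)) (by finiteness) ((ENNReal.tsum_le_tsum h1).trans ?_)
  have hinj : Function.Injective fun m : ℕ => (m : ℤ) - 9 := fun a b h => by simpa using h
  rw [← hinj.tsum_eq]
  · rw [← ENNReal.tsum_mul_left, ← ENNReal.tsum_mul_left]
    refine ENNReal.tsum_le_tsum fun m => ?_
    rw [if_pos (by lia)]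
    gcongr
    rw [← ofReal_two_rpow_add]
    refine ofReal_two_rpow_mono ?_
    push_cast
    have : |(m : ℝ) - 9| ≤ m + 9 := by
      rw [abs_le]
      constructor <;> linarith [(Nat.cast_nonneg m : (0 : ℝ) ≤ m)]
    nlinarith
  · intro i hi
    by_cases h : -9 ≤ i
    · exact ⟨(i + 9).toNat, by simp only; lia⟩
    · simp [h] at hi

/-! ### Integration in time -/

section TimeIntegral

variable {N : ℕ} {Φ : ℝ → Sp n → Arr N n ℝ} {T C : ℝ} {c : ℤ → ℝ}

lemma slab_measure (T : ℝ) : (volume.restrict (Icc 0 T)).prod (volume : Measure (Sp n))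
    = ((volume : Measure ℝ).prod volume).restrict (Ioo 0 T ×ˢ univ) := by
  rw [← Measure.restrict_congr_set (Ioo_ae_eq_Icc (a := (0 : ℝ)) (b := T) (μ := volume)),
    ← Measure.prod_restrict, Measure.restrict_univ]

lemma aestronglyMeasurable_slab {V : Type} [NormedAddCommGroup V] {f : ℝ → Sp n → V}
    (hf : ContinuousOn (Function.uncurry f) (Ioo 0 T ×ˢ univ)) :
    AEStronglyMeasurable (Function.uncurry f) ((volume.restrict (Icc 0 T)).prod volume) := by
  rw [slab_measure]
  exact ContinuousOn.aestronglyMeasurable hf (isOpen_slab T).measurableSet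

lemma aemeasurable_eLpNorm_slab {V : Type} [NormedAddCommGroup V] {f : ℝ → Sp n → V}
    (hf : ContinuousOn (Function.uncurry f) (Ioo 0 T ×ˢ univ)) {p : ℝ≥0∞} (h0 : p ≠ 0)
    (ht : p ≠ ⊤) :
    AEMeasurable (fun t => eLpNorm (f t) p volume) (volume.restrict (Icc 0 T)) := by
  simp_rw [eLpNorm_eq_lintegral_rpow_enorm_toReal h0 ht]
  exact (((aestronglyMeasurable_slab hf).enorm.pow_const p.toReal).lintegral_prod_right').pow_const _

lemma lintegral_mul_le_eLpNorm_two {X : Type} [MeasurableSpace X] {μ : Measure X}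
    {f g : X → ℝ≥0∞} (hf : AEMeasurable f μ) (hg : AEMeasurable g μ) :
    ∫⁻ t, f t * g t ∂μ ≤ eLpNorm f 2 μ * eLpNorm g 2 μ := by
  have h := ENNReal.lintegral_mul_le_Lp_mul_Lq μ Real.HolderConjugate.two_two hf hg
  rw [eLpNorm_eq_lintegral_rpow_enorm_toReal (by norm_num) (by norm_num),
    eLpNorm_eq_lintegral_rpow_enorm_toReal (by norm_num) (by norm_num)]
  simpa using h

end TimeIntegral

/-! ### The Strichartz exponents -/

/-- The exponent `n - 1`. -/
def expP (n : ℕ) : ℝ≥0∞ := ENNReal.ofReal ((n : ℝ) - 1)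

/-- The exponent `2 (n - 1) / (n - 3)`. -/
def expQ (n : ℕ) : ℝ≥0∞ := ENNReal.ofReal (2 * ((n : ℝ) - 1) / ((n : ℝ) - 3))

lemma five_le_cast (hn : 5 ≤ n) : (5 : ℝ) ≤ n := by exact_mod_cast hn

lemma inv_expP (hn : 5 ≤ n) : (expP n)⁻¹ = ENNReal.ofReal (((n : ℝ) - 1)⁻¹) :=
  (ENNReal.ofReal_inv_of_pos (by linarith [five_le_cast hn])).symm

lemma inv_expQ (hn : 5 ≤ n) : (expQ n)⁻¹ = ENNReal.ofReal (((n : ℝ) - 3) / (2 * ((n : ℝ) - 1))) := by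
  have := five_le_cast hn
  rw [expQ, ← ENNReal.ofReal_inv_of_pos (div_pos (by linarith) (by linarith)), inv_div]

lemma toReal_inv_expP (hn : 5 ≤ n) : (expP n)⁻¹.toReal = ((n : ℝ) - 1)⁻¹ := by
  rw [inv_expP hn, ENNReal.toReal_ofReal (inv_nonneg.2 (by linarith [five_le_cast hn]))]

lemma toReal_inv_expQ (hn : 5 ≤ n) : (expQ n)⁻¹.toReal = ((n : ℝ) - 3) / (2 * ((n : ℝ) - 1)) := by
  have := five_le_cast hn
  rw [inv_expQ hn, ENNReal.toReal_ofReal (div_nonneg (by linarith) (by linarith))]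

lemma holderTriple_expP_expQ (hn : 5 ≤ n) : ENNReal.HolderTriple (expP n) (expQ n) 2 where
  inv_add_inv_eq_inv := by
    have := five_le_cast hn
    have h1 : (n : ℝ) - 1 ≠ 0 := by linarith
    rw [inv_expP hn, inv_expQ hn, ← ENNReal.ofReal_add (inv_nonneg.2 (by linarith))
      (div_nonneg (by linarith) (by linarith))]
    have e : ((n : ℝ) - 1)⁻¹ + ((n : ℝ) - 3) / (2 * ((n : ℝ) - 1)) = 2⁻¹ := by
      field_simp
      ring
    rw [e, ENNReal.ofReal_inv_of_pos (by norm_num)]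
    simp

lemma two_le_expP (hn : 5 ≤ n) : 2 ≤ expP n := by
  have := five_le_cast hn
  rw [expP, ← ENNReal.ofReal_ofNat]
  exact ENNReal.ofReal_le_ofReal (by linarith)

lemma two_le_expQ (hn : 5 ≤ n) : 2 ≤ expQ n := by
  have := five_le_cast hn
  rw [expQ, ← ENNReal.ofReal_ofNat]
  refine ENNReal.ofReal_le_ofReal ?_
  rw [le_div_iff₀ (by linarith)]
  linarith

/-- The condition reads `1/2 + 1/2 ≤ (n-1)/4`, which is `n ≥ 5`. -/
lemma admissible_expP (hn : 5 ≤ n) : Admissible n 2 (expP n) := by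
  have := five_le_cast hn
  have h1 : (n : ℝ) - 1 ≠ 0 := by linarith
  refine ⟨le_rfl, two_le_expP hn, ?_⟩
  rw [toReal_inv_expP hn]
  have e : ((n : ℝ) - 1) / 2 * ((n : ℝ) - 1)⁻¹ = 1 / 2 := by field_simp
  rw [e]
  simp only [ENNReal.toReal_inv, ENNReal.toReal_ofNat]
  linarith

/-- This is the endpoint pair: the admissibility condition holds with equality. -/
lemma admissible_expQ (hn : 5 ≤ n) : Admissible n 2 (expQ n) := by
  have := five_le_cast hn
  have h1 : (n : ℝ) - 1 ≠ 0 := by linarith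
  refine ⟨le_rfl, two_le_expQ hn, ?_⟩
  rw [toReal_inv_expQ hn]
  have e : ((n : ℝ) - 1) / 2 * (((n : ℝ) - 3) / (2 * ((n : ℝ) - 1))) = ((n : ℝ) - 3) / 4 := by
    field_simp
    ring
  rw [e]
  simp only [ENNReal.toReal_inv, ENNReal.toReal_ofNat]
  linarith

/-- The gain for the lower frequency. -/
def gamL (n : ℕ) : ℝ := 1 / 2 - ((n : ℝ) - 1)⁻¹

/-- The gain for the higher frequency. -/
def betH (n : ℕ) : ℝ := n * (((n : ℝ) - 3) / (2 * ((n : ℝ) - 1))) - 1 / 2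

lemma gamL_pos (hn : 5 ≤ n) : 0 < gamL n := by
  have := five_le_cast hn
  have h : ((n : ℝ) - 1)⁻¹ ≤ 4⁻¹ := inv_anti₀ (by norm_num) (by linarith)
  unfold gamL
  linarith

/-- The net gain when both frequencies are equal; it must exceed the growth `σ` of the envelope. -/
lemma gamL_sub_betH (hn : 5 ≤ n) : gamL n - betH n = -(((n : ℝ) - 4) / 2) := by
  have := five_le_cast hn
  have h1 : (n : ℝ) - 1 ≠ 0 := by linarith
  unfold gamL betH
  field_simp
  ring

section TimeIntegral

variable {N : ℕ} {Φ : ℝ → Sp n → Arr N n ℝ} {T C ε σ A : ℝ} {c : ℤ → ℝ}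

/-- The Lebesgue norm of a piece at a given time. -/
def pieceNorm (η : Sp n → ℝ) (Φ : ℝ → Sp n → Arr N n ℝ) (p : ℝ≥0∞) (t : ℝ) (k : ℤ) : ℝ≥0∞ :=
  eLpNorm (projArr η k Φ t) p volume

/-- Cauchy-Schwarz in time, then the bootstrap assumption at the two pairs `(2, p)` and `(2, q)`.
The lower frequency uses `c_j ≤ ε`, the higher one the slow variation of the envelope, which
supplies the factor `c_0`. -/
lemma lintegral_pieceNorm_mul_le (h : Bootstrap η T C c Φ) (hn : 5 ≤ n) (hC : 0 < C)
    (hcε : ∀ k, c k ≤ ε) (hε : 0 ≤ ε) (hc : IsFreqEnvelope σ A c)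
    (hm : ∀ k, ∀ p : ℝ≥0∞, p ≠ 0 → p ≠ ⊤ →
      AEMeasurable (fun t => pieceNorm η Φ p t k) (volume.restrict (Icc 0 T))) (i j : ℤ) :
    dy j * ∫⁻ t in Icc 0 T, pieceNorm η Φ (expP n) t j * pieceNorm η Φ (expQ n) t i
      ≤ ENNReal.ofReal (4 * C ^ 2 * ε * (|A| * c 0)) *
        (ENNReal.ofReal ((2 : ℝ) ^ (gamL n * j))
          * ENNReal.ofReal ((2 : ℝ) ^ (-betH n * i + σ * |(i : ℝ)|))) := by
  have h2 : (0 : ℝ≥0∞) < 2 := by norm_num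
  have hI := lintegral_mul_le_eLpNorm_two
    (hm j (expP n) (h2.trans_le (two_le_expP hn)).ne' ENNReal.ofReal_ne_top)
    (hm i (expQ n) (h2.trans_le (two_le_expQ hn)).ne' ENNReal.ofReal_ne_top)
  have hP := h.mixedNorm_le (admissible_expP hn) j
  have hQ := h.mixedNorm_le (admissible_expQ hn) i
  have hcj : ENNReal.ofReal (2 * C * c j) ≤ ENNReal.ofReal (2 * C * ε) :=
    ENNReal.ofReal_le_ofReal (by gcongr; exact hcε j)
  have hci : ENNReal.ofReal (2 * C * c i) ≤ ENNReal.ofReal (2 * C * (|A| * c 0)) *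
      ENNReal.ofReal ((2 : ℝ) ^ (σ * |(i : ℝ)|)) := by
    have h0 := hc.nonneg 0
    rw [← ENNReal.ofReal_mul (by positivity)]
    refine ENNReal.ofReal_le_ofReal ?_
    have h1 := hc.slow i 0
    simp only [Int.cast_zero, sub_zero] at h1
    calc 2 * C * c i ≤ 2 * C * (|A| * 2 ^ (σ * |(i : ℝ)|) * c 0) := by
          gcongr
          refine h1.trans ?_
          gcongr
          exact le_abs_self A
      _ = _ := by ring
  have hA : ENNReal.ofReal (2 * C * ε) * ENNReal.ofReal (2 * C * (|A| * c 0))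
      = ENNReal.ofReal (4 * C ^ 2 * ε * (|A| * c 0)) := by
    rw [← ENNReal.ofReal_mul (by positivity)]
    ring_nf
  have e1 : dy j * ENNReal.ofReal ((2 : ℝ) ^ (-(j : ℝ) * ((2 : ℝ≥0∞)⁻¹.toReal
      + n * (expP n)⁻¹.toReal - 1))) = ENNReal.ofReal ((2 : ℝ) ^ (gamL n * j)) := by
    rw [dy_eq_rpow, ← ofReal_two_rpow_add, toReal_inv_expP hn]
    congr 2
    simp only [ENNReal.toReal_inv, ENNReal.toReal_ofNat, gamL]
    have := five_le_cast hn
    have h1 : (n : ℝ) - 1 ≠ 0 := by linarith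
    field_simp
    ring
  have e2 : ENNReal.ofReal ((2 : ℝ) ^ (σ * |(i : ℝ)|)) *
      ENNReal.ofReal ((2 : ℝ) ^ (-(i : ℝ) * ((2 : ℝ≥0∞)⁻¹.toReal + n * (expQ n)⁻¹.toReal - 1)))
      = ENNReal.ofReal ((2 : ℝ) ^ (-betH n * i + σ * |(i : ℝ)|)) := by
    rw [← ofReal_two_rpow_add, toReal_inv_expQ hn]
    congr 2
    simp only [ENNReal.toReal_inv, ENNReal.toReal_ofNat, betH]
    ring
  rw [← hA, ← e1, ← e2]
  set X := ENNReal.ofReal ((2 : ℝ) ^ (-(j : ℝ) * ((2 : ℝ≥0∞)⁻¹.toReal + n * (expP n)⁻¹.toReal - 1)))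
  set Y := ENNReal.ofReal ((2 : ℝ) ^ (-(i : ℝ) * ((2 : ℝ≥0∞)⁻¹.toReal + n * (expQ n)⁻¹.toReal - 1)))
  calc _ ≤ dy j * ((ENNReal.ofReal (2 * C * ε) * X) *
        (ENNReal.ofReal (2 * C * (|A| * c 0)) * ENNReal.ofReal ((2 : ℝ) ^ (σ * |(i : ℝ)|)) * Y)) := by
        gcongr
        refine hI.trans (mul_le_mul' (hP.trans ?_) (hQ.trans ?_)) <;> gcongr
    _ = _ := by ring

lemma lintegral_gSum_le (h : Bootstrap η T C c Φ) (hn : 5 ≤ n) (hC : 0 < C)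
    (hcε : ∀ k, c k ≤ ε) (hε : 0 ≤ ε) (hc : IsFreqEnvelope σ A c)
    (hm : ∀ k, ∀ p : ℝ≥0∞, p ≠ 0 → p ≠ ⊤ →
      AEMeasurable (fun t => pieceNorm η Φ p t k) (volume.restrict (Icc 0 T))) :
    ∫⁻ t in Icc 0 T, ∑' i, ∑' j, gSum (pieceNorm η Φ (expP n) t) (pieceNorm η Φ (expQ n) t) i j
      ≤ ENNReal.ofReal (4 * C ^ 2 * ε * (|A| * c 0)) *
        ∑' i, ∑' j, zSum (gamL n) (betH n) σ i j := by
  have h2 : (0 : ℝ≥0∞) < 2 := by norm_num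
  have hmP := fun j => hm j (expP n) (h2.trans_le (two_le_expP hn)).ne' ENNReal.ofReal_ne_top
  have hmQ := fun i => hm i (expQ n) (h2.trans_le (two_le_expQ hn)).ne' ENNReal.ofReal_ne_top
  have hmG : ∀ i j, AEMeasurable (fun t => gSum (pieceNorm η Φ (expP n) t)
      (pieceNorm η Φ (expQ n) t) i j) (volume.restrict (Icc 0 T)) := fun i j => by
    unfold gSum
    split_ifs
    · exact ((hmP j).const_mul _).mul (hmQ i)
    · exact aemeasurable_const
  rw [lintegral_tsum fun i => AEMeasurable.tsum (hmG i), ← ENNReal.tsum_mul_left]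
  refine ENNReal.tsum_le_tsum fun i => ?_
  rw [lintegral_tsum (hmG i), ← ENNReal.tsum_mul_left]
  refine ENNReal.tsum_le_tsum fun j => ?_
  unfold gSum zSum
  by_cases hij : -9 ≤ i ∧ j ≤ i
  · simp only [if_pos hij, mul_assoc (dy j)]
    rw [lintegral_const_mul' _ _ (dy_ne_top j)]
    exact lintegral_pieceNorm_mul_le h hn hC hcε hε hc hm i j
  · simp [hij]

end TimeIntegral

/-! ### The solution at a fixed time -/

section FixedTime

variable {N : ℕ} {S : Fin N → Fin N → Fin N → ℝ} {Φ : ℝ → Sp n → Arr N n ℝ} {T C : ℝ} {c : ℤ → ℝ}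

/-- The evaluation of an array at a pair of indices. -/
def evalArr (𝕜 : Type) [NormedAddCommGroup 𝕜] [NormedSpace ℝ 𝕜] (a : Fin N) (α : Fin (n + 1)) :
    Arr N n 𝕜 →L[ℝ] 𝕜 :=
  (ContinuousLinearMap.proj (R := ℝ) (φ := fun _ : Fin (n + 1) => 𝕜) α).comp
    (ContinuousLinearMap.proj (R := ℝ) (φ := fun _ : Fin N => Fin (n + 1) → 𝕜) a)

lemma pd_cpt (hΦ : ContDiffOn ℝ 2 (Function.uncurry Φ) (Ioo 0 T ×ˢ univ)) (μ : Fin (n + 1))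
    (a : Fin N) (α : Fin (n + 1)) {t : ℝ} (ht : t ∈ Ioo 0 T) (x : Sp n) :
    pd μ (cpt Φ a α) t x = (pd μ Φ t x a α : ℂ) :=
  pd_clm (Complex.ofRealCLM.comp (evalArr ℝ a α))
    (differentiableAt_slab (hΦ.of_le (by norm_num)) ht x) μ

/-- The `L⁴` and gradient bounds come from the pieces and may depend on `M`. They only justify the
manipulations and do not enter the constant of the final estimate. -/
lemma Bootstrap.sol [NeZero n] (h : Bootstrap η T C c Φ) (hη : IsBump η) (hn : 5 ≤ n)
    (hΦ : ContDiffOn ℝ 2 (Function.uncurry Φ) (Ioo 0 T ×ˢ univ)) {M : ℝ≥0}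
    (hM : ∀ t ∈ Ioo 0 T, eLpNorm (Φ t) 2 volume ≤ M) (hS : SolvesDivCurl S T Φ) {b : ℝ}
    (hC : 0 ≤ C) (hb : ∀ k, c k ≤ b) : Sol S T (cpt Φ) := by
  have hPB := fun (a : Fin N) (α : Fin (n + 1)) (t : ℝ) (ht : t ∈ Ioo 0 T) =>
    h.pieceBounds hη hn hΦ.continuousOn hM hC hb a α ht
  have hsm : ∀ a α, ContDiffOn ℝ 2 (Function.uncurry (cpt Φ a α)) (Ioo 0 T ×ˢ univ) :=
    fun a α => (Complex.ofRealCLM.comp (evalArr ℝ a α)).contDiff.comp_contDiffOn hΦ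
  have hsm1 : ∀ a α, ContDiffOn ℝ 1 (Function.uncurry (cpt Φ a α)) (Ioo 0 T ×ˢ univ) :=
    fun a α => (hsm a α).of_le (by norm_num)
  refine ⟨hsm, fun t ht x a α β => ?_, fun t ht x a => ?_, fun a α => ?_, fun a α => ?_,
    fun j a α => ?_⟩
  · rw [pd_cpt hΦ β a α ht, pd_cpt hΦ α a β ht, ← Complex.ofReal_sub, hS.curl t ht]
    simp only [quadCurl, cpt]
    push_cast
    simp_rw [mul_assoc]
  · simp_rw [pd_cpt hΦ _ a _ ht, ← Complex.ofReal_mul, ← Complex.ofReal_sum]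
    rw [hS.div t ht]
    simp only [quadDiv, cpt, ← Finset.sum_neg_distrib]
    push_cast
    refine Finset.sum_congr rfl fun b _ => Finset.sum_congr rfl fun c _ =>
      Finset.sum_congr rfl fun β _ => ?_
    ring
  · exact ⟨(hsm a α).continuousOn, M, fun t ht => (eLpNorm_cpt_le t a α 2).trans (hM t ht)⟩
  · exact UB.of_le (regC_ne_top hη _) (hsm a α).continuousOn
      fun t ht => (hPB a α t ht).eLpNorm_four_le hη hn
  · refine UB.of_le (regC_ne_top hη (M + (2 * C * b).toNNReal))
      (contDiffOn_pd (m := 0) (by simpa using hsm1 a α) j.succ).continuousOn fun t ht => ?_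
    have hd := differentiable_slice (hsm1 a α) ht
    rw [funext fun x => pd_succ_eq (hd x) j]
    exact (hPB a α t ht).eLpNorm_fderiv_le hη hn hd j

/-- The data of a solution at a fixed time. -/
def Sol.slice (h : Sol S T (cpt Φ)) (η : Sp n → ℝ) (p q : ℝ≥0∞) {t : ℝ} (ht : t ∈ Ioo 0 T) :
    Slice S η p q where
  u i γ := cpt Φ i γ t
  du μ i γ := pd μ (cpt Φ i γ) t
  a := pieceNorm η Φ p t
  b := pieceNorm η Φ q t
  e := pieceNorm η Φ ⊤ t
  major i α := ⟨(h.ub_two i α).nice ht, fun k => eLpNorm_proj_cpt_le k t i α p,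
    fun k => eLpNorm_proj_cpt_le k t i α q, fun k => eLpNorm_proj_cpt_le k t i α ⊤⟩
  differentiable i α := differentiable_slice (h.smooth_one i α) ht
  fderiv_eq j i α x := (pd_succ_eq (differentiable_slice (h.smooth_one i α) ht x) j).symm
  nice_du μ i α := (h.ub_pd μ i α).nice ht
  nice_mul i α j β := (h.ub_mul i j α β).nice ht
  curl i α β y := h.curl t ht y i α β
  div i y := h.div t ht y i

/-- The error term as a function of time. -/
def errorArr (hη : IsBump η) (S : Fin N → Fin N → Fin N → ℝ) (Φ : ℝ → Sp n → Arr N n ℝ) (t : ℝ)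
    (x : Sp n) : Arr N n ℂ :=
  fun a α => errF hη S (fun i γ => cpt Φ i γ t) (fun μ i γ => pd μ (cpt Φ i γ) t) a α x

/-- Yields the measurability of the error: its ingredients are convolutions of functions with slices
bounded in `L¹` or `L²`. -/
lemma Sol.continuousOn_errorArr (h : Sol S T (cpt Φ)) (hη : IsBump η) :
    ContinuousOn (Function.uncurry (errorArr hη S Φ)) (Ioo 0 T ×ˢ univ) := by
  refine continuousOn_pi.2 fun a => continuousOn_pi.2 fun α => ?_
  have hprod : ∀ μ b c β γ, UB T 1 fun t x => pd μ (cpt Φ b β) t x * cpt Φ c γ t x :=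
    fun μ b c β γ => UB.mul (h.ub_pd μ b β) (h.ub_two c γ)
  have hprod' : ∀ μ b c β γ, UB T 1 fun t x => cpt Φ b β t x * pd μ (cpt Φ c γ) t x :=
    fun μ b c β γ => UB.mul (h.ub_two b β) (h.ub_pd μ c γ)
  have h1 : UB T 1 fun t => inhom S (fun i γ => cpt Φ i γ t) (fun μ i γ => pd μ (cpt Φ i γ) t)
      a α :=
    (UB.sum le_rfl _ fun b _ => UB.sum le_rfl _ fun c _ => UB.sum le_rfl _ fun β _ =>
      ((hprod α b c β β).add le_rfl (hprod' α b c β β)).const_mul _).add le_rfl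
    (UB.sum le_rfl _ fun β _ => UB.const_mul (UB.sum le_rfl _ fun b _ => UB.sum le_rfl _ fun c _ =>
      ((hprod β b c α β).add le_rfl (hprod' β b c α β)).const_mul _) _)
  have h2 : ∀ b c β, ContinuousOn (fun z : ℝ × Sp n => (2 * conn S a c b * mink β : ℂ) *
      (cvl (kerLE hη (-10)) (cpt Φ c β z.1) z.2 * cvl (kerP hη 0) (pd β (cpt Φ b α) z.1) z.2))
      (Ioo 0 T ×ˢ univ) := fun b c β =>
    continuousOn_const.mul ((continuousOn_cvl (kerLE hη (-10)) (h.ub_two c β).sliceBdd_two).mul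
      (continuousOn_cvl (kerP hη 0) (h.ub_pd β b α).sliceBdd_two))
  exact (continuousOn_cvl (kerP hη 0) h1.sliceBdd_one).add
    (continuousOn_finsetSum _ fun b _ => continuousOn_finsetSum _ fun c _ =>
      continuousOn_finsetSum _ fun β _ => h2 b c β)

lemma eLpNorm_arr_le {F : Sp n → Arr N n ℂ} (hF : ∀ a α, Continuous fun x => F x a α) :
    eLpNorm F 2 volume ≤ ∑ a, ∑ α, eLpNorm (fun x => F x a α) 2 volume := by
  have h1 : ∀ x, ‖F x‖ ≤ ∑ a, ∑ α, ‖F x a α‖ := fun x => by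
    have h0 : ∀ a α, 0 ≤ ‖F x a α‖ := fun a α => norm_nonneg _
    refine (pi_norm_le_iff_of_nonneg (Finset.sum_nonneg fun a _ =>
      Finset.sum_nonneg fun α _ => h0 a α)).2 fun a => ?_
    refine le_trans ?_ (Finset.single_le_sum (f := fun a => ∑ α, ‖F x a α‖)
      (fun a _ => Finset.sum_nonneg fun α _ => h0 a α) (Finset.mem_univ a))
    exact (pi_norm_le_iff_of_nonneg (Finset.sum_nonneg fun α _ => h0 a α)).2 fun α =>
      Finset.single_le_sum (f := fun α => ‖F x a α‖) (fun α _ => h0 a α) (Finset.mem_univ α)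
  refine (eLpNorm_mono_real h1).trans ?_
  have hc : ∀ a, Continuous fun x => ∑ α, ‖F x a α‖ := fun a =>
    continuous_finsetSum _ fun α _ => (hF a α).norm
  have h2 := eLpNorm_sum_le (μ := (volume : Measure (Sp n))) (f := fun a x => ∑ α, ‖F x a α‖)
    (s := Finset.univ) (p := 2) (fun a _ => (hc a).aestronglyMeasurable) (by norm_num)
  have e2 : (∑ a, fun x => ∑ α, ‖F x a α‖) = fun x => ∑ a, ∑ α, ‖F x a α‖ := by
    funext x
    simp
  rw [e2] at h2
  refine h2.trans (Finset.sum_le_sum fun a _ => ?_)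
  have h3 := eLpNorm_sum_le (μ := (volume : Measure (Sp n))) (f := fun α x => ‖F x a α‖)
    (s := Finset.univ) (p := 2) (fun α _ => (hF a α).norm.aestronglyMeasurable) (by norm_num)
  have e3 : (∑ α, fun x => ‖F x a α‖) = fun x => ∑ α, ‖F x a α‖ := by
    funext x
    simp
  rw [e3] at h3
  simpa only [eLpNorm_norm] using h3

end FixedTime

section Conclusion

variable {N : ℕ} {S : Fin N → Fin N → Fin N → ℝ} {Φ : ℝ → Sp n → Arr N n ℝ} {T C ε σ A : ℝ}
  {c : ℤ → ℝ}

/-! ### The connection matrices -/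

/-- Exchanging the outer indices flips the sign of the term whose upper index is `d` and
interchanges the other two up to sign. -/
lemma conn_antisymm (hS : ∀ a b c, S a b c = -S a c b) (a b d : Fin N) :
    conn S b d a = -conn S a d b := by
  unfold conn
  linarith [hS b d a, hS a d b, hS d b a]

lemma Sol.connMatLow_eq (h : Sol S T (cpt Φ)) (hη : IsBump η) (μ : Fin (n + 1)) {t : ℝ}
    (ht : t ∈ Ioo 0 T) (x : Sp n) (a b : Fin N) :
    connMatLow η S Φ μ t x a b
      = ∑ d, (conn S a d b : ℂ) * cvl (kerLE hη (-10)) (cpt Φ d μ t) x := by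
  have e : (fun y => (connMat S Φ μ t y a b : ℂ))
      = fun y => ∑ d, (conn S a d b : ℂ) * cpt Φ d μ t y := by
    funext y
    simp [connMat, cpt]
  have hm : MemLp (fun y => ∑ d, (conn S a d b : ℂ) * cpt Φ d μ t y) 2 :=
    memLp_finsetSum _ fun d _ => ((h.ub_two d μ).nice ht).2.const_mul _
  rw [connMatLow, e, projLE_eq_cvl hη _ hm,
    cvl_sum _ _ fun d _ => ((h.ub_two d μ).nice ht).wint.const_mul _]
  exact Finset.sum_congr rfl fun d _ => cvl_const_mul _ _ _ _

lemma Sol.projLEArr_eq (h : Sol S T (cpt Φ)) (hη : IsBump η) (k : ℤ) (μ : Fin (n + 1)) {t : ℝ}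
    (ht : t ∈ Ioo 0 T) (x : Sp n) (d : Fin N) :
    projLEArr η k Φ t x d μ = cvl (kerLE hη k) (cpt Φ d μ t) x :=
  projLE_eq_cvl hη k ((h.ub_two d μ).nice ht).2 x

lemma Sol.connMatLow_transpose (h : Sol S T (cpt Φ)) (hη : IsBump η)
    (hS : ∀ a b c, S a b c = -S a c b) (μ : Fin (n + 1)) {t : ℝ} (ht : t ∈ Ioo 0 T) (x : Sp n) :
    (connMatLow η S Φ μ t x).transpose = -connMatLow η S Φ μ t x := by
  ext a b
  rw [Matrix.transpose_apply, Matrix.neg_apply, h.connMatLow_eq hη μ ht, h.connMatLow_eq hη μ ht,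
    ← Finset.sum_neg_distrib]
  refine Finset.sum_congr rfl fun d _ => ?_
  rw [conn_antisymm hS a b d]
  push_cast
  ring

/-! ### The equation for `P_0 Φ` -/

lemma Sol.projArr_eq (h : Sol S T (cpt Φ)) (hη : IsBump η) (k : ℤ) {t : ℝ} (ht : t ∈ Ioo 0 T)
    (x : Sp n) (a : Fin N) (α : Fin (n + 1)) :
    projArr η k Φ t x a α = cvl (kerP hη k) (cpt Φ a α t) x :=
  proj_eq_cvl hη k ((h.ub_two a α).nice ht).2 x

lemma Sol.contDiffOn_projArr (h : Sol S T (cpt Φ)) (hη : IsBump η) (k : ℤ) :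
    ContDiffOn ℝ 2 (Function.uncurry (projArr η k Φ)) (Ioo 0 T ×ˢ univ) :=
  contDiffOn_pi.2 fun a => contDiffOn_pi.2 fun α =>
    (h.contDiffOn_cvl (kerP hη k) a α).congr fun z hz => h.projArr_eq hη k hz.1 z.2 a α

lemma Sol.pd_projArr (h : Sol S T (cpt Φ)) (hη : IsBump η) (k : ℤ) (μ : Fin (n + 1)) {t : ℝ}
    (ht : t ∈ Ioo 0 T) (x : Sp n) (a : Fin N) (α : Fin (n + 1)) :
    pd μ (projArr η k Φ) t x a α = pd μ (fun t => cvl (kerP hη k) (cpt Φ a α t)) t x := by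
  rw [← pd_congr (fun s hs y => h.projArr_eq hη k hs y a α) ht x μ]
  exact (pd_clm (evalArr ℂ a α) (differentiableAt_slab
    ((h.contDiffOn_projArr hη k).of_le (by norm_num)) ht x) μ).symm

lemma Sol.box_projArr (h : Sol S T (cpt Φ)) (hη : IsBump η) (k : ℤ) {t : ℝ} (ht : t ∈ Ioo 0 T)
    (x : Sp n) (a : Fin N) (α : Fin (n + 1)) :
    box (projArr η k Φ) t x a α = box (fun t => cvl (kerP hη k) (cpt Φ a α t)) t x := by
  unfold box
  change evalArr ℂ a α (∑ μ, mink μ • pd μ (pd μ (projArr η k Φ)) t x) = _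
  rw [map_sum]
  refine Finset.sum_congr rfl fun μ _ => ?_
  have hpd : ContDiffOn ℝ 1 (Function.uncurry (pd μ (projArr η k Φ))) (Ioo 0 T ×ˢ univ) := by
    have := contDiffOn_pd (m := 1)
      (by simpa [one_add_one_eq_two] using h.contDiffOn_projArr hη k) μ
    simpa using this
  rw [map_smul, ← pd_clm (evalArr ℂ a α) (differentiableAt_slab hpd ht x) μ]
  congr 1
  exact pd_congr (fun s hs y => h.pd_projArr hη k μ hs y a α) ht x μ

/-- `errF` is defined as `P_0` of the full nonlinearity plus the paradifferential term, so the
identity only requires writing out the matrix product and commuting derivatives with the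
convolution. -/
lemma Sol.box_projArr_zero (h : Sol S T (cpt Φ)) (hη : IsBump η) {t : ℝ} (ht : t ∈ Ioo 0 T)
    (x : Sp n) (a : Fin N) (α : Fin (n + 1)) :
    box (projArr η 0 Φ) t x a α
      = -2 * ∑ μ, ∑ b, connMatLow η S Φ μ t x a b *
          ((mink μ : ℂ) * pd μ (projArr η 0 Φ) t x b α) + errorArr hη S Φ t x a α := by
  rw [h.box_projArr hη 0 ht, h.box_cvl _ a α ht]
  have e : ∑ μ, ∑ b, connMatLow η S Φ μ t x a b * ((mink μ : ℂ) * pd μ (projArr η 0 Φ) t x b α)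
      = ∑ b, ∑ c, ∑ β : Fin (n + 1), (conn S a c b * mink β : ℂ) *
      (cvl (kerLE hη (-10)) (cpt Φ c β t) x * cvl (kerP hη 0) (pd β (cpt Φ b α) t) x) := by
    rw [Finset.sum_comm]
    refine Finset.sum_congr rfl fun b _ => ?_
    rw [Finset.sum_comm]
    refine Finset.sum_congr rfl fun μ _ => ?_
    rw [h.connMatLow_eq hη μ ht, h.pd_projArr hη 0 μ ht, (h.adm b α).pd_cvl _ μ ht, Finset.sum_mul]
    refine Finset.sum_congr rfl fun d _ => ?_
    ring
  rw [e]
  unfold errorArr errF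
  simp_rw [mul_assoc (2 : ℂ), ← Finset.mul_sum]
  ring

/-! ### The bound for the error -/

lemma IsFreqEnvelope.le_of_sqrt_le (hc : IsFreqEnvelope σ A c)
    (h : Real.sqrt (∑' k, c k ^ 2) ≤ ε) (k : ℤ) : c k ≤ ε := by
  refine le_trans ?_ h
  refine Real.le_sqrt_of_sq_le ?_
  exact hc.sq_summable.le_tsum k fun j _ => sq_nonneg _

/-- At `(q, r) = (∞, ∞)` the bootstrap bound is `2 C c_k 2^k`, and `ε ≤ 1/(4C)` makes `2 C c_k ≤
1/2`. -/
lemma Bootstrap.ae_small (h : Bootstrap η T C c Φ) (hn : 5 ≤ n) (hC : 0 < C)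
    (hcε : ∀ k, c k ≤ ε) (hε : ε ≤ 1 / (4 * C)) :
    ∀ᵐ t ∂volume.restrict (Icc 0 T), ∀ k, pieceNorm η Φ ⊤ t k ≤ 2⁻¹ * dy k := by
  rw [ae_all_iff]
  intro k
  filter_upwards [h.ae_le hn le_top k] with t ht
  refine ht.trans (mul_le_mul' ?_ (le_of_eq ?_))
  · have h1 : 2 * C * c k ≤ 2⁻¹ := by
      calc 2 * C * c k ≤ 2 * C * (1 / (4 * C)) := by
            gcongr
            exact (hcε k).trans hε
        _ = 2⁻¹ := by
            field_simp
            norm_num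
    refine (ENNReal.ofReal_le_ofReal h1).trans_eq ?_
    rw [ENNReal.ofReal_inv_of_pos (by norm_num)]
    simp
  · rw [dy_eq_rpow]
    simp

lemma Sol.aemeasurable_pieceNorm (h : Sol S T (cpt Φ)) (hη : IsBump η) (k : ℤ) {p : ℝ≥0∞}
    (h0 : p ≠ 0) (ht : p ≠ ⊤) :
    AEMeasurable (fun t => pieceNorm η Φ p t k) (volume.restrict (Icc 0 T)) :=
  aemeasurable_eLpNorm_slab (h.contDiffOn_projArr hη k).continuousOn h0 ht

/-- The error is acceptable, provided the constants are chosen appropriately. -/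
lemma Sol.mixedNorm_errorArr_le (h : Sol S T (cpt Φ)) (hB : Bootstrap η T C c Φ) (hη : IsBump η)
    (hn : 5 ≤ n) (hC : 0 < C) (hc : IsFreqEnvelope σ A c) (hcε : ∀ k, c k ≤ ε) (hε0 : 0 ≤ ε)
    (hε : ε ≤ 1 / (4 * C)) {κ : Fin N → Fin (n + 1) → ℝ≥0}
    (hκ : ∀ a α, ∀ D : Slice S η (expP n) (expQ n), Continuous (errF hη S D.u D.du a α) ∧
      eLpNorm (errF hη S D.u D.du a α) 2 volume ≤ κ a α * D.bound) :
    mixedNorm T 1 2 (errorArr hη S Φ) ≤ (∑ a, ∑ α, (κ a α : ℝ≥0∞)) * (2 *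
      (ENNReal.ofReal (4 * C ^ 2 * ε * (|A| * c 0)) *
        ∑' i, ∑' j, zSum (gamL n) (betH n) σ i j)) := by
  rw [mixedNorm, eLpNorm_one_eq_lintegral_enorm]
  have hK : (∑ a, ∑ α, (κ a α : ℝ≥0∞)) ≠ ⊤ :=
    ENNReal.sum_ne_top.2 fun a _ => ENNReal.sum_ne_top.2 fun α _ => ENNReal.coe_ne_top
  have hae : ∀ᵐ t ∂volume.restrict (Icc 0 T), t ∈ Ioo 0 T := by
    rw [← Measure.restrict_congr_set (Ioo_ae_eq_Icc (a := (0 : ℝ)) (b := T) (μ := volume))]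
    exact ae_restrict_mem measurableSet_Ioo
  calc ∫⁻ t in Icc 0 T, ‖eLpNorm (errorArr hη S Φ t) 2 volume‖ₑ
      ≤ ∫⁻ t in Icc 0 T, (∑ a, ∑ α, (κ a α : ℝ≥0∞)) * (2 *
        ∑' i, ∑' j, gSum (pieceNorm η Φ (expP n) t) (pieceNorm η Φ (expQ n) t) i j) := by
        refine lintegral_mono_ae ?_
        filter_upwards [hae, hB.ae_small hn hC hcε hε] with t ht hs
        rw [enorm_eq_self]
        set D := h.slice η (expP n) (expQ n) ht
        -- One copy of the bilinear sum for the bilinear terms and one that dominates the cubic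
        -- terms.
        have hb : D.bound ≤ 2 * ∑' i, ∑' j,
            gSum (pieceNorm η Φ (expP n) t) (pieceNorm η Φ (expQ n) t) i j := by
          rw [two_mul]
          exact add_le_add le_rfl (tsum_hSum_le hs)
        refine (eLpNorm_arr_le fun a α => (hκ a α D).1).trans ?_
        rw [Finset.sum_mul]
        refine Finset.sum_le_sum fun a _ => ?_
        rw [Finset.sum_mul]
        exact Finset.sum_le_sum fun α _ => ((hκ a α D).2).trans (by gcongr)
    _ = (∑ a, ∑ α, (κ a α : ℝ≥0∞)) * (2 * ∫⁻ t in Icc 0 T,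
        ∑' i, ∑' j, gSum (pieceNorm η Φ (expP n) t) (pieceNorm η Φ (expQ n) t) i j) := by
        rw [lintegral_const_mul' _ _ hK, lintegral_const_mul' _ _ (by norm_num)]
    _ ≤ _ := by
        gcongr
        exact lintegral_gSum_le hB hn hC hcε hε0 hc
          fun k p h0 ht => h.aemeasurable_pieceNorm hη k h0 ht

end Conclusion

end WaveMaps

end

/-! ### Choice of the constants and conclusion. -/

theorem mainTheorem5 (n N : ℕ) (hn : 5 ≤ n)
    (S : Fin N → Fin N → Fin N → ℝ) (hS : ∀ a b c, S a b c = -S a c b)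
    (η : WaveMaps.Sp n → ℝ) (hη : WaveMaps.IsBump η)
    (σ A : ℝ) (hσ : 0 < σ) (hσ' : σ < min (1 / 2) (((n : ℝ) - 4) / 4)) :
    ∃ C₀ : ℝ, 0 < C₀ ∧ ∀ C : ℝ, C₀ ≤ C → ∃ ε₀ : ℝ, 0 < ε₀ ∧ ∀ ε : ℝ, 0 < ε → ε ≤ ε₀ →
      ∀ c : ℤ → ℝ, WaveMaps.IsFreqEnvelope σ A c → Real.sqrt (∑' k, c k ^ 2) ≤ ε →
      ∀ T : ℝ, 0 < T → ∀ Φ : ℝ → WaveMaps.Sp n → WaveMaps.Arr N n ℝ,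
        ContDiffOn ℝ 2 (Function.uncurry Φ) (Ioo 0 T ×ˢ univ) →
        (∃ M : ℝ≥0, ∀ t ∈ Ioo 0 T, eLpNorm (Φ t) 2 volume ≤ M) →
        WaveMaps.SolvesDivCurl S T Φ →
        WaveMaps.Bootstrap η T C c Φ →
        ContDiffOn ℝ 2 (Function.uncurry (WaveMaps.projArr η 0 Φ)) (Ioo 0 T ×ˢ univ) ∧
        (∀ t ∈ Ioo 0 T, ∀ (x : WaveMaps.Sp n) (μ : Fin (n + 1)),
          (∀ a b, WaveMaps.connMatLow η S Φ μ t x a b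
            = ∑ d, (WaveMaps.conn S a d b : ℂ) * WaveMaps.projLEArr η (-10) Φ t x d μ) ∧
          (WaveMaps.connMatLow η S Φ μ t x).transpose = -WaveMaps.connMatLow η S Φ μ t x) ∧
        ∃ F : ℝ → WaveMaps.Sp n → WaveMaps.Arr N n ℂ,
          WaveMaps.AcceptableError T C ε c F ∧
          ∀ t ∈ Ioo 0 T, ∀ (x : WaveMaps.Sp n) (a : Fin N) (α : Fin (n + 1)),
            WaveMaps.box (WaveMaps.projArr η 0 Φ) t x a α
              = -2 * ∑ μ, ∑ b, WaveMaps.connMatLow η S Φ μ t x a b *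
                  ((WaveMaps.mink μ : ℂ) * WaveMaps.pd μ (WaveMaps.projArr η 0 Φ) t x b α)
                + F t x a α := by
  have : NeZero n := ⟨by lia⟩
  have := WaveMaps.holderTriple_expP_expQ hn
  have h1P : 1 ≤ WaveMaps.expP n := le_trans (by norm_num) (WaveMaps.two_le_expP hn)
  have h1Q : 1 ≤ WaveMaps.expQ n := le_trans (by norm_num) (WaveMaps.two_le_expQ hn)
  -- These constants are uniform over all slices, and are fixed before `C`, `ε`, `c`, `T` and `Φ`.
  choose κ hκ using fun (a : Fin N) (α : Fin (n + 1)) =>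
    WaveMaps.controlled_errF (S := S) h1P h1Q hη hS a α
  have hσ4 : σ < ((n : ℝ) - 4) / 4 := hσ'.trans_le (min_le_right _ _)
  have hZ : ∑' i, ∑' j, WaveMaps.zSum (WaveMaps.gamL n) (WaveMaps.betH n) σ i j ≠ ⊤ :=
    WaveMaps.tsum_zSum_ne_top (WaveMaps.gamL_pos hn) hσ.le (by
      rw [WaveMaps.gamL_sub_betH hn]
      linarith)
  set Z := ∑' i, ∑' j, WaveMaps.zSum (WaveMaps.gamL n) (WaveMaps.betH n) σ i j
  set K : ℝ≥0 := ∑ a, ∑ α, κ a α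
  have hK : ∑ a, ∑ α, (κ a α : ℝ≥0∞) = ENNReal.ofReal K := by
    rw [ENNReal.ofReal_coe_nnreal]
    simp [K]
  -- The `8` is the `2` from bilinear plus cubic terms times the `4` from two bootstrap factors
  -- `2C`; the `1` ensures positivity. One of the three powers of `C` in the goal absorbs this
  -- constant.
  refine ⟨8 * K * |A| * Z.toReal + 1, by positivity, fun C hC => ?_⟩
  have hC0 : 0 < C := lt_of_lt_of_le (by positivity) hC
  -- Smallness of `ε` is needed only to bound the lowest factor of the cubic terms.
  refine ⟨1 / (4 * C), by positivity, fun ε hε hεC c hc hcε T _ Φ hΦ hM hdc hB => ?_⟩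
  obtain ⟨M, hM⟩ := hM
  have hck := hc.le_of_sqrt_le hcε
  have hsol := hB.sol hη hn hΦ hM hdc hC0.le hck
  refine ⟨hsol.contDiffOn_projArr hη 0, fun t ht x μ => ⟨fun a b => ?_,
    hsol.connMatLow_transpose hη hS μ ht x⟩, WaveMaps.errorArr hη S Φ, ⟨?_, ?_⟩,
    fun t ht x a α => hsol.box_projArr_zero hη ht x a α⟩
  · rw [hsol.connMatLow_eq hη μ ht]
    exact Finset.sum_congr rfl fun d _ => by rw [hsol.projLEArr_eq hη _ μ ht]
  · exact WaveMaps.aestronglyMeasurable_slab (hsol.continuousOn_errorArr hη)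
  · refine (hsol.mixedNorm_errorArr_le hB hη hn hC0 hc hck hε.le hεC hκ).trans ?_
    have h0 := hc.nonneg 0
    rw [hK]
    change _ * (2 * (_ * Z)) ≤ _
    rw [← ENNReal.ofReal_toReal hZ, ← ENNReal.ofReal_mul (by positivity),
      show (2 : ℝ≥0∞) = ENNReal.ofReal 2 by simp, ← ENNReal.ofReal_mul (by norm_num),
      ← ENNReal.ofReal_mul (by positivity)]
    refine ENNReal.ofReal_le_ofReal ?_
    calc (K : ℝ) * (2 * (4 * C ^ 2 * ε * (|A| * c 0) * Z.toReal))
        = (8 * K * |A| * Z.toReal) * (C ^ 2 * ε * c 0) := by ring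
      _ ≤ C * (C ^ 2 * ε * c 0) := by
          gcongr
          linarith
      _ = C ^ 3 * ε * c 0 := by ring
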